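/- **Setting.** Let $d,\tau,B\ge 1$ be integers, $L,\mu>0$, $\sigma_1,\Delta\ge 0$. Let $f:\mathbb R^d\to\mathbb R$ be $L$-smooth and $\mu$-strongly convex with minimizer $x^*$. Let $\mathrm Q$ be a Markov kernel on a space $\mathsf Z$ with invariant distribution $\pi$ and $\sup_{z,z'}\tfrac12\|\mathrm Q^k(z,\cdot)-\mathrm Q^k(z',\cdot)\|_{TV}\le (1/4)^{\lfloor k/\tau\rfloor}$ for all $k\in\mathbb N$. Let $F:\mathbb R^d\times\mathsf Z\to\mathbb R$ satisfy $\mathbb E_{Z\sim\pi}F(x,Z)=f(x)$ and $|F(x,z)-f(x)|\le\sigma_1$ for all $x,z$. The oracle returns $\hat F(x,z)=F(x,z)+\delta(x)$ with a deterministic error $|\delta(x)|\le\Delta$. Successive oracle calls use successive states $Z_0,Z_1,\dots$ of the Markov chain with kernel $\mathrm Q$ and arbitrary initial distribution (for instance $\pi$). **Estimator.** At a point $x$, let $Z_i^+,Z_i^-$ ($i\ge1$) be the next consecutive chain states (two per $i$), let $e_i$ be i.i.d. uniform on the unit sphere, and put $\hat g_{rd}[n]=\frac1n\sum_{i=1}^n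 d\,\frac{\hat F(x+te_i,Z_i^+)-\hat F(x-te_i,Z_i^-)}{2t}e_i$. With $\mathbb P(J=j)=2^{-j}$, $j\ge 1$, put $\hat g_{ml}=\hat g_{rd}[l]+\mathbf 1\{2^J\le M\}\,2^J(\hat g_{rd}[2^Jl]-\hat g_{rd}[2^{J-1}l])$. All the $\hat g_{rd}$ in it use initial segments of the same sample, so computing $\hat g_{ml}$ costs $2\cdot 2^Jl$ oracle calls if $2^J\le M$ and $2l$ otherwise. Levels and directions are fresh in each iteration and independent of the chain. **Algorithm.** Given $\gamma\in(0,\frac{3}{4L}]$, $t>0$, $p\in(0,1]$, put $\beta=\sqrt{4p^2\mu\gamma/3}$, $\eta=\sqrt{3/(\mu\gamma)}$, $\theta=\frac{p\eta^{-1}-1}{\beta p\eta^{-1}-1}$, $M=\frac1p+\frac2\beta$, $l=(\lfloor\log_2M\rfloor+1)B$. Starting from $x_f^0=x^0$, iterate $x_g^k=\theta x_f^k+(1-\theta)x^k$, $\hat g^k=\hat g_{ml}(x_g^k)$, $x_f^{k+1}=x_g^k-p\gamma\hat g^k$, $x^{k+1}=\eta x_f^{k+1}+(p-\eta)x_f^k+(1-p)(1-\beta)x^k+(1-p)\beta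 x_g^k$. Put $r^k=\frac1\mu(f(x_f^k)-f(x^*))+\|x^k-x^*\|^2$. **Theorem.** There are universal constants $c_1\in(0,1]$, $c_2,C>0$ and a universal polynomial $P$ such that, with $p=c_1\frac{B}{B+d}$, the following hold. (i) For all $\gamma\in(0,\frac3{4L}]$, $t>0$, $N\in\mathbb N$ and every problem as above, $$\mathbb E\,r^N\le C\Big[e^{-\sqrt{p^2\mu\gamma N^2/3}}\,r^0+\frac{p\sqrt\gamma}{\mu^{3/2}}\Big(\frac{d(d+\tau)\sigma_1^2}{t^2B}+\frac{t^2L^2d^2}{B}\Big)+\frac{\Delta^2d^2}{\mu^2t^2}+\frac{Lt^2}{\mu}\Big].$$ (ii) Fix $d,\tau,B,L,\mu,\sigma_1$ and $R\ge0$. There is $\varepsilon_0>0$ such that for every $\varepsilon\in(0,\varepsilon_0)$ there are $\gamma\in(0,\frac3{4L}]$, $t>0$ and $N$ such that for every problem as above with $\|x^0-x^*\|\le R$ and $\Delta\le c_2\frac{\varepsilon\mu^{3/2}}{d\sqrt L}$ (in particular for $\Delta=0$) one has $\mathbb E\|x^N-x^*\|^2\le\varepsilon$ and $\mathbb E\,r^N\le\varepsilon$,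 and the expected number of one-point oracle calls made in the $N$ iterations is at most $$B\cdot P(\log S)\,S,\qquad S=\max\Big[1,\frac dB\Big]\sqrt{\frac L\mu}\,\log\frac1\varepsilon+\frac{L\,d(d+\tau)\,\sigma_1^2}{B\mu^3\varepsilon^2}.$$ -/

import Mathlib

open MeasureTheory ProbabilityTheory

noncomputable section

/-! ### Assumptions on the objective, the noise chain and the oracle -/

/-- `ℝᵈ` with the Euclidean norm. -/
abbrev Vec (d : ℕ) : Type := EuclideanSpace ℝ (Fin d)

/-- `f` is differentiable with `L`-Lipschitz gradient. -/
def IsLSmooth {d : ℕ} (L : ℝ) (f : Vec d → ℝ) : Prop :=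
  Differentiable ℝ f ∧ ∀ x y, ‖gradient f x - gradient f y‖ ≤ L * ‖x - y‖

/-- `f` is continuously differentiable and `μ`-strongly convex. -/
def IsStronglyConvex {d : ℕ} (μ : ℝ) (f : Vec d → ℝ) : Prop :=
  ContDiff ℝ 1 f ∧
    ∀ x y, μ / 2 * ‖x - y‖ ^ 2 ≤ f x - f y - inner ℝ (gradient f y) (x - y)

/-- Total variation distance of two probability measures, i.e. one half of the total variation
norm of their difference. -/
def tvDist {Z : Type*} [MeasurableSpace Z] (ν ρ : Measure Z) : ℝ :=
  ⨆ A : {A : Set Z // MeasurableSet A}, |ν.real A.1 - ρ.real A.1|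

/-- Dobrushin coefficient of a Markov kernel. -/
def dobrushin {Z : Type*} [MeasurableSpace Z] (K : Kernel Z Z) : ℝ :=
  ⨆ q : Z × Z, tvDist (K q.1) (K q.2)

/-- `π` is invariant for `Q`, and `Q` is uniformly geometrically ergodic with mixing time `τ`.
(Uniqueness of the invariant distribution is a consequence.) -/
structure IsUniformlyErgodic {Z : Type*} [MeasurableSpace Z] (Q : Kernel Z Z) (π : Measure Z)
    (τ : ℕ) : Prop where
  invariant : Kernel.Invariant Q π
  mixing : ∀ k : ℕ, dobrushin (Q ^ k) ≤ (1 / 4 : ℝ) ^ (k / τ)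

/-- `F` is an unbiased oracle for `f` under `π`, with error uniformly bounded by `σ`. -/
structure IsOnePointOracle {Z : Type*} [MeasurableSpace Z] {d : ℕ} (π : Measure Z) (σ : ℝ)
    (F : Vec d → Z → ℝ) (f : Vec d → ℝ) : Prop where
  measurable : Measurable (Function.uncurry F)
  unbiased : ∀ x, ∫ z, F x z ∂π = f x
  bounded : ∀ x z, |F x z - f x| ^ 2 ≤ σ ^ 2

/-- All standing assumptions: `f` is smooth and strongly convex with minimizer `xs`, the noise
kernel `Q` mixes, `F` is a one-point oracle for `f`, and `δ` is a deterministic additive error of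
size at most `Δ`. -/
structure IsProblem {Z : Type*} [MeasurableSpace Z] {d : ℕ} (L μ σ Δ : ℝ) (τ : ℕ)
    (Q : Kernel Z Z) (π : Measure Z) (F : Vec d → Z → ℝ) (δ f : Vec d → ℝ) (xs : Vec d) :
    Prop where
  smooth : IsLSmooth L f
  stronglyConvex : IsStronglyConvex μ f
  ergodic : IsUniformlyErgodic Q π τ
  oracle : IsOnePointOracle π σ F f
  perturbation_measurable : Measurable δ
  perturbation_bounded : ∀ x, |δ x| ≤ Δ
  minimizer : ∀ x, f xs ≤ f x

/-! ### Gradient estimators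

`z 0, z 1, …` are the successive noise states (one per oracle call) and `e 0, e 1, …` the successive
directions. Sample `i` uses `z (2 * i)` at `x + t e i` and `z (2 * i + 1)` at `x - t e i`. -/

/-- Single-sample one-point estimator `d (O(x + te, z⁺) - O(x - te, z⁻)) / (2t) · e`. -/
def gHat {Z : Type*} {d : ℕ} (O : Vec d → Z → ℝ) (t : ℝ) (x e : Vec d) (zp zm : Z) : Vec d :=
  ((d : ℝ) * ((O (x + t • e) zp - O (x - t • e) zm) / (2 * t))) • e

/-- Random-direction estimator with `n` samples. -/
def gRD {Z : Type*} {d : ℕ} (O : Vec d → Z → ℝ) (t : ℝ) (n : ℕ) (x : Vec d)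
    (z : ℕ → Z) (e : ℕ → Vec d) : Vec d :=
  (n : ℝ)⁻¹ • ∑ i ∈ Finset.range n, gHat O t x (e i) (z (2 * i)) (z (2 * i + 1))

open Classical in
/-- Multilevel Monte Carlo estimator with (random) level `j`, base batch `l`, limit `M`. -/
def gML {Z : Type*} {d : ℕ} (O : Vec d → Z → ℝ) (t M : ℝ) (l j : ℕ) (x : Vec d)
    (z : ℕ → Z) (e : ℕ → Vec d) : Vec d :=
  gRD O t l x z e +
    if (2 : ℝ) ^ j ≤ M then
      (2 : ℝ) ^ j • (gRD O t (2 ^ j * l) x z e - gRD O t (2 ^ (j - 1) * l) x z e)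
    else 0

open Classical in
/-- Number of samples used by `gML`; each costs two oracle calls. -/
def batchSize (M : ℝ) (l j : ℕ) : ℕ := if (2 : ℝ) ^ j ≤ M then 2 ^ j * l else l

/-! ### The algorithm -/

/-- Hyperparameters: strong convexity constant, stepsize, approximation step, momentum parameter,
batch size multiplier. -/
structure Hyper where
  μ : ℝ
  γ : ℝ
  t : ℝ
  p : ℝ
  B : ℕ

namespace Hyper

def β (h : Hyper) : ℝ := Real.sqrt (4 * h.p ^ 2 * h.μ * h.γ / 3)
def η (h : Hyper) : ℝ := Real.sqrt (3 / (h.μ * h.γ))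
def θ (h : Hyper) : ℝ := (h.p * h.η⁻¹ - 1) / (h.β * h.p * h.η⁻¹ - 1)
def M (h : Hyper) : ℝ := 1 / h.p + 2 / h.β
def l (h : Hyper) : ℕ := (⌊Real.logb 2 h.M⌋₊ + 1) * h.B

/-- Hyperparameters with the momentum parameter `p = c B / (B + d)`. -/
def ofScale (c μ γ t : ℝ) (d B : ℕ) : Hyper where
  μ := μ
  γ := γ
  t := t
  p := c * (B / (B + d))
  B := B

end Hyper

/-- Iterates `x^k`, `x_f^k` and the number of one-point oracle calls made so far. -/
structure State (d : ℕ) where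
  x : Vec d
  xf : Vec d
  calls : ℕ

/-- `k` iterations of the randomized accelerated zero-order method from `x0` with oracle `O`,
noise path `z`, levels `J` and directions `e`. Every oracle call moves one step along `z`. -/
def run {Z : Type*} {d : ℕ} (h : Hyper) (O : Vec d → Z → ℝ) (x0 : Vec d)
    (z : ℕ → Z) (J : ℕ → ℕ) (e : ℕ → ℕ → Vec d) : ℕ → State d
  | 0 => ⟨x0, x0, 0⟩
  | k + 1 =>
    let s := run h O x0 z J e k
    let xg := h.θ • s.xf + (1 - h.θ) • s.x
    let g := gML O h.t h.M h.l (J k) xg (fun i => z (s.calls + i)) (e k)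
    let xf' := xg - (h.p * h.γ) • g
    { x := h.η • xf' + (h.p - h.η) • s.xf + ((1 - h.p) * (1 - h.β)) • s.x
        + ((1 - h.p) * h.β) • xg
      xf := xf'
      calls := s.calls + 2 * batchSize h.M h.l (J k) }

/-! ### Randomness -/

/-- Law on path space of the Markov chain with kernel `Q` and initial distribution `ξ`. -/
def chainLaw {Z : Type*} [MeasurableSpace Z] (ξ : Measure Z) (Q : Kernel Z Z)
    [IsMarkovKernel Q] : Measure (ℕ → Z) :=
  Kernel.trajMeasure (X := fun _ => Z) ξ
    (fun n => Q.comap (fun path : (i : Finset.Iic n) → Z => path ⟨n, by simp⟩)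
      (measurable_pi_apply _))

/-- Geometric law on `{1, 2, …}`: mass `2⁻ʲ` at `j`. -/
def levelLaw : Measure ℕ :=
  Measure.sum fun n : ℕ => ENNReal.ofReal ((1 / 2 : ℝ) ^ (n + 1)) • Measure.dirac (n + 1)

/-- Uniform distribution on the unit sphere of `ℝᵈ`. -/
def sphereLaw (d : ℕ) : Measure (Metric.sphere (0 : Vec d) 1) :=
  ((volume : Measure (Vec d)).toSphere Set.univ)⁻¹ • (volume : Measure (Vec d)).toSphere

/-- Sample space: noise path, levels, and directions indexed by (iteration, sample). -/
abbrev Sample (Z : Type*) (d : ℕ) : Type _ :=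
  (ℕ → Z) × (ℕ → ℕ) × (ℕ × ℕ → Metric.sphere (0 : Vec d) 1)

/-- The chain, the i.i.d. levels and the i.i.d. directions are independent of each other. -/
def sampleLaw {Z : Type*} [MeasurableSpace Z] (d : ℕ) (ξ : Measure Z) (Q : Kernel Z Z)
    [IsMarkovKernel Q] : Measure (Sample Z d) :=
  (chainLaw ξ Q).prod
    ((Measure.infinitePi fun _ : ℕ => levelLaw).prod
      (Measure.infinitePi fun _ : ℕ × ℕ => sphereLaw d))

/-- State after `k` iterations as a random variable; the algorithm sees the oracle
`F(x, z) + δ(x)`. -/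
def iter {Z : Type*} {d : ℕ} (h : Hyper) (F : Vec d → Z → ℝ) (δ : Vec d → ℝ) (x0 : Vec d)
    (k : ℕ) (ω : Sample Z d) : State d :=
  run h (fun x z => F x z + δ x) x0 ω.1 ω.2.1 (fun k i => (ω.2.2 (k, i) : Vec d)) k

/-- Error measure `(f(x_f) - f(x*)) / μ + ‖x - x*‖²`. -/
def errR {d : ℕ} (μ : ℝ) (f : Vec d → ℝ) (xs : Vec d) (s : State d) : ℝ :=
  1 / μ * (f s.xf - f xs) + ‖s.x - xs‖ ^ 2

/-! ### Bounds -/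

/-- `max[1, d/B] √(L/μ) log(1/ε) + L d (d + τ) σ² / (B μ³ ε²)`. -/
def rateS (d B τ : ℕ) (L μ σ ε : ℝ) : ℝ :=
  max 1 ((d : ℝ) / B) * Real.sqrt (L / μ) * Real.log (1 / ε)
    + L * d * (d + τ) * σ ^ 2 / (B * μ ^ 3 * ε ^ 2)

/-- Right-hand side of the error bound after `N` iterations, `r0` being the initial error. -/
def errBound (d τ N : ℕ) (L σ Δ r0 : ℝ) (h : Hyper) : ℝ :=
  Real.exp (-Real.sqrt (h.p ^ 2 * h.μ * h.γ * N ^ 2 / 3)) * r0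
    + h.p * Real.sqrt h.γ / h.μ ^ (3 / 2 : ℝ) *
        (σ ^ 2 * (d * (d + τ)) / (h.t ^ 2 * h.B) + h.t ^ 2 * (L ^ 2 * d ^ 2 / h.B))
    + Δ ^ 2 * d ^ 2 / (h.μ ^ 2 * h.t ^ 2) + L * h.t ^ 2 / h.μ

end

/-! ### The uniform law on the sphere -/

open Metric Set Filter Topology
open scoped Pointwise

variable {d : ℕ}

/-! Let f_t be the average of f over the ball of radius t. By the divergence theorem the gradient of
f_t is a sphere average of f. So a two-point sample, averaged over its direction, is ∇f_t plus a
perturbation of size at most dΔ/t plus a direction average of the observation noise. Convexity and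
smoothness give 0 ≤ f_t − f ≤ Lt²/2, and f_t inherits the quadratic upper and lower bounds of f. The
method is therefore an accelerated gradient method for f_t with inexact gradients.

Error of one batch (`IsProblem.lintegral_gRD_sub_sq_le`). Given the noise path the directions are
independent, so the mean square error is at most a variance plus a squared mean. The variance per
sample is of order d‖∇f_t‖² + d²(L²t² + σ²/t² + Δ²/t²). The mean is a sum along the chain of
direction-averaged noise; isotropy reduces the size of each term from dσ to √d σ, and mixing makes
the correlations summable at the price of a factor τ. Together this produces d(d+τ)σ²/t².

Multilevel correction. Let m be the largest active level. Averaging over the level alone, with path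
and directions frozen, telescopes to the estimator of batch 2^m l. The bias term is bounded by the
mean square error of that batch, of order 1/(2^m l) ≤ β/B, because 2^(m+1) > M ≥ 2/β. In the second
moment every level contributes the same order 1/l, in total (m+1)/l = 1/B, and the step inequality
multiplies this by β. No conditional mean along the chain is needed: once the levels are frozen, the
number of past calls is deterministic and the query point is a function of the states already
consumed.

Contraction. `accelerated_step` is a deterministic inequality: the potential contracts by 1 − β/2,
up to the terms above and minus a multiple of ‖∇f_t‖² carrying a factor 1/p. With p of order B/(B+d)
this negative term absorbs the part d‖∇f_t‖²/B of the estimator error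
(`IsProblem.lintegral_potential_succ_le`). Summing the geometric recursion gives part (i).

Complexity. Take t² of order εμ/L, γ the smaller of 3/(4L) and the value making the variance term
ε/(4C), and N about (2/β) log(1/ε). Then 2/β is bounded by √(L/μ)/p, a statistical term of order
1/ε², and a term Ld²/(μB) free of ε, up to constants; for small ε the last one and the surplus
logarithms are swallowed by powers of log S. One iteration costs at most 2B(m+1)² expected calls,
with m logarithmic in S. -/

theorem sphereLaw_map {d : ℕ} (hd : 0 < d) :
    (sphereLaw d).map Subtype.val =
      (volume (ball (0 : Vec d) 1))⁻¹ •
        (volume.restrict (ball (0 : Vec d) 1)).map (fun u => ‖u‖⁻¹ • u) := by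
  have hm : Measurable (fun u : Vec d => ‖u‖⁻¹ • u) := by fun_prop
  ext s hs
  rw [Measure.map_apply measurable_subtype_coe hs, sphereLaw, Measure.smul_apply,
    Measure.smul_apply, Measure.map_apply hm hs, Measure.restrict_apply (hm hs),
    Measure.toSphere_apply_univ, Measure.toSphere_apply' _ (measurable_subtype_coe hs)]
  have hd0 : (Module.finrank ℝ (Vec d) : ENNReal) ≠ 0 := by simpa using hd.ne'
  -- `toSphere` measures a set by the volume of the open cone over it. That cone is the preimage
  -- under normalisation inside the ball, except for the origin, which is null.
  have hset : volume (Ioo (0 : ℝ) 1 • (Subtype.val '' (Subtype.val ⁻¹' s : Set (sphere (0 : Vec d) 1)))) =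
      volume ((fun u : Vec d => ‖u‖⁻¹ • u) ⁻¹' s ∩ ball 0 1) := by
    have h1 : Ioo (0 : ℝ) 1 • (Subtype.val '' (Subtype.val ⁻¹' s : Set (sphere (0 : Vec d) 1))) =
        ((fun u : Vec d => ‖u‖⁻¹ • u) ⁻¹' s ∩ ball 0 1) \ {0} := by
      ext u
      simp only [Set.mem_smul, mem_image, mem_preimage, Subtype.exists, mem_sphere_iff_norm,
        sub_zero, mem_inter_iff, Set.mem_sdiff, mem_singleton_iff, mem_ball_zero_iff]
      constructor
      · rintro ⟨r, ⟨hr0, hr1⟩, y, ⟨y', hy', hys, rfl⟩, rfl⟩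
        have hn : ‖r • y'‖ = r := by rw [norm_smul, hy', mul_one, Real.norm_of_nonneg hr0.le]
        refine ⟨⟨?_, by rw [hn]; exact hr1⟩, ?_⟩
        · rw [hn, smul_smul, inv_mul_cancel₀ hr0.ne', one_smul]; exact hys
        · exact norm_ne_zero_iff.1 (by rw [hn]; exact hr0.ne')
      · rintro ⟨⟨h1, h2⟩, h3⟩
        have hp : 0 < ‖u‖ := norm_pos_iff.2 h3
        refine ⟨‖u‖, ⟨hp, h2⟩, ‖u‖⁻¹ • u, ⟨_, ?_, h1, rfl⟩, ?_⟩
        · rw [norm_smul, norm_inv, norm_norm, inv_mul_cancel₀ hp.ne']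
        · rw [smul_smul, mul_inv_cancel₀ hp.ne', one_smul]
    rw [h1]
    refine measure_sdiff_null ?_
    have : Nontrivial (Vec d) := by
      have : Nonempty (Fin d) := ⟨⟨0, hd⟩⟩
      infer_instance
    exact measure_singleton 0
  rw [hset, smul_eq_mul, smul_eq_mul, ENNReal.mul_inv (Or.inl hd0) (Or.inl (by simp)),
    mul_comm (Module.finrank ℝ (Vec d) : ENNReal)⁻¹, mul_assoc, ← mul_assoc _ _ (volume _),
    ENNReal.inv_mul_cancel hd0 (by simp), one_mul]

theorem isProbabilityMeasure_sphereLaw {d : ℕ} (hd : 0 < d) :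
    IsProbabilityMeasure (sphereLaw d) := by
  constructor
  have : Nontrivial (Vec d) := by
    have : Nonempty (Fin d) := ⟨⟨0, hd⟩⟩
    infer_instance
  rw [sphereLaw, Measure.smul_apply, smul_eq_mul]
  refine ENNReal.inv_mul_cancel ?_ (measure_ne_top _ _)
  rw [Ne, Measure.measure_univ_eq_zero]
  exact Measure.toSphere_ne_zero _


/-- Makes the sphere accessible through Lebesgue measure: isometry invariance and the divergence
theorem are then facts about balls. -/
theorem integral_sphereLaw {E : Type*} [NormedAddCommGroup E] [NormedSpace ℝ E] (hd : 0 < d)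
    {g : Vec d → E} (hg : StronglyMeasurable g) :
    ∫ e, g e ∂sphereLaw d =
      (volume.real (ball (0 : Vec d) 1))⁻¹ • ∫ u in ball (0 : Vec d) 1, g (‖u‖⁻¹ • u) := by
  rw [← integral_map (φ := Subtype.val) measurable_subtype_coe.aemeasurable
    hg.aestronglyMeasurable, sphereLaw_map hd, integral_smul_measure,
    integral_map (by fun_prop) hg.aestronglyMeasurable, ENNReal.toReal_inv, measureReal_def]

theorem integral_sphereLaw_comp_isometry {E : Type*} [NormedAddCommGroup E] [NormedSpace ℝ E]
    (hd : 0 < d) {g : Vec d → E} (hg : StronglyMeasurable g) (T : Vec d ≃ₗᵢ[ℝ] Vec d) :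
    ∫ e, g (T e) ∂sphereLaw d = ∫ e, g e ∂sphereLaw d := by
  rw [integral_sphereLaw hd hg, integral_sphereLaw (g := fun e => g (T e)) hd
    (hg.comp_measurable T.continuous.measurable)]
  congr 1
  have h := T.measurePreserving.setIntegral_preimage_emb
    T.toHomeomorph.toMeasurableEquiv.measurableEmbedding (fun u => g (‖u‖⁻¹ • u)) (ball 0 1)
  rw [← h, T.preimage_ball]
  simp

theorem integral_sphereLaw_neg {E : Type*} [NormedAddCommGroup E] [NormedSpace ℝ E]
    (hd : 0 < d) {g : Vec d → E} (hg : StronglyMeasurable g) :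
    ∫ e, g (-e) ∂sphereLaw d = ∫ e, g e ∂sphereLaw d :=
  integral_sphereLaw_comp_isometry hd hg (LinearIsometryEquiv.neg ℝ)

theorem integrable_sphereLaw_of_bounded {E : Type*} [NormedAddCommGroup E] (hd : 0 < d)
    {g : Vec d → E} (hg : StronglyMeasurable g) (C : ℝ) (hC : ∀ e, ‖e‖ = 1 → ‖g e‖ ≤ C) :
    Integrable (fun e : sphere (0 : Vec d) 1 => g e) (sphereLaw d) := by
  have := isProbabilityMeasure_sphereLaw hd
  exact Integrable.of_bound (hg.comp_measurable measurable_subtype_coe).aestronglyMeasurable C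
    (Eventually.of_forall fun e => hC _ (by simp))

/-- A reflection exchanges any two vectors of equal norm, so the integral depends only on ‖v‖;
summing over an orthonormal basis gives Parseval, hence the share 1/d for each direction. -/
theorem integral_inner_sq_sphereLaw (hd : 0 < d) (v : Vec d) :
    ∫ e : sphere (0 : Vec d) 1, (inner ℝ (e : Vec d) v) ^ 2 ∂sphereLaw d = ‖v‖ ^ 2 / d := by
  have := isProbabilityMeasure_sphereLaw hd
  have hsm (v : Vec d) : StronglyMeasurable (fun e : Vec d => (inner ℝ e v) ^ 2) :=
    Continuous.stronglyMeasurable (by fun_prop)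
  have key (v w : Vec d) (h : ‖v‖ = ‖w‖) :
      ∫ e : sphere (0 : Vec d) 1, (inner ℝ (e : Vec d) v) ^ 2 ∂sphereLaw d =
      ∫ e : sphere (0 : Vec d) 1, (inner ℝ (e : Vec d) w) ^ 2 ∂sphereLaw d := by
    obtain ⟨T, hT⟩ : ∃ T : Vec d ≃ₗᵢ[ℝ] Vec d, T v = w :=
      ⟨(ℝ ∙ (v - w))ᗮ.reflection, Submodule.reflection_sub h⟩
    rw [← integral_sphereLaw_comp_isometry hd (hsm w) T]
    congr with e
    rw [← hT, T.inner_map_map]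
  have hint (v : Vec d) : Integrable (fun e : sphere (0 : Vec d) 1 => (inner ℝ (e : Vec d) v) ^ 2)
      (sphereLaw d) := by
    refine integrable_sphereLaw_of_bounded hd (hsm v) (‖v‖ ^ 2) fun e he => ?_
    rw [norm_pow]
    gcongr
    simpa [he] using norm_inner_le_norm (𝕜 := ℝ) e v
  let b := EuclideanSpace.basisFun (Fin d) ℝ
  have hsum : ∑ i, ∫ e : sphere (0 : Vec d) 1, (inner ℝ (e : Vec d) (‖v‖ • b i)) ^ 2 ∂sphereLaw d
      = ‖v‖ ^ 2 := by
    rw [← integral_finsetSum _ fun i _ => hint _]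
    have (e : sphere (0 : Vec d) 1) : ∑ i, (inner ℝ (e : Vec d) (‖v‖ • b i)) ^ 2 = ‖v‖ ^ 2 := by
      have := b.sum_sq_inner_left (e : Vec d)
      simp only [inner_smul_right, mul_pow, ← Finset.mul_sum]
      rw [this]; simp
    simp [this]
  have heq : ∀ i ∈ Finset.univ, ∫ e : sphere (0 : Vec d) 1,
      (inner ℝ (e : Vec d) (‖v‖ • b i)) ^ 2 ∂sphereLaw d =
      ∫ e : sphere (0 : Vec d) 1, (inner ℝ (e : Vec d) v) ^ 2 ∂sphereLaw d := fun i _ =>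
    key _ _ (by simp [norm_smul])
  rw [Finset.sum_congr rfl heq] at hsum
  have : (d : ℝ) ≠ 0 := by exact_mod_cast hd.ne'
  simp at hsum
  field_simp
  linarith

/-- A bounded function tested against the direction has mean of order `1 / √d`. -/
theorem norm_integral_smul_sphereLaw_sq_le (hd : 0 < d) {φ : Vec d → ℝ} (hφ : Measurable φ)
    {S : ℝ} (hS : ∀ e, ‖e‖ = 1 → |φ e| ≤ S) :
    ‖∫ e : sphere (0 : Vec d) 1, φ e • (e : Vec d) ∂sphereLaw d‖ ^ 2 ≤ S ^ 2 / d := by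
  have := isProbabilityMeasure_sphereLaw hd
  set w := ∫ e : sphere (0 : Vec d) 1, φ e • (e : Vec d) ∂sphereLaw d with hw
  have hd' : (0 : ℝ) < d := by exact_mod_cast hd
  have hint : Integrable (fun e : sphere (0 : Vec d) 1 => φ e • (e : Vec d)) (sphereLaw d) :=
    integrable_sphereLaw_of_bounded (g := fun e => φ e • e) hd
      (by fun_prop) S fun e he => by
        simpa [norm_smul, he] using hS e he
  have h1 : ‖w‖ ^ 2 = ∫ e : sphere (0 : Vec d) 1, φ e * inner ℝ (e : Vec d) w ∂sphereLaw d := by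
    rw [← real_inner_self_eq_norm_sq]
    nth_rw 1 [hw]
    rw [real_inner_comm, ← integral_inner hint]
    congr with e
    rw [inner_smul_right, real_inner_comm]
  -- Young's inequality with weight d: the mean of ⟨e, w⟩² is ‖w‖²/d, so the second term integrates
  -- to ‖w‖²/2, half of the quantity being bounded.
  have h2 : ∫ e : sphere (0 : Vec d) 1, φ e * inner ℝ (e : Vec d) w ∂sphereLaw d ≤
      ∫ e : sphere (0 : Vec d) 1, (S ^ 2 / (2 * d) + d / 2 * (inner ℝ (e : Vec d) w) ^ 2)
        ∂sphereLaw d := by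
    have hi2 : Integrable (fun e : sphere (0 : Vec d) 1 => (inner ℝ (e : Vec d) w) ^ 2)
        (sphereLaw d) := by
      refine integrable_sphereLaw_of_bounded (g := fun e => (inner ℝ e w) ^ 2) hd
        (Continuous.stronglyMeasurable (by fun_prop)) (‖w‖ ^ 2) fun e he => ?_
      rw [norm_pow]
      gcongr
      simpa [he] using norm_inner_le_norm (𝕜 := ℝ) e w
    have hi1 : Integrable (fun e : sphere (0 : Vec d) 1 => φ e * inner ℝ (e : Vec d) w)
        (sphereLaw d) := by
      refine integrable_sphereLaw_of_bounded (g := fun e => φ e * inner ℝ e w) hd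
        (Measurable.stronglyMeasurable (by fun_prop)) (S * ‖w‖) fun e he => ?_
      rw [norm_mul]
      gcongr
      · exact (abs_nonneg _).trans (hS e he)
      · exact hS e he
      · simpa [he] using norm_inner_le_norm (𝕜 := ℝ) e w
    refine integral_mono hi1 ((integrable_const _).add (hi2.const_mul _)) fun e => ?_
    have hs : (φ e) ^ 2 ≤ S ^ 2 := by
      rw [← sq_abs]
      gcongr
      exact hS e (by simp)
    have : φ e * inner ℝ (e : Vec d) w ≤
        (φ e) ^ 2 / (2 * d) + d / 2 * (inner ℝ (e : Vec d) w) ^ 2 := by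
      rw [← sub_nonneg]
      have : (φ e) ^ 2 / (2 * d) + d / 2 * (inner ℝ (e : Vec d) w) ^ 2 -
          φ e * inner ℝ (e : Vec d) w = (φ e - d * inner ℝ (e : Vec d) w) ^ 2 / (2 * d) := by
        field_simp
        ring
      rw [this]
      positivity
    refine this.trans ?_
    gcongr
  have h3 : ∫ e : sphere (0 : Vec d) 1, (S ^ 2 / (2 * d) + d / 2 * (inner ℝ (e : Vec d) w) ^ 2)
      ∂sphereLaw d = S ^ 2 / (2 * d) + ‖w‖ ^ 2 / 2 := by
    have hi2 : Integrable (fun e : sphere (0 : Vec d) 1 => (inner ℝ (e : Vec d) w) ^ 2)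
        (sphereLaw d) := by
      refine integrable_sphereLaw_of_bounded (g := fun e => (inner ℝ e w) ^ 2) hd
        (Continuous.stronglyMeasurable (by fun_prop)) (‖w‖ ^ 2) fun e he => ?_
      rw [norm_pow]
      gcongr
      simpa [he] using norm_inner_le_norm (𝕜 := ℝ) e w
    rw [integral_add (integrable_const _) (hi2.const_mul _), integral_const_mul,
      integral_inner_sq_sphereLaw hd]
    simp
    field_simp
  have : S ^ 2 / d = 2 * (S ^ 2 / (2 * d)) := by field_simp
  linarith

/-! ### The divergence theorem on the unit ball -/

theorem setIntegral_ball_normalize (k : Vec d → ℝ) {s : ℝ} (hs : 0 < s) :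
    ∫ u in ball (0 : Vec d) s, k (‖u‖⁻¹ • u) = s ^ d * ∫ u in ball (0 : Vec d) 1, k (‖u‖⁻¹ • u) := by
  have h := Measure.setIntegral_comp_smul (volume : Measure (Vec d)) (fun u => k (‖u‖⁻¹ • u))
    (ball 0 1) hs.ne'
  rw [smul_unitBall_of_pos hs] at h
  have h2 (u : Vec d) : ‖s • u‖⁻¹ • s • u = ‖u‖⁻¹ • u := by
    rw [norm_smul, Real.norm_of_nonneg hs.le, smul_smul]
    congr 1
    field_simp
  simp only [h2, finrank_euclideanSpace, Fintype.card_fin, smul_eq_mul] at h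
  rw [h, abs_of_pos (by positivity)]
  field_simp

/-- Radial cutoff: `1` on the unit ball, `0` outside the ball of radius `1 + ε`. -/
noncomputable def radialCutoff (ε : ℝ) (u : Vec d) : ℝ := max 0 (min 1 ((1 + ε - ‖u‖) / ε))

theorem radialCutoff_of_le {ε : ℝ} (hε : 0 < ε) {u : Vec d} (hu : ‖u‖ ≤ 1) :
    radialCutoff ε u = 1 := by
  have : 1 ≤ (1 + ε - ‖u‖) / ε := by rw [le_div_iff₀ hε]; linarith
  simp [radialCutoff, this]

theorem radialCutoff_of_ge {ε : ℝ} (hε : 0 < ε) {u : Vec d} (hu : 1 + ε ≤ ‖u‖) :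
    radialCutoff ε u = 0 := by
  have : (1 + ε - ‖u‖) / ε ≤ 0 := by
    apply div_nonpos_of_nonpos_of_nonneg <;> linarith
  simp [radialCutoff, this]

theorem radialCutoff_of_mem {ε : ℝ} (hε : 0 < ε) {u : Vec d} (hu : 1 ≤ ‖u‖) (hu' : ‖u‖ ≤ 1 + ε) :
    radialCutoff ε u = (1 + ε - ‖u‖) / ε := by
  have h1 : (1 + ε - ‖u‖) / ε ≤ 1 := by rw [div_le_iff₀ hε]; linarith
  have h2 : 0 ≤ (1 + ε - ‖u‖) / ε := by apply div_nonneg <;> linarith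
  simp [radialCutoff, h1, h2]

theorem radialCutoff_lipschitz {ε : ℝ} (hε : 0 < ε) :
    LipschitzWith (Real.toNNReal ε⁻¹) (radialCutoff ε : Vec d → ℝ) := by
  have h : LipschitzWith (Real.toNNReal ε⁻¹) (fun u : Vec d => (1 + ε - ‖u‖) / ε) := by
    refine LipschitzWith.of_dist_le_mul fun x y => ?_
    rw [Real.coe_toNNReal _ (by positivity), Real.dist_eq, ← sub_div, abs_div, abs_of_pos hε,
      div_eq_inv_mul]
    gcongr
    rw [dist_eq_norm, show 1 + ε - ‖x‖ - (1 + ε - ‖y‖) = -(‖x‖ - ‖y‖) by ring, abs_neg]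
    exact abs_norm_sub_norm_le x y
  have := (h.const_min 1).const_max 0
  exact this

theorem radialCutoff_hasCompactSupport {ε : ℝ} (hε : 0 < ε) :
    HasCompactSupport (radialCutoff ε : Vec d → ℝ) := by
  refine HasCompactSupport.of_support_subset_isCompact (isCompact_closedBall 0 (1 + ε)) ?_
  intro u hu
  by_contra h
  exact hu (radialCutoff_of_ge hε (by simpa using (not_le.1 (by simpa using h)).le))

theorem lineDeriv_radialCutoff_inside {ε : ℝ} (hε : 0 < ε) {u v : Vec d} (hu : ‖u‖ < 1) :
    lineDeriv ℝ (radialCutoff ε) u v = 0 := by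
  have : radialCutoff ε =ᶠ[𝓝 u] fun _ => (1 : ℝ) := by
    filter_upwards [isOpen_ball.mem_nhds (mem_ball_zero_iff.2 hu)] with w hw
    exact radialCutoff_of_le hε (mem_ball_zero_iff.1 hw).le
  rw [this.lineDeriv_eq]
  simp [lineDeriv]

theorem lineDeriv_radialCutoff_outside {ε : ℝ} (hε : 0 < ε) {u v : Vec d} (hu : 1 + ε < ‖u‖) :
    lineDeriv ℝ (radialCutoff ε) u v = 0 := by
  have : radialCutoff ε =ᶠ[𝓝 u] fun _ => (0 : ℝ) := by
    filter_upwards [(isOpen_lt continuous_const continuous_norm).mem_nhds hu] with w hw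
    exact radialCutoff_of_ge hε (le_of_lt hw)
  rw [this.lineDeriv_eq]
  simp [lineDeriv]

theorem lineDeriv_radialCutoff_shell {ε : ℝ} (hε : 0 < ε) {u v : Vec d} (hu : 1 < ‖u‖)
    (hu' : ‖u‖ < 1 + ε) :
    lineDeriv ℝ (radialCutoff ε) u (-v) = ε⁻¹ * inner ℝ (‖u‖⁻¹ • u) v := by
  have : radialCutoff ε =ᶠ[𝓝 u] fun w => (1 + ε - ‖w‖) / ε := by
    filter_upwards [(isOpen_lt continuous_const continuous_norm).mem_nhds hu,
      (isOpen_lt continuous_norm continuous_const).mem_nhds hu'] with w hw hw'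
    exact radialCutoff_of_mem hε (le_of_lt hw) (le_of_lt hw')
  rw [this.lineDeriv_eq]
  have hu0 : u ≠ 0 := by rintro rfl; simp at hu; linarith
  have hsq : HasDerivAt (fun s : ℝ => ‖u + s • (-v)‖ ^ 2) (-(2 * inner ℝ u v)) 0 := by
    have h1 : HasDerivAt (fun s : ℝ => u + s • (-v)) (-v) 0 := by
      simpa using ((hasDerivAt_id (0 : ℝ)).smul_const (-v)).const_add u
    have := h1.norm_sq
    simpa [inner_neg_right] using this
  have hn : HasDerivAt (fun s : ℝ => ‖u + s • (-v)‖) (-(‖u‖⁻¹ * inner ℝ u v)) 0 := by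
    have h := hsq.sqrt (by simpa using hu0)
    simp only [Real.sqrt_sq (norm_nonneg _), zero_smul, add_zero] at h
    convert h using 1
    have : ‖u‖ ≠ 0 := by simpa using hu0
    field_simp
  have hd := ((hn.const_sub (1 + ε)).div_const ε).deriv
  rw [lineDeriv, hd, real_inner_smul_left]
  field_simp

theorem ae_norm_ne {r : ℝ} (hr : r ≠ 0) : ∀ᵐ u : Vec d, ‖u‖ ≠ r := by
  have := Measure.addHaar_sphere_of_ne_zero (volume : Measure (Vec d)) 0 hr
  filter_upwards [measure_eq_zero_iff_ae_notMem.1 this] with u hu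
  simpa using hu

/-- Dominated convergence: the cutoffs tend pointwise to the indicator of the closed ball, which
differs from the open one by a null sphere. -/
theorem tendsto_integral_lineDeriv_mul_radialCutoff {g : Vec d → ℝ} (hg : ContDiff ℝ 1 g)
    (hc : HasCompactSupport g) (v : Vec d) :
    Tendsto (fun n : ℕ => ∫ u, lineDeriv ℝ g u v * radialCutoff (1 / ((n : ℝ) + 1)) u) atTop
      (𝓝 (∫ u in ball (0 : Vec d) 1, fderiv ℝ g u v)) := by
  have hl (u : Vec d) : lineDeriv ℝ g u v = fderiv ℝ g u v :=
    ((hg.differentiable one_ne_zero) u).lineDeriv_eq_fderiv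
  have hcont : Continuous (fun u => fderiv ℝ g u v) :=
    (hg.continuous_fderiv one_ne_zero).clm_apply continuous_const
  have hcs : HasCompactSupport (fun u => fderiv ℝ g u v) := hc.fderiv_apply (𝕜 := ℝ) v
  have hε (n : ℕ) : (0 : ℝ) < 1 / ((n : ℝ) + 1) := by positivity
  simp only [hl]
  have hb : ∫ u in ball (0 : Vec d) 1, fderiv ℝ g u v =
      ∫ u, (closedBall (0 : Vec d) 1).indicator (fun u => fderiv ℝ g u v) u := by
    rw [integral_indicator measurableSet_closedBall]
    refine setIntegral_congr_set ?_
    filter_upwards [ae_norm_ne (d := d) one_ne_zero] with u hu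
    refine propext (⟨fun h => ball_subset_closedBall h, fun h => ?_⟩ : u ∈ ball _ _ ↔ u ∈ closedBall _ _)
    exact mem_ball_zero_iff.2 (lt_of_le_of_ne (mem_closedBall_zero_iff.1 h) hu)
  rw [hb]
  refine tendsto_integral_of_dominated_convergence (fun u => ‖fderiv ℝ g u v‖) (fun n => ?_)
    (hcont.integrable_of_hasCompactSupport hcs).norm (fun n => ?_) ?_
  · exact (hcont.mul (radialCutoff_lipschitz (hε n)).continuous).aestronglyMeasurable
  · refine Eventually.of_forall fun u => ?_
    rw [norm_mul]
    refine mul_le_of_le_one_right (norm_nonneg _) ?_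
    rw [Real.norm_of_nonneg (by simp [radialCutoff]), radialCutoff]
    simp
  · refine Eventually.of_forall fun u => ?_
    by_cases hu : ‖u‖ ≤ 1
    · rw [indicator_of_mem (by simpa using hu)]
      refine tendsto_const_nhds.congr fun n => ?_
      rw [radialCutoff_of_le (hε n) hu, mul_one]
    · rw [indicator_of_notMem (by simpa using hu)]
      refine tendsto_const_nhds.congr' ?_
      have h1 : ∀ᶠ n : ℕ in atTop, 1 / ((n : ℝ) + 1) < ‖u‖ - 1 :=
        tendsto_one_div_add_atTop_nhds_zero_nat.eventually_lt_const (by linarith [not_le.1 hu])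
      filter_upwards [h1] with n hn
      rw [radialCutoff_of_ge (hε n) (by linarith), mul_zero]

theorem integral_lineDeriv_radialCutoff_mul {g : Vec d → ℝ} {ε : ℝ} (hε : 0 < ε)
    (v : Vec d) :
    ∫ u, lineDeriv ℝ (radialCutoff ε) u (-v) * g u =
      ∫ u in ball (0 : Vec d) (1 + ε) \ ball 0 1, ε⁻¹ * inner ℝ (‖u‖⁻¹ • u) v * g u := by
  rw [← integral_indicator (measurableSet_ball.diff measurableSet_ball)]
  refine integral_congr_ae ?_
  filter_upwards [ae_norm_ne (d := d) one_ne_zero, ae_norm_ne (d := d) (r := 1 + ε) (by positivity)]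
    with u h1 h2
  rcases lt_or_gt_of_ne h1 with h1 | h1
  · rw [lineDeriv_radialCutoff_inside hε h1, indicator_of_notMem (by simp [h1]), zero_mul]
  · rcases lt_or_gt_of_ne h2 with h2 | h2
    · rw [lineDeriv_radialCutoff_shell hε h1 h2, indicator_of_mem (by simp [h2, h1.le])]
    · rw [lineDeriv_radialCutoff_outside hε h2, indicator_of_notMem (by simp [h2.le]), zero_mul]

/-- Integration by parts against the Lipschitz cutoff moves the derivative onto the cutoff, where it
is the radial field divided by ε on a shell of width ε. Up to O(ε), g may be replaced there by its
value at the normalised point. The integral of a function of the direction over the shell is (1+ε)^d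
− 1 times that over the ball, and dividing by ε gives the derivative d of s^d at 1. -/
theorem ball_divergence_of_hasCompactSupport {g : Vec d → ℝ} (hg : ContDiff ℝ 1 g)
    (hc : HasCompactSupport g) (v : Vec d) :
    ∫ u in ball (0 : Vec d) 1, fderiv ℝ g u v =
      d * ∫ u in ball (0 : Vec d) 1, inner ℝ (‖u‖⁻¹ • u) v * g (‖u‖⁻¹ • u) := by
  obtain ⟨C, hC⟩ := ContDiff.lipschitzWith_of_hasCompactSupport hc hg one_ne_zero
  obtain ⟨Cg, hCg⟩ := hc.exists_bound_of_continuous hg.continuous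
  set k : Vec d → ℝ := fun w => inner ℝ w v * g w with hk
  have hkm : Measurable k := by
    have := hg.continuous.measurable
    fun_prop
  set I := ∫ u in ball (0 : Vec d) 1, k (‖u‖⁻¹ • u) with hI
  set V := volume.real (ball (0 : Vec d) 1) with hV
  have hnorm (u : Vec d) : ‖‖u‖⁻¹ • u‖ ≤ 1 := by
    rw [norm_smul, norm_inv, norm_norm]
    exact inv_mul_le_one
  have hVs {s : ℝ} (hs : 0 < s) : volume.real (ball (0 : Vec d) s) = s ^ d * V := by
    have := setIntegral_ball_normalize (d := d) (fun _ => 1) hs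
    simpa using this
  have hkb (u : Vec d) : ‖k (‖u‖⁻¹ • u)‖ ≤ ‖v‖ * Cg := by
    rw [hk, norm_mul]
    gcongr
    · refine (norm_inner_le_norm _ _).trans ?_
      exact mul_le_of_le_one_left (norm_nonneg _) (hnorm u)
    · exact hCg _
  have hki (s : ℝ) : IntegrableOn (fun u => k (‖u‖⁻¹ • u)) (ball (0 : Vec d) s) :=
    Measure.integrableOn_of_bounded (M := ‖v‖ * Cg) measure_ball_lt_top.ne
      (hkm.comp (by fun_prop)).aestronglyMeasurable (Eventually.of_forall hkb)
  -- the mean over a thin shell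
  have hshell {ε : ℝ} (hε : 0 < ε) :
      |(∫ u, lineDeriv ℝ (radialCutoff ε) u (-v) * g u) - ((1 + ε) ^ d - 1) / ε * I| ≤
        ‖v‖ * C * (((1 + ε) ^ d - 1) * V) := by
    have hsub : ball (0 : Vec d) 1 ⊆ ball 0 (1 + ε) := ball_subset_ball (by linarith)
    have hvol : volume.real (ball (0 : Vec d) (1 + ε) \ ball 0 1) = ((1 + ε) ^ d - 1) * V := by
      rw [measureReal_sdiff hsub measurableSet_ball, hVs (by linarith)]
      ring
    have h1 : ((1 + ε) ^ d - 1) / ε * I =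
        ∫ u in ball (0 : Vec d) (1 + ε) \ ball 0 1, ε⁻¹ * k (‖u‖⁻¹ • u) := by
      rw [integral_const_mul, setIntegral_sdiff measurableSet_ball (hki _) hsub,
        setIntegral_ball_normalize k (by linarith)]
      ring
    have hgm : Measurable g := hg.continuous.measurable
    have hint : IntegrableOn (fun u => ε⁻¹ * inner ℝ (‖u‖⁻¹ • u) v * g u)
        (ball (0 : Vec d) (1 + ε) \ ball 0 1) := by
      refine Measure.integrableOn_of_bounded (M := ε⁻¹ * ‖v‖ * Cg)
        (measure_ne_top_of_subset sdiff_subset measure_ball_lt_top.ne)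
        (Measurable.aestronglyMeasurable (by fun_prop)) (Eventually.of_forall fun u => ?_)
      rw [norm_mul, norm_mul, Real.norm_of_nonneg (by positivity : (0 : ℝ) ≤ ε⁻¹)]
      gcongr
      · refine (norm_inner_le_norm _ _).trans ?_
        exact mul_le_of_le_one_left (norm_nonneg _) (hnorm u)
      · exact hCg _
    rw [integral_lineDeriv_radialCutoff_mul hε, h1, ← integral_sub hint
      (((hki _).mono_set sdiff_subset).const_mul _), ← Real.norm_eq_abs, ← hvol]
    refine norm_setIntegral_le_of_norm_le_const
      ((measure_mono sdiff_subset).trans_lt measure_ball_lt_top) fun u hu => ?_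
    have hu1 : 1 ≤ ‖u‖ := by simpa using hu.2
    have hu2 : ‖u‖ ≤ 1 + ε := by simpa using (mem_ball_zero_iff.1 hu.1).le
    have hu0 : 0 < ‖u‖ := by linarith
    have h2 : ε⁻¹ * inner ℝ (‖u‖⁻¹ • u) v * g u - ε⁻¹ * k (‖u‖⁻¹ • u) =
        ε⁻¹ * (inner ℝ (‖u‖⁻¹ • u) v * (g u - g (‖u‖⁻¹ • u))) := by
      rw [hk]; ring
    have h3 : |g u - g (‖u‖⁻¹ • u)| ≤ C * ε := by
      rw [← Real.dist_eq]
      refine (hC.dist_le_mul _ _).trans ?_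
      gcongr
      rw [dist_eq_norm, show u - ‖u‖⁻¹ • u = (1 - ‖u‖⁻¹) • u by rw [sub_smul, one_smul], norm_smul,
        Real.norm_of_nonneg (by simpa using inv_le_one_of_one_le₀ hu1), sub_mul, one_mul,
        inv_mul_cancel₀ hu0.ne']
      linarith
    have h4 : |(inner ℝ (‖u‖⁻¹ • u) v : ℝ)| ≤ ‖v‖ :=
      (abs_real_inner_le_norm _ _).trans (mul_le_of_le_one_left (norm_nonneg _) (hnorm u))
    rw [h2, Real.norm_eq_abs, abs_mul, abs_mul, abs_of_pos (inv_pos.2 hε)]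
    calc ε⁻¹ * (|(inner ℝ (‖u‖⁻¹ • u) v : ℝ)| * |g u - g (‖u‖⁻¹ • u)|)
        ≤ ε⁻¹ * (‖v‖ * (C * ε)) := by gcongr
      _ = ‖v‖ * C := by field_simp
  have hlim0 : Tendsto (fun n : ℕ => 1 / ((n : ℝ) + 1)) atTop (𝓝[≠] 0) := by
    refine tendsto_nhdsWithin_iff.2 ⟨tendsto_one_div_add_atTop_nhds_zero_nat, ?_⟩
    exact Eventually.of_forall fun n => by simp only [mem_compl_iff, mem_singleton_iff]; positivity
  have hlim1 : Tendsto (fun n : ℕ => ((1 + 1 / ((n : ℝ) + 1)) ^ d - 1) / (1 / ((n : ℝ) + 1)) * I)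
      atTop (𝓝 (d * I)) := by
    refine Tendsto.mul_const I ?_
    have h : HasDerivAt (fun x : ℝ => x ^ d) (d : ℝ) 1 := by simpa using hasDerivAt_pow d (1 : ℝ)
    have := (hasDerivAt_iff_tendsto_slope_zero.1 h).comp hlim0
    refine this.congr fun n => ?_
    simp [div_eq_inv_mul]
  have hlim2 : Tendsto (fun n : ℕ => ‖v‖ * C * (((1 + 1 / ((n : ℝ) + 1)) ^ d - 1) * V))
      atTop (𝓝 0) := by
    have : Tendsto (fun n : ℕ => ‖v‖ * C * (((1 + 1 / ((n : ℝ) + 1)) ^ d - 1) * V))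
        atTop (𝓝 (‖v‖ * C * (((1 + 0) ^ d - 1) * V))) :=
      ((((tendsto_one_div_add_atTop_nhds_zero_nat.const_add 1).pow d).sub_const 1).mul_const
        V).const_mul _
    simpa using this
  have hlim3 : Tendsto (fun n : ℕ => ∫ u, lineDeriv ℝ (radialCutoff (1 / ((n : ℝ) + 1))) u (-v) * g u)
      atTop (𝓝 (d * I)) := by
    have h0 := squeeze_zero (fun n => abs_nonneg _)
      (fun n : ℕ => hshell (ε := 1 / ((n : ℝ) + 1)) (by positivity)) hlim2
    have := ((tendsto_zero_iff_abs_tendsto_zero _).2 h0).add hlim1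
    simpa using this
  refine tendsto_nhds_unique (tendsto_integral_lineDeriv_mul_radialCutoff hg hc v) ?_
  refine hlim3.congr fun n => ?_
  have hε : (0 : ℝ) < 1 / ((n : ℝ) + 1) := by positivity
  exact (hC.integral_lineDeriv_mul_eq (radialCutoff_lipschitz hε)
    (radialCutoff_hasCompactSupport hε) v).symm

/-- Divergence theorem on the unit ball, the surface integral being written as an integral over
the ball of a function of the direction. -/
theorem ball_divergence {g : Vec d → ℝ} (hg : ContDiff ℝ 1 g) (v : Vec d) :
    ∫ u in ball (0 : Vec d) 1, fderiv ℝ g u v =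
      d * ∫ u in ball (0 : Vec d) 1, inner ℝ (‖u‖⁻¹ • u) v * g (‖u‖⁻¹ • u) := by
  -- The bump is 1 on the ball of radius 2, a neighbourhood of the closed unit ball, so neither side
  -- sees it; it only supplies compact support.
  let χ : ContDiffBump (0 : Vec d) := ⟨2, 3, by norm_num, by norm_num⟩
  have h1 : ContDiff ℝ 1 (fun u => χ u * g u) := χ.contDiff.mul hg
  have h2 : HasCompactSupport (fun u => χ u * g u) := χ.hasCompactSupport.mul_right
  have hone {u : Vec d} (hu : ‖u‖ ≤ 2) : χ u = 1 :=
    χ.one_of_mem_closedBall (by simpa using hu)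
  have h := ball_divergence_of_hasCompactSupport h1 h2 v
  have hnorm (u : Vec d) : ‖‖u‖⁻¹ • u‖ ≤ 1 := by
    rw [norm_smul, norm_inv, norm_norm]
    exact inv_mul_le_one
  have hr : ∀ u : Vec d, χ (‖u‖⁻¹ • u) = 1 := fun u => hone ((hnorm u).trans (by norm_num))
  simp only [hr, one_mul] at h
  rw [← h]
  refine setIntegral_congr_fun measurableSet_ball fun u hu => ?_
  have : (fun u => χ u * g u) =ᶠ[𝓝 u] g := by
    filter_upwards [isOpen_ball.mem_nhds hu] with w hw
    rw [hone ((mem_ball_zero_iff.1 hw).le.trans (by norm_num)), one_mul]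
  simp only [this.fderiv_eq]

/-! ### Smoothness, strong convexity and averages over balls -/

theorem IsLSmooth.continuous_gradient {L : ℝ} {f : Vec d → ℝ} (hf : IsLSmooth L f) :
    Continuous (gradient f) := by
  refine (LipschitzWith.of_dist_le_mul (K := Real.toNNReal L) fun x y => ?_).continuous
  rw [dist_eq_norm, dist_eq_norm]
  refine (hf.2 x y).trans ?_
  gcongr
  exact Real.le_coe_toNNReal L

theorem IsLSmooth.continuous {L : ℝ} {f : Vec d → ℝ} (hf : IsLSmooth L f) : Continuous f :=
  hf.1.continuous

theorem fderiv_eq_inner_gradient (f : Vec d → ℝ) (x v : Vec d) :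
    fderiv ℝ f x v = inner ℝ (gradient f x) v := by
  rw [gradient, InnerProductSpace.toDual_symm_apply]

/-- The descent lemma. -/
theorem IsLSmooth.upper {L : ℝ} {f : Vec d → ℝ} (hf : IsLSmooth L f) (x y : Vec d) :
    f y ≤ f x + inner ℝ (gradient f x) (y - x) + L / 2 * ‖y - x‖ ^ 2 := by
  set v := y - x with hv
  have hline (s : ℝ) : HasDerivAt (fun s : ℝ => f (x + s • v))
      (inner ℝ (gradient f (x + s • v)) v) s := by
    have h1 : HasDerivAt (fun s : ℝ => x + s • v) v s := by
      simpa using ((hasDerivAt_id s).smul_const v).const_add x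
    have := ((hf.1 (x + s • v)).hasFDerivAt).comp_hasDerivAt s h1
    rwa [fderiv_eq_inner_gradient] at this
  have hderiv (s : ℝ) : HasDerivAt
      (fun s : ℝ => f (x + s • v) - s * inner ℝ (gradient f x) v - s ^ 2 * (L / 2 * ‖v‖ ^ 2))
      (inner ℝ (gradient f (x + s • v)) v - inner ℝ (gradient f x) v - s * (L * ‖v‖ ^ 2)) s := by
    have := ((hline s).sub ((hasDerivAt_id s).mul_const (inner ℝ (gradient f x) v))).sub
      ((hasDerivAt_pow 2 s).mul_const (L / 2 * ‖v‖ ^ 2))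
    refine this.congr_deriv ?_
    push_cast
    ring
  have hanti : AntitoneOn
      (fun s : ℝ => f (x + s • v) - s * inner ℝ (gradient f x) v - s ^ 2 * (L / 2 * ‖v‖ ^ 2))
      (Icc 0 1) := by
    refine antitoneOn_of_deriv_nonpos (convex_Icc 0 1)
      (fun s _ => (hderiv s).continuousAt.continuousWithinAt)
      (fun s _ => (hderiv s).differentiableAt.differentiableWithinAt) fun s hs => ?_
    rw [interior_Icc] at hs
    rw [(hderiv s).deriv, ← inner_sub_left]
    have h1 := real_inner_le_norm (gradient f (x + s • v) - gradient f x) v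
    have h2 := hf.2 (x + s • v) x
    rw [add_sub_cancel_left, norm_smul, Real.norm_of_nonneg hs.1.le] at h2
    have h3 := mul_le_mul_of_nonneg_right h2 (norm_nonneg v)
    nlinarith
  have := hanti (left_mem_Icc.2 zero_le_one) (right_mem_Icc.2 zero_le_one) zero_le_one
  simp only [one_smul, zero_smul, add_zero, hv, add_sub_cancel] at this
  rw [hv]
  linarith

/-- Uniform distribution on the unit ball. -/
noncomputable def ballLaw (d : ℕ) : Measure (Vec d) :=
  (volume (ball (0 : Vec d) 1))⁻¹ • volume.restrict (ball 0 1)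

instance : IsProbabilityMeasure (ballLaw d) := by
  constructor
  rw [ballLaw, Measure.smul_apply, Measure.restrict_apply_univ, smul_eq_mul]
  exact ENNReal.inv_mul_cancel (measure_ball_pos _ _ one_pos).ne' measure_ball_lt_top.ne

theorem ae_ballLaw : ∀ᵐ u ∂ballLaw d, ‖u‖ ≤ 1 := by
  refine Measure.ae_smul_measure ?_ _
  filter_upwards [ae_restrict_mem measurableSet_ball] with u hu
  exact (mem_ball_zero_iff.1 hu).le

theorem integrable_ballLaw {E : Type*} [NormedAddCommGroup E] {g : Vec d → E}
    (hg : Continuous g) : Integrable g (ballLaw d) := by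
  refine Integrable.smul_measure ?_ (by simpa using (measure_ball_pos _ _ one_pos).ne')
  exact (hg.continuousOn.integrableOn_compact (isCompact_closedBall 0 1)).mono_set
    ball_subset_closedBall

theorem integral_ballLaw {E : Type*} [NormedAddCommGroup E] [NormedSpace ℝ E] (g : Vec d → E) :
    ∫ u, g u ∂ballLaw d = (volume.real (ball (0 : Vec d) 1))⁻¹ • ∫ u in ball (0 : Vec d) 1, g u := by
  rw [ballLaw, integral_smul_measure, ENNReal.toReal_inv, measureReal_def]

theorem integral_inner_ballLaw (v : Vec d) : ∫ u, inner ℝ v u ∂ballLaw d = 0 := by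
  have h := (LinearIsometryEquiv.neg ℝ (E := Vec d)).measurePreserving.setIntegral_preimage_emb
    (LinearIsometryEquiv.neg ℝ (E := Vec d)).toHomeomorph.toMeasurableEquiv.measurableEmbedding
    (fun u => (inner ℝ v u : ℝ)) (ball 0 1)
  rw [LinearIsometryEquiv.preimage_ball] at h
  simp only [LinearIsometryEquiv.coe_neg, inner_neg_right, integral_neg, map_zero] at h
  rw [integral_ballLaw]
  have : ∫ u in ball (0 : Vec d) 1, (inner ℝ v u : ℝ) = 0 := by linarith
  rw [this, smul_zero]

/-- Average of `f` over the ball of radius `t` around `x`. -/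
noncomputable def smoothed (f : Vec d → ℝ) (t : ℝ) (x : Vec d) : ℝ :=
  ∫ u, f (x + t • u) ∂ballLaw d

/-- Average of the gradient of `f` over the ball of radius `t` around `x`. -/
noncomputable def smoothGrad (f : Vec d → ℝ) (t : ℝ) (x : Vec d) : Vec d :=
  ∫ u, gradient f (x + t • u) ∂ballLaw d

section
variable {L μ t : ℝ} {f : Vec d → ℝ}

theorem IsLSmooth.integrable_comp (hf : IsLSmooth L f) (t : ℝ) (x : Vec d) :
    Integrable (fun u => f (x + t • u)) (ballLaw d) :=
  integrable_ballLaw (hf.continuous.comp (by fun_prop))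

theorem IsLSmooth.integrable_gradient_comp (hf : IsLSmooth L f) (t : ℝ) (x : Vec d) :
    Integrable (fun u => gradient f (x + t • u)) (ballLaw d) :=
  integrable_ballLaw (hf.continuous_gradient.comp (by fun_prop))

theorem IsLSmooth.inner_smoothGrad (hf : IsLSmooth L f) (t : ℝ) (x v : Vec d) :
    inner ℝ (smoothGrad f t x) v = ∫ u, inner ℝ (gradient f (x + t • u)) v ∂ballLaw d := by
  rw [smoothGrad, real_inner_comm, ← integral_inner (hf.integrable_gradient_comp t x)]
  simp only [real_inner_comm]

theorem IsLSmooth.integrable_inner_gradient (hf : IsLSmooth L f) (t : ℝ) (x v : Vec d) :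
    Integrable (fun u => (inner ℝ (gradient f (x + t • u)) v : ℝ)) (ballLaw d) := by
  have := hf.continuous_gradient
  exact integrable_ballLaw (by fun_prop)

/-- The descent lemma is averaged over translates. Only such quadratic inequalities, with
`smoothGrad` in the role of the gradient, enter the analysis; differentiability of `smoothed` is
never needed. -/
theorem IsLSmooth.smoothed_upper (hf : IsLSmooth L f) (t : ℝ) (x y : Vec d) :
    smoothed f t y ≤ smoothed f t x + inner ℝ (smoothGrad f t x) (y - x)
      + L / 2 * ‖y - x‖ ^ 2 := by
  have h : smoothed f t x + inner ℝ (smoothGrad f t x) (y - x) + L / 2 * ‖y - x‖ ^ 2 =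
      ∫ u, (f (x + t • u) + inner ℝ (gradient f (x + t • u)) (y - x) + L / 2 * ‖y - x‖ ^ 2)
        ∂ballLaw d := by
    rw [integral_add (f := fun u => f (x + t • u) + inner ℝ (gradient f (x + t • u)) (y - x))
      ((hf.integrable_comp t x).add (hf.integrable_inner_gradient t x _))
      (integrable_const _), integral_add (hf.integrable_comp t x)
      (hf.integrable_inner_gradient t x _), hf.inner_smoothGrad, smoothed]
    simp
  rw [h]
  refine integral_mono (hf.integrable_comp t y) (((hf.integrable_comp t x).add
    (hf.integrable_inner_gradient t x _)).add (integrable_const _)) fun u => ?_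
  have := hf.upper (x + t • u) (y + t • u)
  simpa using this

theorem IsLSmooth.smoothed_lower (hf : IsLSmooth L f) (hc : IsStronglyConvex μ f) (t : ℝ)
    (x y : Vec d) :
    smoothed f t x + inner ℝ (smoothGrad f t x) (y - x) + μ / 2 * ‖y - x‖ ^ 2 ≤
      smoothed f t y := by
  have h : smoothed f t x + inner ℝ (smoothGrad f t x) (y - x) + μ / 2 * ‖y - x‖ ^ 2 =
      ∫ u, (f (x + t • u) + inner ℝ (gradient f (x + t • u)) (y - x) + μ / 2 * ‖y - x‖ ^ 2)
        ∂ballLaw d := by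
    rw [integral_add (f := fun u => f (x + t • u) + inner ℝ (gradient f (x + t • u)) (y - x))
      ((hf.integrable_comp t x).add (hf.integrable_inner_gradient t x _))
      (integrable_const _), integral_add (hf.integrable_comp t x)
      (hf.integrable_inner_gradient t x _), hf.inner_smoothGrad, smoothed]
    simp
  rw [h]
  refine integral_mono (((hf.integrable_comp t x).add
    (hf.integrable_inner_gradient t x _)).add (integrable_const _)) (hf.integrable_comp t y)
    fun u => ?_
  have := hc.2 (y + t • u) (x + t • u)
  simp only [add_sub_add_right_eq_sub] at this ⊢
  linarith

/-- Jensen: the linear term of the tangent inequality has mean zero because the ball is symmetric.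
-/
theorem IsLSmooth.le_smoothed (hf : IsLSmooth L f) (hc : IsStronglyConvex μ f) (hμ : 0 ≤ μ) (t : ℝ)
    (x : Vec d) : f x ≤ smoothed f t x := by
  have h : f x = ∫ u, (f x + inner ℝ (t • gradient f x) u) ∂ballLaw d := by
    rw [integral_add (integrable_const _) (integrable_ballLaw (by fun_prop)),
      integral_inner_ballLaw]
    simp
  rw [h]
  refine integral_mono ((integrable_const _).add (integrable_ballLaw (by fun_prop)))
    (hf.integrable_comp t x) fun u => ?_
  have := hc.2 (x + t • u) x
  have h0 : 0 ≤ μ / 2 * ‖x + t • u - x‖ ^ 2 := by positivity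
  simp only [add_sub_cancel_left, inner_smul_right, inner_smul_left, RCLike.conj_to_real] at *
  linarith

theorem IsLSmooth.smoothed_le (hf : IsLSmooth L f) (hL : 0 ≤ L) (t : ℝ) (x : Vec d) :
    smoothed f t x ≤ f x + L * t ^ 2 / 2 := by
  have h : f x + L * t ^ 2 / 2 =
      ∫ u, (f x + L * t ^ 2 / 2 + inner ℝ (t • gradient f x) u) ∂ballLaw d := by
    rw [integral_add (integrable_const _) (integrable_ballLaw (by fun_prop)),
      integral_inner_ballLaw]
    simp
  rw [h]
  refine integral_mono_ae (hf.integrable_comp t x)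
    ((integrable_const _).add (integrable_ballLaw (by fun_prop))) ?_
  filter_upwards [ae_ballLaw] with u hu
  have := hf.upper x (x + t • u)
  simp only [add_sub_cancel_left, inner_smul_right, inner_smul_left, RCLike.conj_to_real,
    norm_smul, mul_pow, Real.norm_eq_abs, sq_abs] at *
  have h1 : ‖u‖ ^ 2 ≤ 1 := pow_le_one₀ (norm_nonneg _) hu
  have h2 : L / 2 * (t ^ 2 * ‖u‖ ^ 2) ≤ L / 2 * (t ^ 2 * 1) := by gcongr
  linarith

theorem IsLSmooth.norm_gradient_sub_smoothGrad_le (hf : IsLSmooth L f) (hL : 0 ≤ L) (ht : 0 ≤ t)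
    (x : Vec d) : ‖gradient f x - smoothGrad f t x‖ ≤ L * t := by
  have h : gradient f x - smoothGrad f t x =
      ∫ u, (gradient f x - gradient f (x + t • u)) ∂ballLaw d := by
    rw [integral_sub (integrable_const _) (hf.integrable_gradient_comp t x), smoothGrad]
    simp
  rw [h]
  refine (norm_integral_le_of_norm_le_const (C := L * t) ?_).trans (by simp)
  filter_upwards [ae_ballLaw] with u hu
  refine (hf.2 _ _).trans ?_
  gcongr
  rw [sub_add_cancel_left, norm_neg, norm_smul, Real.norm_of_nonneg ht]
  exact mul_le_of_le_one_right ht hu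

/-- The mean of the two-point estimator is the gradient of the smoothed function. -/
theorem IsLSmooth.smoothGrad_eq (hd : 0 < d) (hf : IsLSmooth L f) (ht : 0 < t) (x : Vec d) :
    smoothGrad f t x =
      ((d : ℝ) / t) • ∫ e : sphere (0 : Vec d) 1, f (x + t • (e : Vec d)) • (e : Vec d)
        ∂sphereLaw d := by
  have hfc := hf.continuous
  have hcd : ContDiff ℝ 1 f := by
    rw [contDiff_one_iff_fderiv]
    refine ⟨hf.1, ?_⟩
    have : fderiv ℝ f = fun x => InnerProductSpace.toDual ℝ (Vec d) (gradient f x) := by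
      ext1 x
      rw [gradient, LinearIsometryEquiv.apply_symm_apply]
    rw [this]
    exact (InnerProductSpace.toDual ℝ (Vec d)).continuous.comp hf.continuous_gradient
  refine ext_inner_right ℝ fun v => ?_
  have hg : ContDiff ℝ 1 (fun u : Vec d => f (x + t • u)) := hcd.comp (by fun_prop)
  -- Applied to u ↦ f(x + tu), whose derivative carries a factor t; this is the origin of d/t.
  have hdiv := ball_divergence hg v
  have hfd (u : Vec d) : fderiv ℝ (fun u : Vec d => f (x + t • u)) u v =
      t * inner ℝ (gradient f (x + t • u)) v := by
    have h1 : HasFDerivAt (fun u : Vec d => x + t • u) (t • ContinuousLinearMap.id ℝ (Vec d)) u :=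
      ((hasFDerivAt_id u).const_smul t).const_add x
    have h2 : HasFDerivAt (fun u : Vec d => f (x + t • u)) _ u :=
      (hf.1 (x + t • u)).hasFDerivAt.comp u h1
    rw [h2.fderiv]
    rw [ContinuousLinearMap.comp_apply, fderiv_eq_inner_gradient]
    exact inner_smul_right _ _ _
  simp only [hfd, integral_const_mul] at hdiv
  have hint : Integrable (fun e : sphere (0 : Vec d) 1 => f (x + t • (e : Vec d)) • (e : Vec d))
      (sphereLaw d) := by
    obtain ⟨C, hC⟩ := (isCompact_sphere (0 : Vec d) 1).exists_bound_of_continuousOn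
      (f := fun e : Vec d => f (x + t • e) • e) (by fun_prop)
    exact integrable_sphereLaw_of_bounded (g := fun e => f (x + t • e) • e) hd
      (Continuous.stronglyMeasurable (by fun_prop)) C fun e he => hC e (by simpa using he)
  rw [hf.inner_smoothGrad, integral_ballLaw, inner_smul_left, RCLike.conj_to_real,
    real_inner_comm, ← integral_inner hint]
  simp only [inner_smul_right]
  rw [integral_sphereLaw (g := fun e => f (x + t • e) * inner ℝ v e) hd
    (Continuous.stronglyMeasurable (by fun_prop))]
  simp only [smul_eq_mul]
  have h2 : ∫ u in ball (0 : Vec d) 1, inner ℝ (gradient f (x + t • u)) v =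
      d / t * ∫ u in ball (0 : Vec d) 1, inner ℝ (‖u‖⁻¹ • u) v * f (x + t • ‖u‖⁻¹ • u) := by
    rw [div_mul_eq_mul_div, eq_div_iff ht.ne', ← hdiv, mul_comm]
  rw [h2]
  have h3 (u : Vec d) : inner ℝ (‖u‖⁻¹ • u) v * f (x + t • ‖u‖⁻¹ • u) =
    f (x + t • ‖u‖⁻¹ • u) * inner ℝ v (‖u‖⁻¹ • u) := by rw [real_inner_comm, mul_comm]
  simp only [h3]
  ring

/-- Strong convexity and smoothness constants are ordered. -/
theorem IsLSmooth.strongConvexity_le (hd : 0 < d) (hf : IsLSmooth L f)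
    (hc : IsStronglyConvex μ f) : μ ≤ L := by
  have : Nonempty (Fin d) := ⟨⟨0, hd⟩⟩
  obtain ⟨y, hy⟩ := exists_ne (0 : Vec d)
  have h1 := hf.upper 0 y
  have h2 := hc.2 y 0
  have : 0 < ‖y - 0‖ ^ 2 := by simpa using pow_pos (norm_pos_iff.2 hy) 2
  nlinarith

theorem gradient_eq_zero_of_forall_le {xs : Vec d} (h : ∀ x, f xs ≤ f x) : gradient f xs = 0 := by
  have : IsLocalMin f xs := Eventually.of_forall h
  rw [gradient, this.fderiv_eq_zero, map_zero]
end

/-! ### Mixing and decay of correlations -/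

section Chain
variable {Z : Type*} [MeasurableSpace Z]

theorem abs_measureReal_sub_le_tvDist (ν ρ : Measure Z) [IsProbabilityMeasure ν]
    [IsProbabilityMeasure ρ] {A : Set Z} (hA : MeasurableSet A) :
    |ν.real A - ρ.real A| ≤ tvDist ν ρ := by
  refine le_ciSup (f := fun A : {A : Set Z // MeasurableSet A} => |ν.real A.1 - ρ.real A.1|)
    ⟨1, ?_⟩ ⟨A, hA⟩
  rintro _ ⟨A, rfl⟩
  have h1 : ν.real A.1 ≤ 1 := measureReal_le_one
  have h2 : ρ.real A.1 ≤ 1 := measureReal_le_one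
  have h3 : 0 ≤ ν.real A.1 := measureReal_nonneg
  have h4 : 0 ≤ ρ.real A.1 := measureReal_nonneg
  exact abs_le.2 ⟨by linarith, by linarith⟩

theorem tvDist_le_one (ν ρ : Measure Z) [IsProbabilityMeasure ν] [IsProbabilityMeasure ρ] :
    tvDist ν ρ ≤ 1 := by
  have : Nonempty {A : Set Z // MeasurableSet A} := ⟨⟨∅, .empty⟩⟩
  refine ciSup_le fun A => ?_
  have h1 : ν.real A.1 ≤ 1 := measureReal_le_one
  have h2 : ρ.real A.1 ≤ 1 := measureReal_le_one
  have h3 : 0 ≤ ν.real A.1 := measureReal_nonneg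
  have h4 : 0 ≤ ρ.real A.1 := measureReal_nonneg
  exact abs_le.2 ⟨by linarith, by linarith⟩

theorem tvDist_le_dobrushin (K : Kernel Z Z) [IsMarkovKernel K] (z z' : Z) :
    tvDist (K z) (K z') ≤ dobrushin K := by
  refine le_ciSup (f := fun q : Z × Z => tvDist (K q.1) (K q.2)) ⟨1, ?_⟩ (z, z')
  rintro _ ⟨q, rfl⟩
  exact tvDist_le_one _ _

/-- Layer cake: φ + S takes values in [0, 2S], so its mean is the integral over that interval of the
measures of its superlevel sets, and each of these changes by at most the total variation. -/
theorem abs_integral_sub_le_tvDist (ν ρ : Measure Z) [IsProbabilityMeasure ν]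
    [IsProbabilityMeasure ρ] {φ : Z → ℝ} (hφ : Measurable φ) {S : ℝ} (hS : 0 ≤ S)
    (hb : ∀ z, |φ z| ≤ S) :
    |∫ z, φ z ∂ν - ∫ z, φ z ∂ρ| ≤ 2 * S * tvDist ν ρ := by
  have hint (κ : Measure Z) [IsProbabilityMeasure κ] : Integrable φ κ :=
    Integrable.of_bound hφ.aestronglyMeasurable S (Eventually.of_forall hb)
  have key (κ : Measure Z) [IsProbabilityMeasure κ] :
      ∫ z, φ z ∂κ = (∫ t in Ioc 0 (2 * S), κ.real {a | t ≤ φ a + S}) - S := by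
    rw [← Integrable.integral_eq_integral_Ioc_meas_le (f := fun z => φ z + S)
      ((hint κ).add (integrable_const _))
      (Eventually.of_forall fun z => by have := (abs_le.1 (hb z)).1; simp; linarith)
      (Eventually.of_forall fun z => by have := (abs_le.1 (hb z)).2; simp; linarith),
      integral_add (hint κ) (integrable_const _)]
    simp
  have hi (κ : Measure Z) [IsProbabilityMeasure κ] :
      IntegrableOn (fun t : ℝ => κ.real {a | t ≤ φ a + S}) (Ioc 0 (2 * S)) := by
    refine Measure.integrableOn_of_bounded (M := 1) measure_Ioc_lt_top.ne ?_ ?_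
    · refine Measurable.aestronglyMeasurable (Antitone.measurable fun s t hst => ?_)
      exact measureReal_mono fun a ha => le_trans hst ha
    · refine Eventually.of_forall fun t => ?_
      rw [Real.norm_of_nonneg measureReal_nonneg]
      exact measureReal_le_one
  rw [key ν, key ρ, sub_sub_sub_cancel_right, ← integral_sub (hi ν) (hi ρ), ← Real.norm_eq_abs]
  refine (norm_setIntegral_le_of_norm_le_const (C := tvDist ν ρ) measure_Ioc_lt_top
    fun t _ => ?_).trans ?_
  · exact abs_measureReal_sub_le_tvDist ν ρ (measurableSet_le measurable_const (by fun_prop))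
  · simp [hS]
    linarith

instance isMarkovKernel_pow (Q : Kernel Z Z) [IsMarkovKernel Q] (k : ℕ) :
    IsMarkovKernel (Q ^ k) := by
  induction k with
  | zero => exact inferInstanceAs (IsMarkovKernel (Kernel.id))
  | succ k ih =>
    rw [pow_succ']
    exact Kernel.IsMarkovKernel.comp Q (Q ^ k)

theorem ProbabilityTheory.Kernel.Invariant.pow {Q : Kernel Z Z} {π : Measure Z} (h : Kernel.Invariant Q π) (k : ℕ) :
    Kernel.Invariant (Q ^ k) π := by
  induction k with
  | zero =>
    change Kernel.Invariant Kernel.id π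
    rw [Kernel.Invariant, Measure.id_comp]
  | succ k ih => rw [pow_succ']; exact h.comp ih

/-- A function with mean zero under the invariant law has small mean after many steps. -/
theorem IsUniformlyErgodic.abs_integral_pow_le {Q : Kernel Z Z} [IsMarkovKernel Q] {π : Measure Z}
    [IsProbabilityMeasure π] {τ : ℕ} (h : IsUniformlyErgodic Q π τ) {φ : Z → ℝ}
    (hφ : Measurable φ) {S : ℝ} (hS : 0 ≤ S) (hb : ∀ z, |φ z| ≤ S) (h0 : ∫ z, φ z ∂π = 0)
    (k : ℕ) (z : Z) : |∫ y, φ y ∂(Q ^ k) z| ≤ 2 * S * (1 / 4) ^ (k / τ) := by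
  have hi : Integrable (fun z' => ∫ y, φ y ∂(Q ^ k) z') π := by
    refine Integrable.of_bound (hφ.stronglyMeasurable.integral_kernel).aestronglyMeasurable S
      (Eventually.of_forall fun z' => ?_)
    exact (norm_integral_le_of_norm_le_const (Eventually.of_forall hb)).trans (by simp)
  have h1 : ∫ z', ∫ y, φ y ∂(Q ^ k) z' ∂π = 0 := by
    have hinv : (π ⊗ₘ (Q ^ k)).snd = π := by
      rw [Measure.snd_compProd]
      exact h.invariant.pow k
    rw [← Measure.integral_compProd (f := fun q : Z × Z => φ q.2)
      (Integrable.of_bound (hφ.comp measurable_snd).aestronglyMeasurable S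
        (Eventually.of_forall fun q => hb _)),
      ← integral_map (φ := Prod.snd) measurable_snd.aemeasurable hφ.aestronglyMeasurable]
    change ∫ y, φ y ∂(π ⊗ₘ (Q ^ k)).snd = 0
    rw [hinv, h0]
  -- The stationary average of the k-step mean is zero, so that mean is an average of differences
  -- between two starting points, which the Dobrushin coefficient controls.
  have h2 : ∫ y, φ y ∂(Q ^ k) z = ∫ z', (∫ y, φ y ∂(Q ^ k) z - ∫ y, φ y ∂(Q ^ k) z') ∂π := by
    rw [integral_sub (integrable_const _) hi, h1]
    simp
  rw [h2, ← Real.norm_eq_abs]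
  refine (norm_integral_le_of_norm_le_const (C := 2 * S * (1 / 4) ^ (k / τ))
    (Eventually.of_forall fun z' => ?_)).trans (by simp)
  refine (abs_integral_sub_le_tvDist _ _ hφ hS hb).trans ?_
  gcongr
  exact (tvDist_le_dobrushin _ _ _).trans (h.mixing k)

variable {ξ : Measure Z} {Q : Kernel Z Z} [IsMarkovKernel Q] [IsProbabilityMeasure ξ]

instance : IsProbabilityMeasure (chainLaw ξ Q) :=
  inferInstanceAs (IsProbabilityMeasure (Kernel.trajMeasure (X := fun _ => Z) ξ _))

theorem lintegral_chainLaw_succ (b : ℕ) {Ψ : (Finset.Iic b → Z) → Z → ENNReal}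
    (hΨ : Measurable (Function.uncurry Ψ)) :
    ∫⁻ z, Ψ (Preorder.frestrictLe b z) (z (b + 1)) ∂chainLaw ξ Q =
      ∫⁻ z, ∫⁻ y, Ψ (Preorder.frestrictLe b z) y ∂Q (z b) ∂chainLaw ξ Q := by
  have h := Kernel.map_frestrictLe_trajMeasure_compProd_eq_map_trajMeasure (X := fun _ => Z)
    (μ₀ := ξ) (κ := fun n => Q.comap (fun path : (i : Finset.Iic n) → Z => path ⟨n, by simp⟩)
      (measurable_pi_apply _)) (a := b)
  have h2 := congrArg (fun m => ∫⁻ q, Function.uncurry Ψ q ∂m) h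
  rw [Measure.lintegral_compProd hΨ, lintegral_map hΨ (by fun_prop),
    lintegral_map (by fun_prop) (by fun_prop)] at h2
  exact h2.symm

/-- The Markov property at lag k. The last step is integrated out first, which leaves the previous
lag for a new integrand; hence the induction over all Ψ. -/
theorem lintegral_chainLaw_add (b k : ℕ) {Ψ : (Finset.Iic b → Z) → Z → ENNReal}
    (hΨ : Measurable (Function.uncurry Ψ)) :
    ∫⁻ z, Ψ (Preorder.frestrictLe b z) (z (b + k)) ∂chainLaw ξ Q =
      ∫⁻ z, ∫⁻ y, Ψ (Preorder.frestrictLe b z) y ∂(Q ^ k) (z b) ∂chainLaw ξ Q := by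
  induction k generalizing Ψ with
  | zero =>
    refine lintegral_congr fun z => ?_
    change _ = ∫⁻ y, Ψ (Preorder.frestrictLe b z) y ∂(Kernel.id (z b))
    rw [Kernel.id_apply, lintegral_dirac' (z b) (f := Ψ (Preorder.frestrictLe b z))
      (hΨ.comp measurable_prodMk_left)]
    rfl
  | succ k ih =>
    have hr0 : Measurable (Preorder.frestrictLe₂ (π := fun _ : ℕ => Z) (Nat.le_add_right b k)) :=
      measurable_pi_lambda _ fun i => measurable_pi_apply (_ : Finset.Iic (b + k))
    have hr : Measurable (fun q : (Finset.Iic (b + k) → Z) × Z =>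
        (Preorder.frestrictLe₂ (π := fun _ : ℕ => Z) (Nat.le_add_right b k) q.1, q.2)) :=
      (hr0.comp measurable_fst).prodMk measurable_snd
    have h1 := lintegral_chainLaw_succ (ξ := ξ) (Q := Q) (b + k)
      (Ψ := fun p y => Ψ (Preorder.frestrictLe₂ (π := fun _ : ℕ => Z) (Nat.le_add_right b k) p) y)
      (hΨ.comp hr)
    have h2 := ih (Ψ := fun p w => ∫⁻ y, Ψ p y ∂Q w)
      (Measurable.lintegral_kernel_prod_right' (κ := Q.comap Prod.snd measurable_snd)
        (f := fun q : ((Finset.Iic b → Z) × Z) × Z => Ψ q.1.1 q.2)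
        (hΨ.comp ((measurable_fst.comp measurable_fst).prodMk measurable_snd)))
    refine h1.trans (h2.trans ?_)
    refine lintegral_congr fun z => ?_
    rw [pow_succ']
    exact (Kernel.lintegral_comp Q (Q ^ k) (z b) (hΨ.comp measurable_prodMk_left)).symm

theorem map_chainLaw_add (b k : ℕ) :
    (chainLaw ξ Q).map (fun z : ℕ → Z => (Preorder.frestrictLe (π := fun _ : ℕ => Z) b z, z (b + k))) =
      ((chainLaw ξ Q).map (Preorder.frestrictLe (π := fun _ => Z) b)) ⊗ₘ
        ((Q ^ k).comap (fun p : (i : Finset.Iic b) → Z => p ⟨b, by simp⟩) (measurable_pi_apply _)) := by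
  have hm : Measurable (Preorder.frestrictLe (π := fun _ : ℕ => Z) b) :=
    Preorder.measurable_frestrictLe b
  refine Measure.ext_of_lintegral _ fun g hg => ?_
  rw [Measure.lintegral_compProd hg, lintegral_map hg (by fun_prop),
    lintegral_map (by fun_prop) (by fun_prop)]
  exact lintegral_chainLaw_add b k (Ψ := fun p y => g (p, y)) hg

/-- Decay of correlations along the chain. -/
theorem IsUniformlyErgodic.abs_integral_chainLaw_le {π : Measure Z}
    [IsProbabilityMeasure π] {τ : ℕ} (h : IsUniformlyErgodic Q π τ) (b k : ℕ)
    {φ : (Finset.Iic b → Z) → Z → ℝ} (hφ : Measurable (Function.uncurry φ)) {S : ℝ} (hS : 0 ≤ S)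
    (hb : ∀ p z, |φ p z| ≤ S) (h0 : ∀ p, ∫ z, φ p z ∂π = 0) :
    |∫ z, φ (Preorder.frestrictLe b z) (z (b + k)) ∂chainLaw ξ Q| ≤
      2 * S * (1 / 4) ^ (k / τ) := by
  have h1 : ∫ z, φ (Preorder.frestrictLe b z) (z (b + k)) ∂chainLaw ξ Q =
      ∫ p, ∫ y, φ p y ∂((Q ^ k).comap (fun p : (i : Finset.Iic b) → Z => p ⟨b, by simp⟩)
        (measurable_pi_apply _)) p ∂(chainLaw ξ Q).map (Preorder.frestrictLe (π := fun _ => Z) b) := by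
    have : IsProbabilityMeasure ((chainLaw ξ Q).map (Preorder.frestrictLe (π := fun _ => Z) b)) :=
      Measure.isProbabilityMeasure_map (by fun_prop)
    have h2 := Measure.integral_compProd (f := Function.uncurry φ)
      (μ := (chainLaw ξ Q).map (Preorder.frestrictLe (π := fun _ => Z) b))
      (κ := (Q ^ k).comap (fun p : (i : Finset.Iic b) → Z => p ⟨b, by simp⟩)
        (measurable_pi_apply _)) ?_
    · rw [← map_chainLaw_add, integral_map (by fun_prop) hφ.aestronglyMeasurable] at h2
      exact h2
    · exact Integrable.of_bound hφ.aestronglyMeasurable S (Eventually.of_forall fun q => hb _ _)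
  have : IsProbabilityMeasure ((chainLaw ξ Q).map (Preorder.frestrictLe (π := fun _ => Z) b)) :=
      Measure.isProbabilityMeasure_map (by fun_prop)
  rw [h1, ← Real.norm_eq_abs]
  refine (norm_integral_le_of_norm_le_const (C := 2 * S * (1 / 4) ^ (k / τ))
    (Eventually.of_forall fun p => ?_)).trans (by simp)
  exact h.abs_integral_pow_le (hφ.comp measurable_prodMk_left) hS (hb p) (h0 p) k _
end Chain

/-! ### Second moments of sums: along the chain and for independent vectors -/

theorem sum_range_geometric_div_le {τ : ℕ} (hτ : 0 < τ) (m : ℕ) :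
    ∑ k ∈ Finset.range m, (1 / 4 : ℝ) ^ (k / τ) ≤ 4 / 3 * τ := by
  -- The exponent is constant on blocks of length τ, so q full blocks form τ times a geometric
  -- series.
  have key (q : ℕ) : ∑ k ∈ Finset.range (τ * q), (1 / 4 : ℝ) ^ (k / τ) =
      τ * (4 / 3 * (1 - (1 / 4) ^ q)) := by
    induction q with
    | zero => simp
    | succ q ih =>
      rw [mul_add_one, Finset.sum_range_add, ih]
      have : ∀ i ∈ Finset.range τ, (1 / 4 : ℝ) ^ ((τ * q + i) / τ) = (1 / 4) ^ q := by
        intro i hi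
        rw [Nat.mul_add_div hτ, Nat.div_eq_of_lt (Finset.mem_range.1 hi), add_zero]
      rw [Finset.sum_congr rfl this]
      simp only [Finset.sum_const, Finset.card_range, nsmul_eq_mul]
      ring
  have h1 : ∑ k ∈ Finset.range m, (1 / 4 : ℝ) ^ (k / τ) ≤
      ∑ k ∈ Finset.range (τ * m), (1 / 4 : ℝ) ^ (k / τ) :=
    Finset.sum_le_sum_of_subset_of_nonneg
      (Finset.range_subset_range.2 (Nat.le_mul_of_pos_left m hτ)) fun _ _ _ => by positivity
  refine h1.trans ?_
  rw [key]
  have : (0 : ℝ) ≤ τ * (1 / 4) ^ m := by positivity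
  nlinarith

/-- For fixed s the indices on either side run through distinct distances, each side contributing at
most 4τ/3. -/
theorem sum_sum_geometric_dist_le {τ : ℕ} (hτ : 0 < τ) (m : ℕ) :
    ∑ s ∈ Finset.range m, ∑ s' ∈ Finset.range m, (1 / 4 : ℝ) ^ ((max s s' - min s s') / τ) ≤
      m * (8 / 3 * τ) := by
  have inner_le : ∀ s ∈ Finset.range m,
      ∑ s' ∈ Finset.range m, (1 / 4 : ℝ) ^ ((max s s' - min s s') / τ) ≤ 8 / 3 * τ := by
    intro s hs
    have hs := Finset.mem_range.1 hs
    have hm : m = s + (m - s) := by omega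
    have h1 : ∑ s' ∈ Finset.range s, (1 / 4 : ℝ) ^ ((max s s' - min s s') / τ) ≤ 4 / 3 * τ := by
      have : ∑ s' ∈ Finset.range s, (1 / 4 : ℝ) ^ ((max s s' - min s s') / τ) =
          ∑ k ∈ Finset.range s, (1 / 4 : ℝ) ^ ((k + 1) / τ) := by
        rw [← Finset.sum_range_reflect]
        refine Finset.sum_congr rfl fun k hk => ?_
        have := Finset.mem_range.1 hk
        congr 2
        omega
      rw [this]
      refine le_trans ?_ (sum_range_geometric_div_le hτ (s + 1))
      rw [Finset.sum_range_succ']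
      linarith [show (0 : ℝ) ≤ (1 / 4) ^ (0 / τ) by positivity]
    have h2 : ∑ k ∈ Finset.range (m - s), (1 / 4 : ℝ) ^ ((max s (s + k) - min s (s + k)) / τ) ≤
        4 / 3 * τ := by
      refine le_trans (le_of_eq ?_) (sum_range_geometric_div_le hτ (m - s))
      refine Finset.sum_congr rfl fun k _ => ?_
      congr 2
      omega
    rw [hm, Finset.sum_range_add]
    linarith
  refine (Finset.sum_le_sum inner_le).trans (by simp)

section
variable {Z : Type*} [MeasurableSpace Z] {ξ : Measure Z} {Q : Kernel Z Z} [IsMarkovKernel Q]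
  [IsProbabilityMeasure ξ]

/-- Second moment of a sum along the chain of a centred function whose parameter is determined by
the past. -/
theorem IsUniformlyErgodic.integral_norm_sum_sq_le {π : Measure Z}
    [IsProbabilityMeasure π] {τ : ℕ} (hτ : 0 < τ) (h : IsUniformlyErgodic Q π τ)
    {H : Vec d → Z → Vec d} (hH : Measurable (Function.uncurry H)) {S : ℝ} (hS : 0 ≤ S)
    (hb : ∀ x z, ‖H x z‖ ≤ S) (h0 : ∀ x, ∫ z, H x z ∂π = 0)
    {x : (ℕ → Z) → Vec d} (hx : Measurable x) (c : ℕ)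
    (hdep : ∀ z z' : ℕ → Z, (∀ i < c, z i = z' i) → x z = x z') (m : ℕ) :
    ∫ z, ‖∑ s ∈ Finset.range m, H (x z) (z (c + s))‖ ^ 2 ∂chainLaw ξ Q ≤
      m * (16 / 3 * τ * S ^ 2) := by
  have hHs (s : ℕ) : Measurable (fun z : ℕ → Z => H (x z) (z (c + s))) :=
    hH.comp (hx.prodMk (measurable_pi_apply _))
  have hprod (s s' : ℕ) (z : ℕ → Z) :
      |(inner ℝ (H (x z) (z (c + s))) (H (x z) (z (c + s'))) : ℝ)| ≤ S ^ 2 := by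
    refine (abs_real_inner_le_norm _ _).trans ?_
    rw [sq]
    exact mul_le_mul (hb _ _) (hb _ _) (norm_nonneg _) hS
  have hint (s s' : ℕ) : Integrable
      (fun z : ℕ → Z => (inner ℝ (H (x z) (z (c + s))) (H (x z) (z (c + s'))) : ℝ))
      (chainLaw ξ Q) :=
    Integrable.of_bound ((hHs s).inner (hHs s')).aestronglyMeasurable (S ^ 2)
      (Eventually.of_forall (hprod s s'))
  obtain ⟨z0⟩ : Nonempty Z := by
    by_contra hne
    rw [not_nonempty_iff] at hne
    exact (IsProbabilityMeasure.ne_zero π) (Measure.eq_zero_of_isEmpty π)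
  have hpair (s k : ℕ) :
      |∫ z, (inner ℝ (H (x z) (z (c + s))) (H (x z) (z (c + s + k))) : ℝ) ∂chainLaw ξ Q| ≤
        2 * S ^ 2 * (1 / 4) ^ (k / τ) := by
    -- Pads a finite path by an arbitrary state so that x, a function of infinite paths, can be
    -- evaluated on it. The padding is invisible: x reads only coordinates below c.
    let ext : (Finset.Iic (c + s) → Z) → (ℕ → Z) := fun p i =>
      if hi : i ∈ Finset.Iic (c + s) then p ⟨i, hi⟩ else z0
    have hext : Measurable ext := by
      refine measurable_pi_lambda _ fun i => ?_
      by_cases hi : i ∈ Finset.Iic (c + s)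
      · simp only [ext, hi, dite_true]
        exact measurable_pi_apply _
      · simp only [ext, hi, dite_false]
        exact measurable_const
    have hxe (z : ℕ → Z) : x (ext (Preorder.frestrictLe (π := fun _ => Z) (c + s) z)) = x z := by
      refine hdep _ _ fun i hi => ?_
      have : i ≤ c + s := by omega
      simp [ext, this]
    have hee (z : ℕ → Z) : ext (Preorder.frestrictLe (π := fun _ => Z) (c + s) z) (c + s)
        = z (c + s) := by
      simp [ext]
    have hm : Measurable (fun q : (Finset.Iic (c + s) → Z) × Z =>
        (inner ℝ (H (x (ext q.1)) (ext q.1 (c + s))) (H (x (ext q.1)) q.2) : ℝ)) := by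
      have h1 : Measurable (fun q : (Finset.Iic (c + s) → Z) × Z => ext q.1) :=
        hext.comp measurable_fst
      exact (hH.comp ((hx.comp h1).prodMk ((measurable_pi_apply _).comp h1))).inner
        (hH.comp ((hx.comp h1).prodMk measurable_snd))
    have := h.abs_integral_chainLaw_le (ξ := ξ) (c + s) k
      (φ := fun p y => (inner ℝ (H (x (ext p)) (ext p (c + s))) (H (x (ext p)) y) : ℝ)) hm
      (S := S ^ 2) (by positivity) (fun p y => ?_) (fun p => ?_)
    · simpa only [hxe, hee] using this
    · refine (abs_real_inner_le_norm _ _).trans ?_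
      rw [sq]
      exact mul_le_mul (hb _ _) (hb _ _) (norm_nonneg _) hS
    · rw [integral_inner, h0, inner_zero_right]
      exact Integrable.of_bound (hH.comp measurable_prodMk_left).aestronglyMeasurable S
        (Eventually.of_forall fun y => hb _ y)
  have hpair' (s s' : ℕ) :
      ∫ z, (inner ℝ (H (x z) (z (c + s))) (H (x z) (z (c + s'))) : ℝ) ∂chainLaw ξ Q ≤
        2 * S ^ 2 * (1 / 4) ^ ((max s s' - min s s') / τ) := by
    rcases le_total s s' with hss | hss
    · obtain ⟨k, rfl⟩ := Nat.exists_eq_add_of_le hss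
      have := (le_abs_self _).trans (hpair s k)
      rw [add_assoc] at this
      simpa using this
    · obtain ⟨k, rfl⟩ := Nat.exists_eq_add_of_le hss
      have := (le_abs_self _).trans (hpair s' k)
      rw [add_assoc] at this
      simp only [real_inner_comm] at this ⊢
      simpa using this
  have hexp (z : ℕ → Z) : ‖∑ s ∈ Finset.range m, H (x z) (z (c + s))‖ ^ 2 =
      ∑ s ∈ Finset.range m, ∑ s' ∈ Finset.range m,
        (inner ℝ (H (x z) (z (c + s))) (H (x z) (z (c + s'))) : ℝ) := by
    rw [← real_inner_self_eq_norm_sq, sum_inner]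
    simp only [inner_sum]
  simp only [hexp]
  rw [integral_finsetSum _ fun s _ => integrable_finsetSum _ fun s' _ => hint s s']
  simp_rw [integral_finsetSum _ fun s' _ => hint _ s']
  calc _ ≤ ∑ s ∈ Finset.range m, ∑ s' ∈ Finset.range m,
        2 * S ^ 2 * (1 / 4 : ℝ) ^ ((max s s' - min s s') / τ) :=
      Finset.sum_le_sum fun s _ => Finset.sum_le_sum fun s' _ => hpair' s s'
    _ = 2 * S ^ 2 * ∑ s ∈ Finset.range m, ∑ s' ∈ Finset.range m,
        (1 / 4 : ℝ) ^ ((max s s' - min s s') / τ) := by simp only [Finset.mul_sum]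
    _ ≤ 2 * S ^ 2 * (m * (8 / 3 * τ)) := by
      gcongr
      exact sum_sum_geometric_dist_le hτ m
    _ = _ := by ring
end

/-- Bias-variance bound for a sum of independent vectors. -/
theorem integral_norm_sum_sq_infinitePi_le {S : Type*} [MeasurableSpace S] (ν : Measure S)
    [IsProbabilityMeasure ν] {Y : ℕ → S → Vec d} (hY : ∀ i, Measurable (Y i)) {K : ℝ}
    (hK : ∀ i s, ‖Y i s‖ ≤ K) (n : ℕ) :
    ∫ v, ‖∑ i ∈ Finset.range n, Y i (v i)‖ ^ 2 ∂(Measure.infinitePi fun _ : ℕ => ν) ≤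
      ∑ i ∈ Finset.range n, ∫ s, ‖Y i s‖ ^ 2 ∂ν + ‖∑ i ∈ Finset.range n, ∫ s, Y i s ∂ν‖ ^ 2 := by
  set P := Measure.infinitePi fun _ : ℕ => ν with hP
  have hint (i j : ℕ) : Integrable (fun v : ℕ → S => (inner ℝ (Y i (v i)) (Y j (v j)) : ℝ)) P := by
    refine Integrable.of_bound (C := K * K) (((hY i).comp (measurable_pi_apply i)).inner
      ((hY j).comp (measurable_pi_apply j))).aestronglyMeasurable (Eventually.of_forall fun v => ?_)
    exact (abs_real_inner_le_norm _ _).trans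
      (mul_le_mul (hK _ _) (hK _ _) (norm_nonneg _) ((norm_nonneg _).trans (hK i (v i))))
  have hmp (i : ℕ) : MeasurePreserving (Function.eval i) P ν := measurePreserving_eval_infinitePi _ i
  have hYi (i : ℕ) : Integrable (Y i) ν :=
    Integrable.of_bound (hY i).aestronglyMeasurable K (Eventually.of_forall (hK i))
  have hdiag (i : ℕ) : ∫ v, (inner ℝ (Y i (v i)) (Y i (v i)) : ℝ) ∂P = ∫ s, ‖Y i s‖ ^ 2 ∂ν := by
    rw [← (hmp i).map_eq, integral_map (hmp i).measurable.aemeasurable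
      ((hY i).norm.pow_const 2).aestronglyMeasurable]
    simp
  have hoff (i j : ℕ) (hij : i ≠ j) : ∫ v, (inner ℝ (Y i (v i)) (Y j (v j)) : ℝ) ∂P =
      inner ℝ (∫ s, Y i s ∂ν) (∫ s, Y j s ∂ν) := by
    have hind : IndepFun (fun v : ℕ → S => v i) (fun v => v j) P :=
      (iIndepFun_infinitePi (P := fun _ : ℕ => ν) (X := fun _ => id) fun _ => measurable_id).indepFun hij
    have hmap := (indepFun_iff_map_prod_eq_prod_map_map (measurable_pi_apply i).aemeasurable
      (measurable_pi_apply j).aemeasurable).1 hind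
    have hi : P.map (fun v => v i) = ν := (hmp i).map_eq
    have hj : P.map (fun v => v j) = ν := (hmp j).map_eq
    rw [hi, hj] at hmap
    have hm2 : Measurable (fun q : S × S => (inner ℝ (Y i q.1) (Y j q.2) : ℝ)) :=
      ((hY i).comp measurable_fst).inner ((hY j).comp measurable_snd)
    have h1 : ∫ v, (inner ℝ (Y i (v i)) (Y j (v j)) : ℝ) ∂P =
        ∫ q, (inner ℝ (Y i q.1) (Y j q.2) : ℝ) ∂(ν.prod ν) := by
      rw [← hmap, integral_map (by fun_prop) hm2.aestronglyMeasurable]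
    rw [h1, integral_prod _ (Integrable.of_bound (C := K * K) hm2.aestronglyMeasurable
      (Eventually.of_forall fun q => (abs_real_inner_le_norm _ _).trans
        (mul_le_mul (hK _ _) (hK _ _) (norm_nonneg _) ((norm_nonneg _).trans (hK i q.1)))))]
    simp_rw [integral_inner (hYi j)]
    simp_rw [real_inner_comm (∫ s, Y j s ∂ν)]
    rw [integral_inner (hYi i), real_inner_comm]
  have hexp (v : ℕ → S) : ‖∑ i ∈ Finset.range n, Y i (v i)‖ ^ 2 =
      ∑ i ∈ Finset.range n, ∑ j ∈ Finset.range n, (inner ℝ (Y i (v i)) (Y j (v j)) : ℝ) := by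
    rw [← real_inner_self_eq_norm_sq, sum_inner]
    simp only [inner_sum]
  have hexp2 : ‖∑ i ∈ Finset.range n, ∫ s, Y i s ∂ν‖ ^ 2 =
      ∑ i ∈ Finset.range n, ∑ j ∈ Finset.range n,
        (inner ℝ (∫ s, Y i s ∂ν) (∫ s, Y j s ∂ν) : ℝ) := by
    rw [← real_inner_self_eq_norm_sq, sum_inner]
    simp only [inner_sum]
  simp only [hexp]
  rw [integral_finsetSum _ fun i _ => integrable_finsetSum _ fun j _ => hint i j]
  simp_rw [integral_finsetSum _ fun j _ => hint _ j]
  rw [hexp2, ← Finset.sum_add_distrib]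
  refine Finset.sum_le_sum fun i hi => ?_
  rw [← Finset.add_sum_erase _ _ hi, ← Finset.add_sum_erase _ (fun j =>
    (inner ℝ (∫ s, Y i s ∂ν) (∫ s, Y j s ∂ν) : ℝ)) hi, hdiag]
  have : ∑ j ∈ (Finset.range n).erase i, ∫ v, (inner ℝ (Y i (v i)) (Y j (v j)) : ℝ) ∂P =
      ∑ j ∈ (Finset.range n).erase i, (inner ℝ (∫ s, Y i s ∂ν) (∫ s, Y j s ∂ν) : ℝ) :=
    Finset.sum_congr rfl fun j hj => hoff i j (Finset.ne_of_mem_erase hj).symm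
  rw [this]
  -- Off the diagonal both sides agree; on it the right side has the squared mean of Y i in excess.
  have := real_inner_self_nonneg (x := ∫ s, Y i s ∂ν)
  linarith

/-! ### Mean of the two-point estimator -/

section Estimator
variable {Z : Type*} [MeasurableSpace Z]

/-- Direction average of the observation noise. -/
noncomputable def noiseDir (F : Vec d → Z → ℝ) (f : Vec d → ℝ) (t : ℝ) (x : Vec d) (z : Z) : Vec d :=
  (d : ℝ) • ∫ e : sphere (0 : Vec d) 1, (F (x + t • (e : Vec d)) z - f (x + t • (e : Vec d))) •
    (e : Vec d) ∂sphereLaw d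

/-- Mean of the random-direction estimator under the stationary noise. -/
noncomputable def meanGrad (f δ : Vec d → ℝ) (t : ℝ) (x : Vec d) : Vec d :=
  ((d : ℝ) / t) • ∫ e : sphere (0 : Vec d) 1, (f (x + t • (e : Vec d)) + δ (x + t • (e : Vec d))) •
    (e : Vec d) ∂sphereLaw d

variable {L μ σ Δ t : ℝ} {τ : ℕ} {Q : Kernel Z Z} {π : Measure Z} {F : Vec d → Z → ℝ}
  {δ f : Vec d → ℝ} {xs : Vec d}

theorem IsProblem.noise_le (h : IsProblem L μ σ Δ τ Q π F δ f xs) (hσ : 0 ≤ σ) (x : Vec d) (z : Z) :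
    |F x z - f x| ≤ σ := by
  exact (pow_le_pow_iff_left₀ (abs_nonneg _) hσ two_ne_zero).1 (h.oracle.bounded x z)

theorem IsProblem.measurable_f (h : IsProblem L μ σ Δ τ Q π F δ f xs) : Measurable f :=
  h.smooth.continuous.measurable

theorem IsProblem.measurable_section (h : IsProblem L μ σ Δ τ Q π F δ f xs) (z : Z) :
    Measurable (fun x => F x z) :=
  h.oracle.measurable.comp measurable_prodMk_right

theorem IsProblem.measurable_noiseDir (hd : 0 < d) (h : IsProblem L μ σ Δ τ Q π F δ f xs) :
    Measurable (Function.uncurry (noiseDir F f t)) := by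
  have := isProbabilityMeasure_sphereLaw hd
  have hF := h.oracle.measurable
  have hf := h.measurable_f
  have hg : Measurable (fun q : (Vec d × Z) × sphere (0 : Vec d) 1 =>
      (F (q.1.1 + t • (q.2 : Vec d)) q.1.2 - f (q.1.1 + t • (q.2 : Vec d))) • (q.2 : Vec d)) := by
    have h1 : Measurable (fun q : (Vec d × Z) × sphere (0 : Vec d) 1 => q.1.1 + t • (q.2 : Vec d)) := by
      fun_prop
    have h2 : Measurable (fun q : (Vec d × Z) × sphere (0 : Vec d) 1 =>
        F (q.1.1 + t • (q.2 : Vec d)) q.1.2) := hF.comp (h1.prodMk (by fun_prop))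
    exact (h2.sub (hf.comp h1)).smul (by fun_prop)
  have := (hg.stronglyMeasurable.integral_prod_right' (ν := sphereLaw d)).const_smul (d : ℝ)
  exact this.measurable

/-- Isotropy gains √d over the trivial bound dσ. Squared, this turns the price of mixing into dτσ²
instead of d²τσ². -/
theorem IsProblem.norm_noiseDir_le (hd : 0 < d) (h : IsProblem L μ σ Δ τ Q π F δ f xs)
    (hσ : 0 ≤ σ) (x : Vec d) (z : Z) : ‖noiseDir F f t x z‖ ≤ Real.sqrt d * σ := by
  have hm := h.measurable_section z
  have hf := h.measurable_f
  have hd' : (0 : ℝ) < d := by exact_mod_cast hd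
  have := norm_integral_smul_sphereLaw_sq_le hd
    (φ := fun e => F (x + t • e) z - f (x + t • e))
    ((hm.comp (by fun_prop)).sub (hf.comp (by fun_prop))) (S := σ)
    fun e _ => h.noise_le hσ _ _
  refine abs_le_of_sq_le_sq' ?_ (by positivity) |>.2
  rw [noiseDir, norm_smul, mul_pow, mul_pow, Real.sq_sqrt hd'.le, Real.norm_of_nonneg hd'.le]
  calc (d : ℝ) ^ 2 * _ ≤ (d : ℝ) ^ 2 * (σ ^ 2 / d) := by gcongr
    _ = d * σ ^ 2 := by field_simp

theorem IsProblem.integral_noiseDir [IsProbabilityMeasure π] (hd : 0 < d)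
    (h : IsProblem L μ σ Δ τ Q π F δ f xs) (hσ : 0 ≤ σ) (x : Vec d) :
    ∫ z, noiseDir F f t x z ∂π = 0 := by
  have := isProbabilityMeasure_sphereLaw hd
  have hF := h.oracle.measurable
  have hf := h.measurable_f
  have hg : Measurable (fun q : Z × sphere (0 : Vec d) 1 =>
      (F (x + t • (q.2 : Vec d)) q.1 - f (x + t • (q.2 : Vec d))) • (q.2 : Vec d)) := by
    have h1 : Measurable (fun q : Z × sphere (0 : Vec d) 1 => x + t • (q.2 : Vec d)) := by
      fun_prop
    have h2 : Measurable (fun q : Z × sphere (0 : Vec d) 1 =>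
        F (x + t • (q.2 : Vec d)) q.1) := hF.comp (h1.prodMk (by fun_prop))
    exact (h2.sub (hf.comp h1)).smul (by fun_prop)
  have hi : Integrable (Function.uncurry fun (z : Z) (e : sphere (0 : Vec d) 1) =>
      (F (x + t • (e : Vec d)) z - f (x + t • (e : Vec d))) • (e : Vec d)) (π.prod (sphereLaw d)) := by
    refine Integrable.of_bound hg.aestronglyMeasurable σ (Eventually.of_forall fun q => ?_)
    simpa [norm_smul, Function.uncurry] using h.noise_le hσ (x + t • (q.2 : Vec d)) q.1
  unfold noiseDir
  rw [integral_smul, integral_integral_swap hi]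
  have h0 (e : sphere (0 : Vec d) 1) :
      ∫ z, (F (x + t • (e : Vec d)) z - f (x + t • (e : Vec d))) • (e : Vec d) ∂π = 0 := by
    have hFi : Integrable (fun z => F (x + t • (e : Vec d)) z) π := by
      refine Integrable.of_bound (C := |f (x + t • (e : Vec d))| + σ)
        (hF.comp measurable_prodMk_left).aestronglyMeasurable (Eventually.of_forall fun z => ?_)
      have := h.noise_le hσ (x + t • (e : Vec d)) z
      have h3 := abs_add_le (f (x + t • (e : Vec d))) (F (x + t • (e : Vec d)) z - f (x + t • (e : Vec d)))
      rw [add_sub_cancel] at h3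
      rw [Real.norm_eq_abs]
      linarith
    rw [integral_smul_const, integral_sub hFi (integrable_const _), h.oracle.unbiased]
    simp
  simp [h0]

theorem IsProblem.integrable_smooth_smul (hd : 0 < d)
    (h : IsProblem L μ σ Δ τ Q π F δ f xs) (x : Vec d) :
    Integrable (fun e : sphere (0 : Vec d) 1 => f (x + t • (e : Vec d)) • (e : Vec d))
      (sphereLaw d) := by
  have hfc := h.smooth.continuous
  obtain ⟨C, hC⟩ := (isCompact_sphere (0 : Vec d) 1).exists_bound_of_continuousOn
    (f := fun e : Vec d => f (x + t • e) • e) (by fun_prop)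
  exact integrable_sphereLaw_of_bounded (g := fun e => f (x + t • e) • e) hd
    (Continuous.stronglyMeasurable (by fun_prop)) C fun e he => hC e (by simpa using he)

theorem IsProblem.integrable_error_smul (hd : 0 < d)
    (h : IsProblem L μ σ Δ τ Q π F δ f xs) (x : Vec d) :
    Integrable (fun e : sphere (0 : Vec d) 1 => δ (x + t • (e : Vec d)) • (e : Vec d))
      (sphereLaw d) := by
  have hδ := h.perturbation_measurable
  refine integrable_sphereLaw_of_bounded (g := fun e => δ (x + t • e) • e) hd
    (Measurable.stronglyMeasurable ((hδ.comp (by fun_prop)).smul measurable_id)) Δ fun e he => ?_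
  simpa [norm_smul, he] using h.perturbation_bounded _

theorem IsProblem.integrable_noise_smul (hd : 0 < d)
    (h : IsProblem L μ σ Δ τ Q π F δ f xs) (hσ : 0 ≤ σ) (x : Vec d) (z : Z) :
    Integrable (fun e : sphere (0 : Vec d) 1 => (F (x + t • (e : Vec d)) z - f (x + t • (e : Vec d))) •
      (e : Vec d)) (sphereLaw d) := by
  have hm := h.measurable_section z
  have hf := h.measurable_f
  refine integrable_sphereLaw_of_bounded (g := fun e => (F (x + t • e) z - f (x + t • e)) • e) hd
    (Measurable.stronglyMeasurable
      (((hm.comp (by fun_prop)).sub (hf.comp (by fun_prop))).smul measurable_id)) σ fun e he => ?_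
  simpa [norm_smul, he] using h.noise_le hσ _ _

/-- The smooth parts cancel by the divergence theorem and only the direction average of δ remains.
The extra factor 1/d that isotropy offers is given away. -/
theorem IsProblem.norm_meanGrad_sub_le (hd : 0 < d) (ht : 0 < t)
    (h : IsProblem L μ σ Δ τ Q π F δ f xs) (x : Vec d) :
    ‖meanGrad f δ t x - smoothGrad f t x‖ ^ 2 ≤ (d * Δ / t) ^ 2 := by
  have hδ := h.perturbation_measurable
  have hd' : (1 : ℝ) ≤ d := by exact_mod_cast hd
  have h1 : meanGrad f δ t x - smoothGrad f t x = ((d : ℝ) / t) •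
      ∫ e : sphere (0 : Vec d) 1, δ (x + t • (e : Vec d)) • (e : Vec d) ∂sphereLaw d := by
    rw [h.smooth.smoothGrad_eq hd ht, meanGrad]
    simp only [add_smul]
    rw [integral_add (h.integrable_smooth_smul hd x) (h.integrable_error_smul hd x), smul_add,
      add_sub_cancel_left]
  have h2 := norm_integral_smul_sphereLaw_sq_le hd (φ := fun e => δ (x + t • e))
    (hδ.comp (by fun_prop)) (S := Δ) fun e _ => h.perturbation_bounded _
  rw [h1, norm_smul, mul_pow, Real.norm_of_nonneg (by positivity)]
  calc ((d : ℝ) / t) ^ 2 * _ ≤ ((d : ℝ) / t) ^ 2 * (Δ ^ 2 / d) := by gcongr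
    _ ≤ ((d : ℝ) / t) ^ 2 * (Δ ^ 2 / 1) := by gcongr
    _ = _ := by ring

theorem IsProblem.integral_oracle_smul (hd : 0 < d)
    (h : IsProblem L μ σ Δ τ Q π F δ f xs) (hσ : 0 ≤ σ) (ht : 0 < t) (x : Vec d) (z : Z) :
    (d : ℝ) • ∫ e : sphere (0 : Vec d) 1, (F (x + t • (e : Vec d)) z + δ (x + t • (e : Vec d))) •
      (e : Vec d) ∂sphereLaw d = t • meanGrad f δ t x + noiseDir F f t x z := by
  have h1 (e : sphere (0 : Vec d) 1) :
      (F (x + t • (e : Vec d)) z + δ (x + t • (e : Vec d))) • (e : Vec d) =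
      (f (x + t • (e : Vec d)) + δ (x + t • (e : Vec d))) • (e : Vec d) +
      (F (x + t • (e : Vec d)) z - f (x + t • (e : Vec d))) • (e : Vec d) := by
    rw [← add_smul]
    congr 1
    ring
  have hi : Integrable (fun e : sphere (0 : Vec d) 1 =>
      (f (x + t • (e : Vec d)) + δ (x + t • (e : Vec d))) • (e : Vec d)) (sphereLaw d) := by
    simp only [add_smul]
    exact (h.integrable_smooth_smul hd x).add (h.integrable_error_smul hd x)
  simp only [h1]
  rw [integral_add hi (h.integrable_noise_smul hd hσ x z), smul_add, noiseDir, meanGrad, smul_smul,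
    mul_div_cancel₀ _ ht.ne']

theorem IsProblem.integrable_oracle_smul (hd : 0 < d)
    (h : IsProblem L μ σ Δ τ Q π F δ f xs) (hσ : 0 ≤ σ) (x : Vec d) (z : Z) :
    Integrable (fun e : sphere (0 : Vec d) 1 =>
      (F (x + t • (e : Vec d)) z + δ (x + t • (e : Vec d))) • (e : Vec d)) (sphereLaw d) := by
  have h1 := ((h.integrable_smooth_smul (t := t) hd x).add (h.integrable_error_smul (t := t) hd x)).add
    (h.integrable_noise_smul (t := t) hd hσ x z)
  refine h1.congr (Eventually.of_forall fun e => ?_)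
  simp only [Pi.add_apply, ← add_smul]
  congr 1
  ring

/-- The symmetry e ↦ −e turns the evaluation at x − te into one at x + te, so the two noise states
enter symmetrically. -/
theorem IsProblem.integral_gHat (hd : 0 < d)
    (h : IsProblem L μ σ Δ τ Q π F δ f xs) (hσ : 0 ≤ σ) (ht : 0 < t) (x : Vec d) (zp zm : Z) :
    ∫ e : sphere (0 : Vec d) 1, gHat (fun x z => F x z + δ x) t x (e : Vec d) zp zm ∂sphereLaw d =
      meanGrad f δ t x + (1 / (2 * t)) • (noiseDir F f t x zp + noiseDir F f t x zm) := by
  have hδ := h.perturbation_measurable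
  have hm := h.measurable_section zm
  have hneg : ∫ e : sphere (0 : Vec d) 1, (F (x - t • (e : Vec d)) zm + δ (x - t • (e : Vec d))) •
      (e : Vec d) ∂sphereLaw d = -∫ e : sphere (0 : Vec d) 1,
        (F (x + t • (e : Vec d)) zm + δ (x + t • (e : Vec d))) • (e : Vec d) ∂sphereLaw d := by
    rw [← integral_sphereLaw_neg hd (g := fun e => (F (x + t • e) zm + δ (x + t • e)) • e)
      (Measurable.stronglyMeasurable
        (((hm.comp (by fun_prop)).add (hδ.comp (by fun_prop))).smul measurable_id)),
      ← integral_neg]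
    simp [sub_eq_add_neg]
  have hi := h.integrable_oracle_smul (t := t) hd hσ x zp
  have hi2 : Integrable (fun e : sphere (0 : Vec d) 1 =>
      (F (x - t • (e : Vec d)) zm + δ (x - t • (e : Vec d))) • (e : Vec d)) (sphereLaw d) := by
    have := h.integrable_oracle_smul (t := -t) hd hσ x zm
    simpa [sub_eq_add_neg] using this
  have h1 (e : sphere (0 : Vec d) 1) : gHat (fun x z => F x z + δ x) t x (e : Vec d) zp zm =
      ((d : ℝ) / (2 * t)) • ((F (x + t • (e : Vec d)) zp + δ (x + t • (e : Vec d))) • (e : Vec d) -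
        (F (x - t • (e : Vec d)) zm + δ (x - t • (e : Vec d))) • (e : Vec d)) := by
    rw [gHat, ← sub_smul, smul_smul]
    congr 1
    ring
  simp only [h1]
  rw [integral_smul, integral_sub hi hi2, hneg, sub_neg_eq_add, div_eq_mul_one_div, mul_comm,
    ← smul_smul, smul_add, h.integral_oracle_smul hd hσ ht, h.integral_oracle_smul hd hσ ht,
    show t • meanGrad f δ t x + noiseDir F f t x zp + (t • meanGrad f δ t x + noiseDir F f t x zm)
      = (2 * t) • meanGrad f δ t x + (noiseDir F f t x zp + noiseDir F f t x zm) by module,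
    smul_add, smul_smul, one_div_mul_cancel (by positivity), one_smul]

/-- First-order expansion at x, with remainder in [0, Lt²/2] by convexity and smoothness. Keeping
⟨e, ∇f(x)⟩ instead of ‖∇f(x)‖ is essential: its mean square is smaller by a factor d. -/
theorem IsProblem.abs_oracle_difference_le (h : IsProblem L μ σ Δ τ Q π F δ f xs) (hσ : 0 ≤ σ)
    (ht : 0 < t) (hL : 0 ≤ L) (hμ : 0 ≤ μ) (x e : Vec d) (he : ‖e‖ = 1) (zp zm : Z) :
    |((F (x + t • e) zp + δ (x + t • e)) - (F (x - t • e) zm + δ (x - t • e))) / (2 * t)| ≤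
      |inner ℝ e (gradient f x)| + L * t + σ / t + Δ / t := by
  have h1 := h.smooth.upper x (x + t • e)
  have h2 := h.smooth.upper x (x - t • e)
  have h3 := h.stronglyConvex.2 (x + t • e) x
  have h4 := h.stronglyConvex.2 (x - t • e) x
  have h3' : 0 ≤ μ / 2 * ‖x + t • e - x‖ ^ 2 := by positivity
  have h4' : 0 ≤ μ / 2 * ‖x - t • e - x‖ ^ 2 := by positivity
  have hn1 : ‖x + t • e - x‖ ^ 2 = t ^ 2 := by simp [norm_smul, he]
  have hn2 : ‖x - t • e - x‖ ^ 2 = t ^ 2 := by simp [norm_smul, he]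
  have hi1 : (inner ℝ (gradient f x) (x + t • e - x) : ℝ) = t * inner ℝ e (gradient f x) := by
    rw [add_sub_cancel_left, inner_smul_right, real_inner_comm]
  have hi2 : (inner ℝ (gradient f x) (x - t • e - x) : ℝ) = -(t * inner ℝ e (gradient f x)) := by
    rw [sub_sub_cancel_left, inner_neg_right, inner_smul_right, real_inner_comm]
  rw [hn1, hi1] at h1
  rw [hn2, hi2] at h2
  rw [hi1] at h3
  rw [hi2] at h4
  obtain ⟨n1, n1'⟩ := abs_le.1 (h.noise_le hσ (x + t • e) zp)
  obtain ⟨n2, n2'⟩ := abs_le.1 (h.noise_le hσ (x - t • e) zm)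
  obtain ⟨p1, p1'⟩ := abs_le.1 (h.perturbation_bounded (x + t • e))
  obtain ⟨p2, p2'⟩ := abs_le.1 (h.perturbation_bounded (x - t • e))
  have ha := le_abs_self (inner ℝ e (gradient f x) : ℝ)
  have hb := neg_abs_le (inner ℝ e (gradient f x) : ℝ)
  have hLt : 0 ≤ L * t ^ 2 := by positivity
  rw [abs_div, abs_of_pos (by positivity : 0 < 2 * t), div_le_iff₀ (by positivity)]
  have : (|inner ℝ e (gradient f x)| + L * t + σ / t + Δ / t) * (2 * t) =
      2 * (t * |inner ℝ e (gradient f x)|) + 2 * (L * t ^ 2) + 2 * σ + 2 * Δ := by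
    field_simp
  rw [this]
  have ha' := mul_le_mul_of_nonneg_left ha ht.le
  have hb' := mul_le_mul_of_nonneg_left hb ht.le
  rw [abs_le]
  constructor <;> linarith

end Estimator

/-! ### Mean square error of a batch -/

section Variance
variable {Z : Type*} [MeasurableSpace Z]
variable {L μ σ Δ t : ℝ} {τ : ℕ} {Q : Kernel Z Z} {π : Measure Z} {F : Vec d → Z → ℝ}
  {δ f : Vec d → ℝ} {xs : Vec d}

/-- The part of the variance of a single sample which does not depend on the point. -/
noncomputable def baseVariance (d τ : ℕ) (L σ Δ t : ℝ) : ℝ :=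
  d ^ 2 * L ^ 2 * t ^ 2 + d * (d + τ) * σ ^ 2 / t ^ 2 + (d * Δ / t) ^ 2

theorem baseVariance_nonneg (d τ : ℕ) (L σ Δ t : ℝ) : 0 ≤ baseVariance d τ L σ Δ t := by
  unfold baseVariance
  positivity

theorem norm_add_sq_le (a b : Vec d) : ‖a + b‖ ^ 2 ≤ 2 * ‖a‖ ^ 2 + 2 * ‖b‖ ^ 2 := by
  have h := norm_add_le a b
  have h1 : ‖a + b‖ ^ 2 ≤ (‖a‖ + ‖b‖) ^ 2 := by gcongr
  nlinarith [sq_nonneg (‖a‖ - ‖b‖)]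

theorem norm_sub_sq_le (a b : Vec d) : ‖a - b‖ ^ 2 ≤ 2 * ‖a‖ ^ 2 + 2 * ‖b‖ ^ 2 := by
  simpa [sub_eq_add_neg] using norm_add_sq_le a (-b)

theorem IsProblem.norm_gHat_le (h : IsProblem L μ σ Δ τ Q π F δ f xs) (hσ : 0 ≤ σ)
    (ht : 0 < t) (hL : 0 ≤ L) (hμ : 0 ≤ μ) (x e : Vec d) (he : ‖e‖ = 1) (zp zm : Z) :
    ‖gHat (fun x z => F x z + δ x) t x e zp zm‖ ≤
      d * (|inner ℝ e (gradient f x)| + L * t + σ / t + Δ / t) := by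
  rw [gHat, norm_smul, he, mul_one, norm_mul, Real.norm_natCast]
  gcongr
  exact h.abs_oracle_difference_le hσ ht hL hμ x e he zp zm

theorem IsProblem.measurable_gHat (h : IsProblem L μ σ Δ τ Q π F δ f xs) (x : Vec d) (zp zm : Z) :
    Measurable (fun e => gHat (fun x z => F x z + δ x) t x e zp zm) := by
  have hδ := h.perturbation_measurable
  have hp := h.measurable_section zp
  have hm := h.measurable_section zm
  unfold gHat
  have h1 : Measurable fun e : Vec d => F (x + t • e) zp + δ (x + t • e) :=
    (hp.comp (by fun_prop)).add (hδ.comp (by fun_prop))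
  have h2 : Measurable fun e : Vec d => F (x - t • e) zm + δ (x - t • e) :=
    (hm.comp (by fun_prop)).add (hδ.comp (by fun_prop))
  exact (((h1.sub h2).div_const _).const_mul _).smul measurable_id

/-- The prefactor d² meets the mean ‖∇f(x)‖²/d of ⟨e, ∇f(x)⟩², so the gradient costs only a factor
d. The numerical constants come from splitting a square into four parts and from replacing ∇f and
`meanGrad` by `smoothGrad`. -/
theorem IsProblem.integral_gHat_sub_sq_le (hd : 0 < d)
    (h : IsProblem L μ σ Δ τ Q π F δ f xs) (hσ : 0 ≤ σ) (ht : 0 < t) (hL : 0 ≤ L) (hμ : 0 ≤ μ)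
    (x : Vec d) (zp zm : Z) :
    ∫ e : sphere (0 : Vec d) 1, ‖gHat (fun x z => F x z + δ x) t x (e : Vec d) zp zm -
        meanGrad f δ t x‖ ^ 2 ∂sphereLaw d ≤
      24 * (d * ‖smoothGrad f t x‖ ^ 2) + 24 * (d ^ 2 * L ^ 2 * t ^ 2)
        + 8 * (d ^ 2 * σ ^ 2 / t ^ 2) + 12 * (d * Δ / t) ^ 2 := by
  have hP := isProbabilityMeasure_sphereLaw hd
  have hd' : (1 : ℝ) ≤ d := by exact_mod_cast hd
  have hΔ : 0 ≤ Δ := (abs_nonneg _).trans (h.perturbation_bounded 0)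
  set m := meanGrad f δ t x with hm
  set q := gradient f x with hq
  set B := 8 * d ^ 2 * (L ^ 2 * t ^ 2 + σ ^ 2 / t ^ 2 + Δ ^ 2 / t ^ 2) + 2 * ‖m‖ ^ 2 with hB
  have hpt (e : sphere (0 : Vec d) 1) :
      ‖gHat (fun x z => F x z + δ x) t x (e : Vec d) zp zm - m‖ ^ 2 ≤
        8 * d ^ 2 * (inner ℝ (e : Vec d) q) ^ 2 + B := by
    have h1 := h.norm_gHat_le hσ ht hL hμ x e (by simp) zp zm
    have h2 := norm_sub_sq_le (gHat (fun x z => F x z + δ x) t x (e : Vec d) zp zm) m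
    have h3 : ‖gHat (fun x z => F x z + δ x) t x (e : Vec d) zp zm‖ ^ 2 ≤
        (d * (|inner ℝ (e : Vec d) q| + L * t + σ / t + Δ / t)) ^ 2 := by gcongr
    have h4 (a b c e : ℝ) : (a + b + c + e) ^ 2 ≤ 4 * (a ^ 2 + b ^ 2 + c ^ 2 + e ^ 2) := by
      nlinarith [sq_nonneg (a - b), sq_nonneg (a - c), sq_nonneg (a - e), sq_nonneg (b - c),
        sq_nonneg (b - e), sq_nonneg (c - e)]
    have h5 := h4 |inner ℝ (e : Vec d) q| (L * t) (σ / t) (Δ / t)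
    rw [sq_abs, mul_pow, div_pow, div_pow] at h5
    rw [mul_pow] at h3
    have h6 := mul_le_mul_of_nonneg_left h5 (sq_nonneg (d : ℝ))
    rw [hB]
    linarith
  have hi : Integrable (fun e : sphere (0 : Vec d) 1 => (inner ℝ (e : Vec d) q : ℝ) ^ 2)
      (sphereLaw d) := by
    refine integrable_sphereLaw_of_bounded (g := fun e => (inner ℝ e q : ℝ) ^ 2) hd
      (Continuous.stronglyMeasurable (by fun_prop)) (‖q‖ ^ 2) fun e he => ?_
    rw [norm_pow]
    gcongr
    simpa [he] using norm_inner_le_norm (𝕜 := ℝ) e q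
  have hint : ∫ e : sphere (0 : Vec d) 1, ‖gHat (fun x z => F x z + δ x) t x (e : Vec d) zp zm -
        m‖ ^ 2 ∂sphereLaw d ≤ 8 * d ^ 2 * (‖q‖ ^ 2 / d) + B := by
    refine (integral_mono_of_nonneg (Eventually.of_forall fun e => by positivity)
      ((hi.const_mul _).add (integrable_const B)) (Eventually.of_forall hpt)).trans (le_of_eq ?_)
    have := integral_add (hi.const_mul (8 * (d : ℝ) ^ 2)) (integrable_const (μ := sphereLaw d) B)
    refine this.trans ?_
    rw [integral_const_mul, integral_inner_sq_sphereLaw hd]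
    simp
  have hm1 := h.norm_meanGrad_sub_le hd ht x
  have hm2 := norm_add_sq_le (m - smoothGrad f t x) (smoothGrad f t x)
  rw [sub_add_cancel] at hm2
  have hq1 := h.smooth.norm_gradient_sub_smoothGrad_le hL ht.le x
  have hq1' : ‖q - smoothGrad f t x‖ ^ 2 ≤ (L * t) ^ 2 := by gcongr
  have hq2 := norm_add_sq_le (q - smoothGrad f t x) (smoothGrad f t x)
  rw [sub_add_cancel] at hq2
  have e1 : 8 * (d : ℝ) ^ 2 * (‖q‖ ^ 2 / d) = 8 * (d * ‖q‖ ^ 2) := by field_simp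
  have e2 : (d * Δ / t) ^ 2 = d ^ 2 * (Δ ^ 2 / t ^ 2) := by ring
  have e3 : (d : ℝ) ^ 2 * σ ^ 2 / t ^ 2 = d ^ 2 * (σ ^ 2 / t ^ 2) := by ring
  have e4 : (d : ℝ) * ‖q‖ ^ 2 ≤ d * (2 * (L * t) ^ 2 + 2 * ‖smoothGrad f t x‖ ^ 2) := by
    gcongr
    linarith
  have e5 : (d : ℝ) * (L * t) ^ 2 ≤ d ^ 2 * L ^ 2 * t ^ 2 := by
    have : (d : ℝ) * (L * t) ^ 2 ≤ d * (d * (L * t) ^ 2) :=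
      mul_le_mul_of_nonneg_left (le_mul_of_one_le_left (sq_nonneg _) hd') (by positivity)
    linarith
  have e6 : ‖smoothGrad f t x‖ ^ 2 ≤ d * ‖smoothGrad f t x‖ ^ 2 :=
    le_mul_of_one_le_left (sq_nonneg _) hd'
  rw [hB, e1] at hint
  rw [e3]
  rw [e2] at hm1 ⊢
  nlinarith

theorem sum_range_two_mul_eq (a : ℕ → Vec d) (n : ℕ) :
    ∑ i ∈ Finset.range n, (a (2 * i) + a (2 * i + 1)) = ∑ s ∈ Finset.range (2 * n), a s := by
  induction n with
  | zero => simp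
  | succ n ih =>
    rw [Finset.sum_range_succ, ih, show 2 * (n + 1) = 2 * n + 1 + 1 by ring, Finset.sum_range_succ,
      Finset.sum_range_succ, add_assoc]

/-- The path is frozen, so only directions are random and they are independent: the variance
averages down like 1/n, while the mean error is the chain sum of `noiseDir` over the 2n states used.
-/
theorem IsProblem.integral_gRD_sub_sq_le (hd : 0 < d)
    (h : IsProblem L μ σ Δ τ Q π F δ f xs) (hσ : 0 ≤ σ) (ht : 0 < t) (hL : 0 ≤ L) (hμ : 0 ≤ μ)
    {n : ℕ} (hn : 0 < n) (x : Vec d) (z : ℕ → Z) :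
    Integrable (fun v : ℕ → sphere (0 : Vec d) 1 => ‖gRD (fun x z => F x z + δ x) t n x z
      (fun i => (v i : Vec d)) - meanGrad f δ t x‖ ^ 2)
        (Measure.infinitePi fun _ : ℕ => sphereLaw d) ∧
    ∫ v : ℕ → sphere (0 : Vec d) 1, ‖gRD (fun x z => F x z + δ x) t n x z (fun i => (v i : Vec d)) -
        meanGrad f δ t x‖ ^ 2 ∂(Measure.infinitePi fun _ : ℕ => sphereLaw d) ≤
      (1 / n) * (24 * (d * ‖smoothGrad f t x‖ ^ 2) + 24 * (d ^ 2 * L ^ 2 * t ^ 2)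
        + 8 * (d ^ 2 * σ ^ 2 / t ^ 2) + 12 * (d * Δ / t) ^ 2) +
      (1 / n) ^ 2 * (1 / (4 * t ^ 2)) * ‖∑ s ∈ Finset.range (2 * n), noiseDir F f t x (z s)‖ ^ 2 := by
  have hP := isProbabilityMeasure_sphereLaw hd
  have hn' : (0 : ℝ) < n := by exact_mod_cast hn
  have hΔ : 0 ≤ Δ := (abs_nonneg _).trans (h.perturbation_bounded 0)
  set m := meanGrad f δ t x with hm
  let Y : ℕ → sphere (0 : Vec d) 1 → Vec d := fun i e =>
    gHat (fun x z => F x z + δ x) t x (e : Vec d) (z (2 * i)) (z (2 * i + 1)) - m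
  have hY (i : ℕ) : Measurable (Y i) :=
    ((h.measurable_gHat x _ _).comp measurable_subtype_coe).sub_const m
  have hK (i : ℕ) (e : sphere (0 : Vec d) 1) :
      ‖Y i e‖ ≤ d * (‖gradient f x‖ + L * t + σ / t + Δ / t) + ‖m‖ := by
    refine (norm_sub_le _ _).trans ?_
    gcongr
    refine (h.norm_gHat_le hσ ht hL hμ x e (by simp) _ _).trans ?_
    gcongr
    simpa using abs_real_inner_le_norm (e : Vec d) (gradient f x)
  have hEY (i : ℕ) : ∫ e, Y i e ∂sphereLaw d =
      (1 / (2 * t)) • (noiseDir F f t x (z (2 * i)) + noiseDir F f t x (z (2 * i + 1))) := by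
    have hi : Integrable (fun e : sphere (0 : Vec d) 1 => gHat (fun x z => F x z + δ x) t x (e : Vec d)
        (z (2 * i)) (z (2 * i + 1))) (sphereLaw d) := by
      refine Integrable.of_bound (C := d * (‖gradient f x‖ + L * t + σ / t + Δ / t))
        ((h.measurable_gHat x _ _).comp measurable_subtype_coe).aestronglyMeasurable
        (Eventually.of_forall fun e => ?_)
      refine (h.norm_gHat_le hσ ht hL hμ x e (by simp) _ _).trans ?_
      gcongr
      simpa using abs_real_inner_le_norm (e : Vec d) (gradient f x)
    rw [integral_sub hi (integrable_const _), h.integral_gHat hd hσ ht]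
    simp [hm]
  have heq (v : ℕ → sphere (0 : Vec d) 1) :
      ‖gRD (fun x z => F x z + δ x) t n x z (fun i => (v i : Vec d)) - m‖ ^ 2 =
      (1 / n) ^ 2 * ‖∑ i ∈ Finset.range n, Y i (v i)‖ ^ 2 := by
    have : gRD (fun x z => F x z + δ x) t n x z (fun i => (v i : Vec d)) - m =
        (1 / n : ℝ) • ∑ i ∈ Finset.range n, Y i (v i) := by
      simp only [Y, Finset.sum_sub_distrib, Finset.sum_const, Finset.card_range, smul_sub, gRD,
        one_div]
      rw [← Nat.cast_smul_eq_nsmul ℝ, inv_smul_smul₀ hn'.ne']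
    rw [this, norm_smul, mul_pow, Real.norm_of_nonneg (by positivity)]
  have hmeas : Measurable fun v : ℕ → sphere (0 : Vec d) 1 => ∑ i ∈ Finset.range n, Y i (v i) :=
    Finset.measurable_sum _ fun i _ => (hY i).comp (measurable_pi_apply i)
  simp only [heq]
  constructor
  · refine Integrable.const_mul ?_ _
    refine Integrable.of_bound (C := (n * (d * (‖gradient f x‖ + L * t + σ / t + Δ / t) + ‖m‖)) ^ 2)
      (hmeas.norm.pow_const 2).aestronglyMeasurable (Eventually.of_forall fun v => ?_)
    rw [norm_pow, norm_norm]
    gcongr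
    refine (norm_sum_le _ _).trans ?_
    refine (Finset.sum_le_sum fun i _ => hK i (v i)).trans ?_
    rw [Finset.sum_const, Finset.card_range, nsmul_eq_mul]
  · rw [integral_const_mul]
    refine (mul_le_mul_of_nonneg_left (integral_norm_sum_sq_infinitePi_le (sphereLaw d) hY hK n)
      (by positivity)).trans ?_
    rw [mul_add]
    refine add_le_add ?_ ?_
    · calc (1 / n : ℝ) ^ 2 * ∑ i ∈ Finset.range n, ∫ e, ‖Y i e‖ ^ 2 ∂sphereLaw d
          ≤ (1 / n : ℝ) ^ 2 * ∑ i ∈ Finset.range n, (24 * (d * ‖smoothGrad f t x‖ ^ 2) +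
            24 * (d ^ 2 * L ^ 2 * t ^ 2) + 8 * (d ^ 2 * σ ^ 2 / t ^ 2) + 12 * (d * Δ / t) ^ 2) := by
            gcongr with i _
            exact h.integral_gHat_sub_sq_le hd hσ ht hL hμ x _ _
        _ = _ := by
            rw [Finset.sum_const, Finset.card_range, nsmul_eq_mul]
            field_simp
    · simp only [hEY]
      rw [← Finset.smul_sum, sum_range_two_mul_eq (fun s => noiseDir F f t x (z s)), norm_smul,
        mul_pow, Real.norm_of_nonneg (by positivity), ← mul_assoc]
      apply le_of_eq
      ring

/-- Mean square error of the random-direction estimator at a point determined by the past of the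
chain. -/
theorem IsProblem.lintegral_gRD_sub_sq_le [IsMarkovKernel Q] [IsProbabilityMeasure π]
    {ξ : Measure Z} [IsProbabilityMeasure ξ] (hd : 0 < d) (hτ : 0 < τ)
    (h : IsProblem L μ σ Δ τ Q π F δ f xs) (hσ : 0 ≤ σ) (ht : 0 < t) (hL : 0 ≤ L) (hμ : 0 ≤ μ)
    {n : ℕ} (hn : 0 < n) {x : (ℕ → Z) → Vec d} (hx : Measurable x) (c : ℕ)
    (hdep : ∀ z z' : ℕ → Z, (∀ i < c, z i = z' i) → x z = x z') :
    ∫⁻ z, ∫⁻ v : ℕ → sphere (0 : Vec d) 1, ENNReal.ofReal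
        (‖gRD (fun x z => F x z + δ x) t n (x z) (fun i => z (c + i)) (fun i => (v i : Vec d)) -
          meanGrad f δ t (x z)‖ ^ 2) ∂(Measure.infinitePi fun _ : ℕ => sphereLaw d) ∂chainLaw ξ Q ≤
      ∫⁻ z, ENNReal.ofReal (24 / n * (d * ‖smoothGrad f t (x z)‖ ^ 2 + baseVariance d τ L σ Δ t))
        ∂chainLaw ξ Q := by
  have hP := isProbabilityMeasure_sphereLaw hd
  have hn' : (0 : ℝ) < n := by exact_mod_cast hn
  set A : Vec d → ℝ := fun y => 24 * (d * ‖smoothGrad f t y‖ ^ 2) + 24 * (d ^ 2 * L ^ 2 * t ^ 2)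
        + 8 * (d ^ 2 * σ ^ 2 / t ^ 2) + 12 * (d * Δ / t) ^ 2 with hA
  have hA0 (y : Vec d) : 0 ≤ A y := by simp only [hA]; positivity
  have h1 (z : ℕ → Z) : ∫⁻ v : ℕ → sphere (0 : Vec d) 1, ENNReal.ofReal
        (‖gRD (fun x z => F x z + δ x) t n (x z) (fun i => z (c + i)) (fun i => (v i : Vec d)) -
          meanGrad f δ t (x z)‖ ^ 2) ∂(Measure.infinitePi fun _ : ℕ => sphereLaw d) ≤
      ENNReal.ofReal ((1 / n) * A (x z)) + ENNReal.ofReal ((1 / n) ^ 2 * (1 / (4 * t ^ 2)) *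
        ‖∑ s ∈ Finset.range (2 * n), noiseDir F f t (x z) (z (c + s))‖ ^ 2) := by
    obtain ⟨hi, hle⟩ := h.integral_gRD_sub_sq_le hd hσ ht hL hμ hn (x z) (fun i => z (c + i))
    have hA0' := hA0 (x z)
    rw [← ofReal_integral_eq_lintegral_ofReal hi (Eventually.of_forall fun v => by positivity),
      ← ENNReal.ofReal_add (by positivity) (by positivity)]
    exact ENNReal.ofReal_le_ofReal hle
  have hN := h.measurable_noiseDir (t := t) hd
  have hmeas : Measurable fun z : ℕ → Z =>
      ‖∑ s ∈ Finset.range (2 * n), noiseDir F f t (x z) (z (c + s))‖ ^ 2 :=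
    (Finset.measurable_sum _ fun s _ =>
      hN.comp (hx.prodMk (measurable_pi_apply (c + s)))).norm.pow_const 2
  -- 2n states, each costing (16/3)τdσ², times 1/(4t²n²).
  have h2 : ∫⁻ z, ENNReal.ofReal ((1 / n) ^ 2 * (1 / (4 * t ^ 2)) *
        ‖∑ s ∈ Finset.range (2 * n), noiseDir F f t (x z) (z (c + s))‖ ^ 2) ∂chainLaw ξ Q ≤
      ENNReal.ofReal ((1 / n) * (8 / 3 * (d * τ * σ ^ 2 / t ^ 2))) := by
    have hbd (z : ℕ → Z) : ‖∑ s ∈ Finset.range (2 * n), noiseDir F f t (x z) (z (c + s))‖ ^ 2 ≤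
        ((2 * n : ℕ) * (Real.sqrt d * σ)) ^ 2 := by
      gcongr
      refine (norm_sum_le _ _).trans ((Finset.sum_le_sum fun s _ =>
        h.norm_noiseDir_le hd hσ (x z) (z (c + s))).trans (by simp))
    have hi : Integrable (fun z : ℕ → Z =>
        ‖∑ s ∈ Finset.range (2 * n), noiseDir F f t (x z) (z (c + s))‖ ^ 2) (chainLaw ξ Q) :=
      Integrable.of_bound hmeas.aestronglyMeasurable _ (Eventually.of_forall fun z => by
        rw [Real.norm_of_nonneg (by positivity)]
        exact hbd z)
    rw [← ofReal_integral_eq_lintegral_ofReal (hi.const_mul _)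
      (Eventually.of_forall fun v => by positivity), integral_const_mul]
    refine ENNReal.ofReal_le_ofReal ?_
    have := h.ergodic.integral_norm_sum_sq_le (ξ := ξ) hτ hN (by positivity)
      (h.norm_noiseDir_le hd hσ) (h.integral_noiseDir hd hσ) hx c hdep (2 * n)
    refine (mul_le_mul_of_nonneg_left this (by positivity)).trans (le_of_eq ?_)
    rw [mul_pow, Real.sq_sqrt (by positivity)]
    push_cast
    field_simp
    ring
  calc _ ≤ ∫⁻ z, (ENNReal.ofReal ((1 / n) * A (x z)) + ENNReal.ofReal
        ((1 / n) ^ 2 * (1 / (4 * t ^ 2)) *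
        ‖∑ s ∈ Finset.range (2 * n), noiseDir F f t (x z) (z (c + s))‖ ^ 2)) ∂chainLaw ξ Q :=
        lintegral_mono h1
    _ = ∫⁻ z, ENNReal.ofReal ((1 / n) * A (x z)) ∂chainLaw ξ Q + ∫⁻ z, ENNReal.ofReal
        ((1 / n) ^ 2 * (1 / (4 * t ^ 2)) *
        ‖∑ s ∈ Finset.range (2 * n), noiseDir F f t (x z) (z (c + s))‖ ^ 2) ∂chainLaw ξ Q :=
        lintegral_add_right _ (hmeas.const_mul _).ennreal_ofReal
    _ ≤ ∫⁻ z, ENNReal.ofReal ((1 / n) * A (x z)) ∂chainLaw ξ Q +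
        ∫⁻ _, ENNReal.ofReal ((1 / n) * (8 / 3 * (d * τ * σ ^ 2 / t ^ 2))) ∂chainLaw ξ Q := by
        refine add_le_add le_rfl (h2.trans (le_of_eq ?_))
        rw [lintegral_const, measure_univ, mul_one]
    _ = ∫⁻ z, (ENNReal.ofReal ((1 / n) * A (x z)) +
        ENNReal.ofReal ((1 / n) * (8 / 3 * (d * τ * σ ^ 2 / t ^ 2)))) ∂chainLaw ξ Q := by
        rw [lintegral_add_right _ measurable_const]
    _ ≤ _ := by
        refine lintegral_mono fun z => ?_
        have hA0' := hA0 (x z)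
        rw [← ENNReal.ofReal_add (by positivity) (by positivity)]
        refine ENNReal.ofReal_le_ofReal ?_
        rw [← mul_add, show 24 / (n : ℝ) = 1 / n * 24 by ring, mul_assoc (1 / (n : ℝ)) 24]
        refine mul_le_mul_of_nonneg_left ?_ (one_div_nonneg.2 hn'.le)
        simp only [hA, baseVariance]
        have e1 : (d : ℝ) * (d + τ) * σ ^ 2 / t ^ 2 = d ^ 2 * σ ^ 2 / t ^ 2 + d * τ * σ ^ 2 / t ^ 2 := by
          ring
        have e2 : (0 : ℝ) ≤ d ^ 2 * σ ^ 2 / t ^ 2 := by positivity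
        have e3 : (0 : ℝ) ≤ d * τ * σ ^ 2 / t ^ 2 := by positivity
        have e4 := sq_nonneg (d * Δ / t)
        rw [e1]
        linarith
end Variance

/-! ### The deterministic accelerated step -/

theorem sum_weighted_norm_sub_smul_sq {ι : Type*} (s : Finset ι) {w : ι → ℝ}
    (hw1 : ∑ i ∈ s, w i = 1) (g : ι → Vec d) (v : Vec d) (a : ℝ) :
    ∑ i ∈ s, w i * ‖v - a • g i‖ ^ 2 =
      ‖v‖ ^ 2 - 2 * a * inner ℝ (∑ i ∈ s, w i • g i) v + a ^ 2 * ∑ i ∈ s, w i * ‖g i‖ ^ 2 := by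
  have h (i : ι) : w i * ‖v - a • g i‖ ^ 2 =
      w i * ‖v‖ ^ 2 - 2 * a * inner ℝ (w i • g i) v + a ^ 2 * (w i * ‖g i‖ ^ 2) := by
    rw [norm_sub_sq_real, inner_smul_right, inner_smul_left, norm_smul, mul_pow, Real.norm_eq_abs,
      sq_abs, real_inner_comm, RCLike.conj_to_real]
    ring
  simp only [h]
  rw [Finset.sum_add_distrib, Finset.sum_sub_distrib, ← Finset.sum_mul, hw1, one_mul,
    ← Finset.mul_sum, ← Finset.mul_sum, sum_inner]

/-- One step of the accelerated method with inexact gradients `g i` used with probability `w i`. -/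
theorem accelerated_step {ι : Type*} (s : Finset ι) {w : ι → ℝ} (hw : ∀ i ∈ s, 0 ≤ w i)
    (hw1 : ∑ i ∈ s, w i = 1) (g : ι → Vec d) {L μ γ p β : ℝ} (hμ : 0 < μ)
    (hγ : 0 < γ) (hp : 0 < p) (hβ : 0 < β) (hβ1 : β ≤ 1) (hLγ : L * γ ≤ 3 / 4)
    (hβγ : p ^ 2 * γ = 3 * β ^ 2 / (4 * μ)) {x y z xs G : Vec d} {h : Vec d → ℝ}
    (hrel : (1 - β) • (x - z) = (2 / β - 1) • (z - y))
    (hy : h z + inner ℝ G (y - z) ≤ h y)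
    (hxs : h z + inner ℝ G (xs - z) + μ / 2 * ‖xs - z‖ ^ 2 ≤ h xs)
    (hup : ∀ u, h u ≤ h z + inner ℝ G (u - z) + L / 2 * ‖u - z‖ ^ 2) :
    ∑ i ∈ s, w i * (‖(1 - β) • x + β • z - (3 * β / (2 * μ)) • g i - xs‖ ^ 2 +
        6 / μ * (h (z - (p * γ) • g i) - h xs)) ≤
      (1 - β / 2) * (‖x - xs‖ ^ 2 + 6 / μ * (h y - h xs)) +
        β / μ ^ 2 * (8 * β * (‖G‖ ^ 2 + ∑ i ∈ s, w i * ‖g i - G‖ ^ 2) +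
          (9 + 9 * β / (4 * p)) * ‖∑ i ∈ s, w i • g i - G‖ ^ 2 - 9 * β / (4 * p) * ‖G‖ ^ 2) := by
  set gh := ∑ i ∈ s, w i • g i with hgh
  set v := (1 - β) • x + β • z - xs with hv
  set Γ := ∑ i ∈ s, w i * ‖g i‖ ^ 2 with hΓ
  set a := 3 * β / (2 * μ) with ha
  have ha0 : 0 < a := by positivity
  have hΓ0 : 0 ≤ Γ := Finset.sum_nonneg fun i hi => mul_nonneg (hw i hi) (sq_nonneg _)
  -- the quadratic part
  have e1 : ∑ i ∈ s, w i * ‖(1 - β) • x + β • z - a • g i - xs‖ ^ 2 =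
      ‖v‖ ^ 2 - 2 * a * inner ℝ gh v + a ^ 2 * Γ := by
    rw [← sum_weighted_norm_sub_smul_sq s hw1]
    refine Finset.sum_congr rfl fun i _ => ?_
    rw [hv, sub_right_comm]
  have e2 : ‖v‖ ^ 2 ≤ (1 - β) * ‖x - xs‖ ^ 2 + β * ‖z - xs‖ ^ 2 := by
    have hv' : v = (1 - β) • (x - xs) + β • (z - xs) := by rw [hv]; module
    have key : (1 - β) * ‖x - xs‖ ^ 2 + β * ‖z - xs‖ ^ 2 - ‖v‖ ^ 2 =
        β * (1 - β) * ‖(x - xs) - (z - xs)‖ ^ 2 := by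
      rw [hv', norm_add_sq_real, norm_sub_sq_real (x - xs) (z - xs), norm_smul, norm_smul, inner_smul_left,
        inner_smul_right, mul_pow, mul_pow, Real.norm_eq_abs, Real.norm_eq_abs, sq_abs, sq_abs]
      simp only [RCLike.conj_to_real]
      ring
    have : 0 ≤ β * (1 - β) * ‖(x - xs) - (z - xs)‖ ^ 2 :=
      mul_nonneg (mul_nonneg hβ.le (by linarith)) (sq_nonneg _)
    linarith
  -- Young with weight β/4 on ‖v‖²: the contraction can afford it, since (1 + β/4)(1 − β) ≤ 1 − β/2.
  have e3 : -(2 * a * inner ℝ (gh - G) v) ≤ β / 4 * ‖v‖ ^ 2 + 9 * β / μ ^ 2 * ‖gh - G‖ ^ 2 := by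
    have h1 := abs_real_inner_le_norm (gh - G) v
    have h2 := neg_abs_le (inner ℝ (gh - G) v : ℝ)
    have h3 : -(2 * a * inner ℝ (gh - G) v) ≤ 2 * a * (‖gh - G‖ * ‖v‖) := by
      have := mul_le_mul_of_nonneg_left (show -(inner ℝ (gh - G) v : ℝ) ≤ ‖gh - G‖ * ‖v‖ by linarith)
        (by positivity : 0 ≤ 2 * a)
      linarith
    refine h3.trans ?_
    have h4 : β / 4 * ‖v‖ ^ 2 + 9 * β / μ ^ 2 * ‖gh - G‖ ^ 2 - 2 * a * (‖gh - G‖ * ‖v‖) =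
        β / 4 * (‖v‖ - 6 / μ * ‖gh - G‖) ^ 2 := by
      rw [ha]
      field_simp
      ring
    have : 0 ≤ β / 4 * (‖v‖ - 6 / μ * ‖gh - G‖) ^ 2 := by positivity
    linarith
  -- The coupling relation `hrel` writes v through z − xs and z − y, the two directions in which the
  -- lower bounds on h can be used.
  have e4 : inner ℝ gh v = inner ℝ (gh - G) v + inner ℝ G (z - xs) +
      (2 / β - 1) * inner ℝ G (z - y) := by
    have hv2 : v = (z - xs) + (2 / β - 1) • (z - y) := by rw [← hrel, hv]; module
    have : inner ℝ G v = inner ℝ G (z - xs) + (2 / β - 1) * inner ℝ G (z - y) := by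
      rw [hv2, inner_add_right, inner_smul_right]
    rw [inner_sub_left, this]
    ring
  have i1 : h z - h xs + μ / 2 * ‖z - xs‖ ^ 2 ≤ inner ℝ G (z - xs) := by
    have : (inner ℝ G (xs - z) : ℝ) = -inner ℝ G (z - xs) := by rw [← inner_neg_right, neg_sub]
    rw [norm_sub_rev]
    linarith
  have i2 : h z - h y ≤ inner ℝ G (z - y) := by
    have : (inner ℝ G (y - z) : ℝ) = -inner ℝ G (z - y) := by rw [← inner_neg_right, neg_sub]
    linarith
  -- the function part
  have f1 : ∑ i ∈ s, w i * (h (z - (p * γ) • g i) - h xs) ≤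
      h z - h xs - p * γ * inner ℝ G gh + L / 2 * (p * γ) ^ 2 * Γ := by
    have hi : ∀ i ∈ s, w i * (h (z - (p * γ) • g i) - h xs) ≤
        w i * (h z - h xs) - p * γ * inner ℝ G (w i • g i) +
          L / 2 * (p * γ) ^ 2 * (w i * ‖g i‖ ^ 2) := by
      intro i hi
      have h1 := hup (z - (p * γ) • g i)
      rw [sub_sub_cancel_left, inner_neg_right, inner_smul_right, norm_neg, norm_smul, mul_pow,
        Real.norm_eq_abs, sq_abs] at h1
      have h2 := mul_le_mul_of_nonneg_left h1 (hw i hi)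
      rw [inner_smul_right]
      linarith
    refine (Finset.sum_le_sum hi).trans (le_of_eq ?_)
    rw [Finset.sum_add_distrib, Finset.sum_sub_distrib, ← Finset.sum_mul, hw1, one_mul,
      ← Finset.mul_sum, ← Finset.mul_sum, hgh, inner_sum]
  -- Source of the negative gradient term: through `c6` it receives the coefficient 9β/(4p), whose
  -- 1/p later pays for the variance.
  have f2 : ‖G‖ ^ 2 - ‖gh - G‖ ^ 2 ≤ 2 * inner ℝ G gh := by
    rw [norm_sub_sq_real, real_inner_comm]
    linarith [sq_nonneg ‖gh‖]
  have f3 : Γ ≤ 2 * ‖G‖ ^ 2 + 2 * ∑ i ∈ s, w i * ‖g i - G‖ ^ 2 := by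
    have hi : ∀ i ∈ s, w i * ‖g i‖ ^ 2 ≤ w i * (2 * ‖G‖ ^ 2) + 2 * (w i * ‖g i - G‖ ^ 2) := by
      intro i hi
      have := norm_add_sq_le (g i - G) G
      rw [sub_add_cancel] at this
      have := mul_le_mul_of_nonneg_left this (hw i hi)
      linarith
    refine (Finset.sum_le_sum hi).trans (le_of_eq ?_)
    rw [Finset.sum_add_distrib, ← Finset.sum_mul, hw1, one_mul, ← Finset.mul_sum]
  -- combining
  have hsplit : ∑ i ∈ s, w i * (‖(1 - β) • x + β • z - a • g i - xs‖ ^ 2 +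
        6 / μ * (h (z - (p * γ) • g i) - h xs)) =
      ∑ i ∈ s, w i * ‖(1 - β) • x + β • z - a • g i - xs‖ ^ 2 +
        6 / μ * ∑ i ∈ s, w i * (h (z - (p * γ) • g i) - h xs) := by
    rw [Finset.mul_sum, ← Finset.sum_add_distrib]
    refine Finset.sum_congr rfl fun i _ => ?_
    ring
  rw [hsplit, e1, e4]
  set X := ‖x - xs‖ ^ 2
  set W := ‖z - xs‖ ^ 2
  set V := ∑ i ∈ s, w i * ‖g i - G‖ ^ 2
  have hX : 0 ≤ X := sq_nonneg _
  have hW : 0 ≤ W := sq_nonneg _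
  have c1 : (1 + β / 4) * ‖v‖ ^ 2 ≤ (1 + β / 4) * ((1 - β) * X + β * W) :=
    mul_le_mul_of_nonneg_left e2 (by positivity)
  -- The coefficient 3β/2 of W is exactly what the strong convexity term in `i1` returns after
  -- multiplication by 2a.
  have c2 : (1 + β / 4) * ((1 - β) * X + β * W) ≤ (1 - β / 2) * X + 3 * β / 2 * W := by
    nlinarith [mul_nonneg hβ.le hX, mul_nonneg hβ.le hW, mul_nonneg (mul_nonneg hβ.le hβ.le) hX,
      mul_le_mul_of_nonneg_right hβ1 (mul_nonneg hβ.le hW)]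
  have c3 := mul_le_mul_of_nonneg_left i1 (by positivity : 0 ≤ 2 * a)
  have hβ2 : 0 ≤ 2 / β - 1 := by
    rw [sub_nonneg, le_div_iff₀ hβ]; linarith
  have c4 := mul_le_mul_of_nonneg_left i2 (mul_nonneg (by positivity : 0 ≤ 2 * a) hβ2)
  have c5 := mul_le_mul_of_nonneg_left f1 (by positivity : 0 ≤ 6 / μ)
  have hpγ : p * γ = 3 * β ^ 2 / (4 * μ) / p := by rw [← hβγ]; field_simp
  have c6 : 6 / μ * (p * γ) = 2 * (β / μ ^ 2 * (9 * β / (4 * p))) := by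
    rw [hpγ]; field_simp; ring
  -- The only use of Lγ ≤ 3/4. Together with a² this yields 27/16 + 9/4 < 4 in `c9`.
  have c7 : 6 / μ * (L / 2 * (p * γ) ^ 2) ≤ β / μ ^ 2 * (27 * β / 16) := by
    have : 6 / μ * (L / 2 * (p * γ) ^ 2) = L * γ * (β / μ ^ 2 * (9 * β / 4)) := by
      rw [show (p * γ) ^ 2 = γ * (p ^ 2 * γ) by ring, hβγ]; field_simp; ring
    rw [this]
    calc L * γ * (β / μ ^ 2 * (9 * β / 4)) ≤ 3 / 4 * (β / μ ^ 2 * (9 * β / 4)) := by gcongr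
      _ = _ := by ring
  have c8 : a ^ 2 = β / μ ^ 2 * (9 * β / 4) := by rw [ha]; field_simp; ring
  have c9 : 6 / μ * (L / 2 * (p * γ) ^ 2) * Γ + a ^ 2 * Γ ≤ β / μ ^ 2 * (4 * β) * Γ := by
    have := mul_le_mul_of_nonneg_right c7 hΓ0
    rw [c8]
    have h1 : 0 ≤ β / μ ^ 2 * β * Γ := by positivity
    have h2 : β / μ ^ 2 * (27 * β / 16) * Γ + β / μ ^ 2 * (9 * β / 4) * Γ =
      β / μ ^ 2 * (4 * β) * Γ - β / μ ^ 2 * β * Γ / 16 := by ring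
    linarith
  have c10 := mul_le_mul_of_nonneg_left f3 (by positivity : 0 ≤ β / μ ^ 2 * (4 * β))
  have c11 := mul_le_mul_of_nonneg_left f2 (by positivity : 0 ≤ β / μ ^ 2 * (9 * β / (4 * p)))
  have c12 : 6 / μ * (p * γ) * inner ℝ G gh = β / μ ^ 2 * (9 * β / (4 * p)) * (2 * inner ℝ G gh) := by
    rw [c6]; ring
  -- In the next identities h z appears with weights β/2 and 1 − β/2; they sum to one and cancel the
  -- h z of the function part, leaving (1 − β/2)(h y − h xs).
  have c13 : 2 * a * (h z - h xs + μ / 2 * W) = 3 * β / μ * (h z - h xs) + 3 * β / 2 * W := by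
    rw [ha]; field_simp
  have c14 : 2 * a * (2 / β - 1) * (h z - h y) = 6 / μ * (1 - β / 2) * (h z - h y) := by
    rw [ha]; field_simp; ring
  have c15 : 3 * β / μ * (h z - h xs) = 6 / μ * (β / 2) * (h z - h xs) := by ring
  rw [c13, c15] at c3
  rw [c14] at c4
  have c16 : 9 * β / μ ^ 2 * ‖gh - G‖ ^ 2 = β / μ ^ 2 * (9 * ‖gh - G‖ ^ 2) := by ring
  rw [c16] at e3
  set T := β / μ ^ 2
  set K := 9 * β / (4 * p)
  set U := 6 / μ
  linarith

/-! ### The level law and the multilevel combination -/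

/-- Probability that the level is `n + 1`, all levels above `m` being merged into `m + 1`. -/
noncomputable def levelWeight (m n : ℕ) : ℝ := if n < m then (1 / 2) ^ (n + 1) else (1 / 2) ^ m

theorem levelWeight_nonneg (m n : ℕ) : 0 ≤ levelWeight m n := by
  unfold levelWeight; split_ifs <;> positivity

theorem sum_levelWeight (m : ℕ) : ∑ n ∈ Finset.range (m + 1), levelWeight m n = 1 := by
  rw [Finset.sum_range_succ]
  have h1 : ∑ n ∈ Finset.range m, levelWeight m n = ∑ n ∈ Finset.range m, (1 / 2 : ℝ) ^ (n + 1) :=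
    Finset.sum_congr rfl fun n hn => by simp [levelWeight, Finset.mem_range.1 hn]
  have h2 : ∑ n ∈ Finset.range m, (1 / 2 : ℝ) ^ (n + 1) = 1 - (1 / 2) ^ m := by
    clear h1
    induction m with
    | zero => simp
    | succ m ih =>
      rw [Finset.sum_range_succ, ih]
      ring
  rw [h1, h2, levelWeight, if_neg (lt_irrefl m)]
  ring

theorem isProbabilityMeasure_levelLaw : IsProbabilityMeasure levelLaw := by
  constructor
  rw [levelLaw, Measure.sum_apply _ MeasurableSet.univ]
  simp only [Measure.smul_apply, measure_univ, smul_eq_mul, mul_one]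
  rw [← ENNReal.ofReal_tsum_of_nonneg (fun n => by positivity)]
  · have : ∑' n : ℕ, (1 / 2 : ℝ) ^ (n + 1) = 1 := by
      simp_rw [pow_succ]
      rw [tsum_mul_right, tsum_geometric_two]
      norm_num
    rw [this, ENNReal.ofReal_one]
  · exact (summable_nat_add_iff 1).2 (summable_geometric_of_lt_one (by norm_num) (by norm_num))

/-- The levels from m + 1 on have total mass 2^(-m) and are indistinguishable to φ, so expectation
over the level becomes a finite sum. -/
theorem lintegral_levelLaw (φ : ℕ → ENNReal) {m : ℕ} (hφ : ∀ n, m ≤ n → φ (n + 1) = φ (m + 1)) :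
    ∫⁻ j, φ j ∂levelLaw =
      ∑ n ∈ Finset.range (m + 1), ENNReal.ofReal (levelWeight m n) * φ (n + 1) := by
  have h0 : ∫⁻ j, φ j ∂levelLaw = ∑' n : ℕ, ENNReal.ofReal ((1 / 2 : ℝ) ^ (n + 1)) * φ (n + 1) := by
    rw [levelLaw, lintegral_sum_measure]
    congr with n
    rw [lintegral_smul_measure, lintegral_dirac, smul_eq_mul]
  have hprob : ∑' n : ℕ, ENNReal.ofReal ((1 / 2 : ℝ) ^ (n + 1)) = 1 := by
    have := isProbabilityMeasure_levelLaw.measure_univ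
    rw [levelLaw, Measure.sum_apply _ MeasurableSet.univ] at this
    simpa using this
  have htail : ∑' n : ℕ, ENNReal.ofReal ((1 / 2 : ℝ) ^ (n + m + 1)) = ENNReal.ofReal ((1 / 2) ^ m) := by
    have (n : ℕ) : ENNReal.ofReal ((1 / 2 : ℝ) ^ (n + m + 1)) =
        ENNReal.ofReal ((1 / 2) ^ m) * ENNReal.ofReal ((1 / 2 : ℝ) ^ (n + 1)) := by
      rw [← ENNReal.ofReal_mul (by positivity)]
      congr 1
      ring
    simp_rw [this]
    rw [ENNReal.tsum_mul_left, hprob, mul_one]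
  rw [h0, ← Summable.sum_add_tsum_nat_add' (k := m) ENNReal.summable, Finset.sum_range_succ]
  congr 1
  · exact Finset.sum_congr rfl fun n hn => by simp [levelWeight, Finset.mem_range.1 hn]
  · have h3 (n : ℕ) : ENNReal.ofReal ((1 / 2 : ℝ) ^ (n + m + 1)) * φ (n + m + 1) =
        ENNReal.ofReal ((1 / 2 : ℝ) ^ (n + m + 1)) * φ (m + 1) := by
      rw [hφ (n + m) (Nat.le_add_left m n)]
    rw [tsum_congr h3, ENNReal.tsum_mul_right, htail, levelWeight, if_neg (lt_irrefl m)]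

/-- Multilevel correction built from a sequence of estimates. -/
noncomputable def mlCombine (m : ℕ) (R : ℕ → Vec d) (n : ℕ) : Vec d :=
  R 0 + if n < m then (2 : ℝ) ^ (n + 1) • (R (n + 1) - R n) else 0

/-- Each weight 2^(-(n+1)) cancels its factor 2^(n+1) and the differences telescope: the level
average is as accurate as the largest batch. -/
theorem sum_levelWeight_smul_mlCombine (m : ℕ) (R : ℕ → Vec d) :
    ∑ n ∈ Finset.range (m + 1), levelWeight m n • mlCombine m R n = R m := by
  have h1 : ∑ n ∈ Finset.range (m + 1), levelWeight m n • mlCombine m R n =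
      ∑ n ∈ Finset.range (m + 1), levelWeight m n • R 0 +
      ∑ n ∈ Finset.range (m + 1), (if n < m then R (n + 1) - R n else 0) := by
    rw [← Finset.sum_add_distrib]
    refine Finset.sum_congr rfl fun n _ => ?_
    rw [mlCombine, smul_add]
    congr 1
    split_ifs with hn
    · rw [levelWeight, if_pos hn, smul_smul, ← mul_pow]
      norm_num
    · simp
  have h2 : ∑ n ∈ Finset.range m, (if n < m then R (n + 1) - R n else 0) =
      ∑ n ∈ Finset.range m, (R (n + 1) - R n) :=
    Finset.sum_congr rfl fun n hn => if_pos (Finset.mem_range.1 hn)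
  rw [h1, ← Finset.sum_smul, sum_levelWeight, one_smul, Finset.sum_range_succ, h2,
    Finset.sum_range_sub]
  simp

/-- One of the two factors 2^(n+1) in the squared correction survives the weight. It is balanced
later by errors of order 2^(-n). -/
theorem sum_levelWeight_mlCombine_sub_sq_le (m : ℕ) (R : ℕ → Vec d) (q : Vec d) :
    ∑ n ∈ Finset.range (m + 1), levelWeight m n * ‖mlCombine m R n - q‖ ^ 2 ≤
      2 * ‖R 0 - q‖ ^ 2 + ∑ n ∈ Finset.range m,
        4 * 2 ^ (n + 1) * (‖R (n + 1) - q‖ ^ 2 + ‖R n - q‖ ^ 2) := by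
  have h1 : ∀ n ∈ Finset.range (m + 1), levelWeight m n * ‖mlCombine m R n - q‖ ^ 2 ≤
      levelWeight m n * (2 * ‖R 0 - q‖ ^ 2) +
      (if n < m then 4 * 2 ^ (n + 1) * (‖R (n + 1) - q‖ ^ 2 + ‖R n - q‖ ^ 2) else 0) := by
    intro n _
    have hw := levelWeight_nonneg m n
    by_cases hn : n < m
    · rw [if_pos hn]
      have e1 : mlCombine m R n - q = (R 0 - q) + (2 : ℝ) ^ (n + 1) • ((R (n + 1) - q) - (R n - q)) := by
        rw [mlCombine, if_pos hn, sub_sub_sub_cancel_right]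
        abel
      have e2 := norm_add_sq_le (R 0 - q) ((2 : ℝ) ^ (n + 1) • ((R (n + 1) - q) - (R n - q)))
      have e3 := norm_sub_sq_le (R (n + 1) - q) (R n - q)
      rw [← e1, norm_smul, mul_pow, Real.norm_of_nonneg (by positivity)] at e2
      have e4 : ‖mlCombine m R n - q‖ ^ 2 ≤ 2 * ‖R 0 - q‖ ^ 2 +
          4 * (2 ^ (n + 1)) ^ 2 * (‖R (n + 1) - q‖ ^ 2 + ‖R n - q‖ ^ 2) := by
        have := mul_le_mul_of_nonneg_left e3 (by positivity : (0 : ℝ) ≤ 2 * (2 ^ (n + 1)) ^ 2)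
        linarith
      refine (mul_le_mul_of_nonneg_left e4 hw).trans (le_of_eq ?_)
      have e5 : levelWeight m n * (2 : ℝ) ^ (n + 1) = 1 := by
        rw [levelWeight, if_pos hn, ← mul_pow]
        norm_num
      rw [mul_add]
      congr 1
      calc levelWeight m n * (4 * (2 ^ (n + 1)) ^ 2 * (‖R (n + 1) - q‖ ^ 2 + ‖R n - q‖ ^ 2))
          = (levelWeight m n * 2 ^ (n + 1)) *
            (4 * 2 ^ (n + 1) * (‖R (n + 1) - q‖ ^ 2 + ‖R n - q‖ ^ 2)) := by ring
        _ = _ := by rw [e5, one_mul]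
    · rw [if_neg hn, add_zero, mlCombine, if_neg hn, add_zero]
      refine mul_le_mul_of_nonneg_left ?_ hw
      linarith [sq_nonneg ‖R 0 - q‖]
  refine (Finset.sum_le_sum h1).trans (le_of_eq ?_)
  rw [Finset.sum_add_distrib, ← Finset.sum_mul, sum_levelWeight, one_mul]
  congr 1
  rw [Finset.sum_range_succ, if_neg (lt_irrefl m), add_zero]
  exact Finset.sum_congr rfl fun n hn => if_pos (Finset.mem_range.1 hn)

theorem two_pow_le_iff_le_floor {M : ℝ} (hM : 1 ≤ M) (j : ℕ) :
    (2 : ℝ) ^ j ≤ M ↔ j ≤ ⌊Real.logb 2 M⌋₊ := by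
  have h0 : 0 ≤ Real.logb 2 M := Real.logb_nonneg (by norm_num) hM
  rw [Nat.le_floor_iff h0, Real.le_logb_iff_rpow_le (by norm_num) (by linarith), Real.rpow_natCast]

/-- Levels start at 1, so index n stands for level n + 1, and 2^(n+1) ≤ M reads n < ⌊log₂ M⌋. -/
theorem gML_succ_eq_mlCombine {Z : Type*} (O : Vec d → Z → ℝ) (t : ℝ) {M : ℝ} (hM : 1 ≤ M) (l n : ℕ)
    (x : Vec d) (z : ℕ → Z) (e : ℕ → Vec d) :
    gML O t M l (n + 1) x z e =
      mlCombine ⌊Real.logb 2 M⌋₊ (fun i => gRD O t (2 ^ i * l) x z e) n := by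
  simp only [gML, mlCombine, two_pow_le_iff_le_floor hM, Nat.succ_le_iff, pow_zero, one_mul,
    Nat.add_sub_cancel]

instance : IsProbabilityMeasure levelLaw := isProbabilityMeasure_levelLaw

/-! ### Resampling coordinates of i.i.d. families -/

section Resampling
variable {ι S : Type*} [MeasurableSpace S] (ν : Measure S) [IsProbabilityMeasure ν]

/-- Replacing some coordinates of an i.i.d. family by those of an independent copy. -/
theorem measurePreserving_ite_infinitePi (A : ι → Prop) [DecidablePred A] :
    MeasurePreserving (fun (q : (ι → S) × (ι → S)) i => if A i then q.2 i else q.1 i)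
      ((Measure.infinitePi fun _ : ι => ν).prod (Measure.infinitePi fun _ : ι => ν))
      (Measure.infinitePi fun _ : ι => ν) := by
  classical
  have hm : Measurable fun (q : (ι → S) × (ι → S)) i => if A i then q.2 i else q.1 i := by
    refine measurable_pi_lambda _ fun i => ?_
    split_ifs <;> fun_prop
  refine ⟨hm, Measure.eq_infinitePi _ fun s t ht => ?_⟩
  rw [Measure.map_apply hm (MeasurableSet.pi s.countable_toSet fun i _ => ht i)]
  have : (fun (q : (ι → S) × (ι → S)) i => if A i then q.2 i else q.1 i) ⁻¹' Set.pi s t =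
      (Set.pi (s.filter fun i => ¬ A i) t) ×ˢ (Set.pi (s.filter fun i => A i) t) := by
    ext q
    simp only [mem_preimage, Set.mem_pi, Finset.mem_coe, mem_prod, Finset.mem_filter]
    constructor
    · intro h
      refine ⟨fun i hi => ?_, fun i hi => ?_⟩
      · simpa [hi.2] using h i hi.1
      · simpa [hi.2] using h i hi.1
    · intro h i hi
      split_ifs with hA
      · exact h.2 i ⟨hi, hA⟩
      · exact h.1 i ⟨hi, hA⟩
  rw [this, Measure.prod_prod, Measure.infinitePi_pi _ fun i _ => ht i,
    Measure.infinitePi_pi _ fun i _ => ht i, mul_comm, Finset.prod_filter_mul_prod_filter_not]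

/-- Stands in for conditioning on all coordinates but k: a quantity that ignores coordinate k is
left unchanged by the update. -/
theorem lintegral_infinitePi_update [DecidableEq ι] (k : ι) {Ψ : (ι → S) → ENNReal}
    (hΨ : Measurable Ψ) :
    ∫⁻ a, Ψ a ∂(Measure.infinitePi fun _ : ι => ν) =
      ∫⁻ a, ∫⁻ b, Ψ (Function.update a k b) ∂ν ∂(Measure.infinitePi fun _ : ι => ν) := by
  have hmp := measurePreserving_ite_infinitePi ν (fun i : ι => i = k)
  rw [← hmp.lintegral_comp hΨ, lintegral_prod (fun q => Ψ _) (hΨ.comp hmp.measurable).aemeasurable]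
  refine lintegral_congr fun a => ?_
  have hu : Measurable fun b => Ψ (Function.update a k b) :=
    hΨ.comp (measurable_update a)
  rw [← (measurePreserving_eval_infinitePi (fun _ : ι => ν) k).lintegral_comp hu]
  refine lintegral_congr fun b => ?_
  congr 1
  ext i
  by_cases hi : i = k
  · subst hi; simp
  · simp [hi]

theorem lintegral_infinitePi_row {α β : Type*} [DecidableEq α] (k : α)
    {Ψ : (α × β → S) → ENNReal} (hΨ : Measurable Ψ) :
    ∫⁻ a, Ψ a ∂(Measure.infinitePi fun _ : α × β => ν) =
      ∫⁻ a, ∫⁻ v, Ψ (fun i => if i.1 = k then v i.2 else a i)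
        ∂(Measure.infinitePi fun _ : β => ν) ∂(Measure.infinitePi fun _ : α × β => ν) := by
  have hmp := measurePreserving_ite_infinitePi ν (fun i : α × β => i.1 = k)
  rw [← hmp.lintegral_comp hΨ, lintegral_prod (fun q => Ψ _) (hΨ.comp hmp.measurable).aemeasurable]
  refine lintegral_congr fun a => ?_
  have hu : Measurable fun v : β → S => Ψ (fun i => if i.1 = k then v i.2 else a i) := by
    refine hΨ.comp (measurable_pi_lambda _ fun i => ?_)
    split_ifs <;> fun_prop
  have hrow : MeasurePreserving (fun (b : α × β → S) n => b (k, n))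
      (Measure.infinitePi fun _ : α × β => ν) (Measure.infinitePi fun _ : β => ν) :=
    ⟨by fun_prop, Measure.map_infinitePi_infinitePi_of_inj (P := fun _ : α × β => ν)
      (f := fun n : β => (k, n)) fun m n h => (Prod.ext_iff.1 h).2⟩
  rw [← hrow.lintegral_comp hu]
  refine lintegral_congr fun b => ?_
  congr 1
  ext i
  by_cases hi : i.1 = k
  · subst hi; simp
  · simp [hi]

end Resampling

/-! ### Dependence of the iterates on the randomness, and measurability -/

section
variable {Z : Type*}

/-- One iteration of the algorithm. -/
noncomputable def nextState (h : Hyper) (O : Vec d → Z → ℝ) (z : ℕ → Z) (j : ℕ) (e : ℕ → Vec d)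
    (s : State d) : State d :=
  let xg := h.θ • s.xf + (1 - h.θ) • s.x
  let xf' := xg - (h.p * h.γ) • gML O h.t h.M h.l j xg (fun i => z (s.calls + i)) e
  { x := h.η • xf' + (h.p - h.η) • s.xf + ((1 - h.p) * (1 - h.β)) • s.x + ((1 - h.p) * h.β) • xg
    xf := xf'
    calls := s.calls + 2 * batchSize h.M h.l j }

theorem run_succ (h : Hyper) (O : Vec d → Z → ℝ) (x0 : Vec d) (z : ℕ → Z) (J : ℕ → ℕ)
    (e : ℕ → ℕ → Vec d) (k : ℕ) :
    run h O x0 z J e (k + 1) = nextState h O z (J k) (e k) (run h O x0 z J e k) := rfl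

theorem run_calls (h : Hyper) (O : Vec d → Z → ℝ) (x0 : Vec d) (z : ℕ → Z) (J : ℕ → ℕ)
    (e : ℕ → ℕ → Vec d) (k : ℕ) :
    (run h O x0 z J e k).calls = ∑ i ∈ Finset.range k, 2 * batchSize h.M h.l (J i) := by
  induction k with
  | zero => rfl
  | succ k ih => rw [run_succ, Finset.sum_range_succ, ← ih]; rfl

theorem run_congr_levels (h : Hyper) (O : Vec d → Z → ℝ) (x0 : Vec d) (z : ℕ → Z) {J J' : ℕ → ℕ}
    {e e' : ℕ → ℕ → Vec d} {k : ℕ} (hJ : ∀ i < k, J i = J' i) (he : ∀ i < k, e i = e' i) :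
    run h O x0 z J e k = run h O x0 z J' e' k := by
  induction k with
  | zero => rfl
  | succ k ih =>
    rw [run_succ, run_succ, ih (fun i hi => hJ i (hi.trans k.lt_succ_self))
      (fun i hi => he i (hi.trans k.lt_succ_self)), hJ k k.lt_succ_self, he k k.lt_succ_self]

theorem gRD_congr (O : Vec d → Z → ℝ) (t : ℝ) (n : ℕ) (x : Vec d) {z z' : ℕ → Z} (e : ℕ → Vec d)
    (hz : ∀ i < 2 * n, z i = z' i) : gRD O t n x z e = gRD O t n x z' e := by
  unfold gRD
  congr 1
  refine Finset.sum_congr rfl fun i hi => ?_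
  have := Finset.mem_range.1 hi
  rw [hz _ (by omega), hz _ (by omega)]

theorem gML_congr (O : Vec d → Z → ℝ) (t M : ℝ) (l j : ℕ) (x : Vec d) {z z' : ℕ → Z}
    (e : ℕ → Vec d) (hz : ∀ i < 2 * batchSize M l j, z i = z' i) :
    gML O t M l j x z e = gML O t M l j x z' e := by
  unfold gML
  unfold batchSize at hz
  split_ifs with hj
  · rw [if_pos hj] at hz
    have h1 : 1 * l ≤ 2 ^ j * l := Nat.mul_le_mul_right l Nat.one_le_two_pow
    have h2 : 2 ^ (j - 1) * l ≤ 2 ^ j * l :=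
      Nat.mul_le_mul_right l (Nat.pow_le_pow_right (by norm_num) (Nat.sub_le _ _))
    rw [gRD_congr O t l x e fun i hi => hz i (by omega), gRD_congr O t _ x e hz,
      gRD_congr O t _ x e fun i hi => hz i (by omega)]
  · rw [if_neg hj] at hz
    rw [gRD_congr O t l x e hz]

/-- Each iteration reads a window of the path that starts where the previous ones stopped, so an
iterate is determined by the states consumed so far. This is the adaptedness needed to use mixing at
a random query point. -/
theorem run_congr_path (h : Hyper) (O : Vec d → Z → ℝ) (x0 : Vec d) {z z' : ℕ → Z} (J : ℕ → ℕ)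
    (e : ℕ → ℕ → Vec d) (k : ℕ) (hz : ∀ i < (run h O x0 z J e k).calls, z i = z' i) :
    run h O x0 z J e k = run h O x0 z' J e k := by
  induction k with
  | zero => rfl
  | succ k ih =>
    have hc : (run h O x0 z J e (k + 1)).calls =
      (run h O x0 z J e k).calls + 2 * batchSize h.M h.l (J k) := rfl
    have ih' := ih fun i hi => hz i (by omega)
    rw [run_succ, run_succ, ← ih']
    have := gML_congr O h.t h.M h.l (J k) (h.θ • (run h O x0 z J e k).xf +
      (1 - h.θ) • (run h O x0 z J e k).x) (z := fun i => z ((run h O x0 z J e k).calls + i))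
      (z' := fun i => z' ((run h O x0 z J e k).calls + i)) (e k) fun i hi => hz _ (by omega)
    simp only [nextState, this]

variable [MeasurableSpace Z]

theorem measurable_gHat {O : Vec d → Z → ℝ} (hO : Measurable (Function.uncurry O)) (t : ℝ) :
    Measurable fun q : (Vec d × Vec d) × (Z × Z) => gHat O t q.1.1 q.1.2 q.2.1 q.2.2 := by
  unfold gHat
  have h1 : Measurable fun q : (Vec d × Vec d) × (Z × Z) => O (q.1.1 + t • q.1.2) q.2.1 :=
    hO.comp (Measurable.prodMk (by fun_prop) (by fun_prop))
  have h2 : Measurable fun q : (Vec d × Vec d) × (Z × Z) => O (q.1.1 - t • q.1.2) q.2.2 :=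
    hO.comp (Measurable.prodMk (by fun_prop) (by fun_prop))
  exact (((h1.sub h2).div_const _).const_mul _).smul (by fun_prop)

theorem measurable_gRD {O : Vec d → Z → ℝ} (hO : Measurable (Function.uncurry O)) (t : ℝ) (n : ℕ) :
    Measurable fun q : Vec d × (ℕ → Z) × (ℕ → Vec d) => gRD O t n q.1 q.2.1 q.2.2 := by
  have h1 (i : ℕ) : Measurable fun q : Vec d × (ℕ → Z) × (ℕ → Vec d) =>
      gHat O t q.1 (q.2.2 i) (q.2.1 (2 * i)) (q.2.1 (2 * i + 1)) :=
    (measurable_gHat hO t).comp (f := fun q : Vec d × (ℕ → Z) × (ℕ → Vec d) =>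
      ((q.1, q.2.2 i), (q.2.1 (2 * i), q.2.1 (2 * i + 1)))) (by fun_prop)
  have h2 : Measurable fun q : Vec d × (ℕ → Z) × (ℕ → Vec d) =>
      ∑ i ∈ Finset.range n, gHat O t q.1 (q.2.2 i) (q.2.1 (2 * i)) (q.2.1 (2 * i + 1)) :=
    Finset.measurable_sum _ fun i _ => h1 i
  exact h2.const_smul (n : ℝ)⁻¹

theorem measurable_gML {O : Vec d → Z → ℝ} (hO : Measurable (Function.uncurry O)) (t M : ℝ)
    (l j : ℕ) :
    Measurable fun q : Vec d × (ℕ → Z) × (ℕ → Vec d) => gML O t M l j q.1 q.2.1 q.2.2 := by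
  have h1 (n : ℕ) := measurable_gRD hO t n
  by_cases hj : (2 : ℝ) ^ j ≤ M
  · simp only [gML, if_pos hj]
    exact (h1 l).add (((h1 (2 ^ j * l)).sub (h1 (2 ^ (j - 1) * l))).const_smul ((2 : ℝ) ^ j))
  · simpa only [gML, if_neg hj, add_zero] using h1 l

/-- Shifting a path by a random amount is measurable. -/
theorem measurable_shift {Ω : Type*} [MeasurableSpace Ω] {c : Ω → ℕ} {z : Ω → ℕ → Z}
    (hc : Measurable c) (hz : Measurable z) : Measurable fun ω i => z ω (c ω + i) := by
  have : Measurable fun q : ℕ × (ℕ → Z) => fun i => q.2 (q.1 + i) :=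
    measurable_from_prod_countable_right fun n => measurable_pi_lambda _ fun i =>
      measurable_pi_apply (n + i)
  exact this.comp (hc.prodMk hz)

variable {Ω : Type*} [MeasurableSpace Ω]

theorem measurable_gML_comp {O : Vec d → Z → ℝ} (hO : Measurable (Function.uncurry O)) (t M : ℝ)
    (l : ℕ) {j : Ω → ℕ} {x : Ω → Vec d} {z : Ω → ℕ → Z} {e : Ω → ℕ → Vec d} (hj : Measurable j)
    (hx : Measurable x) (hz : Measurable z) (he : Measurable e) :
    Measurable fun ω => gML O t M l (j ω) (x ω) (z ω) (e ω) := by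
  have : Measurable (Function.uncurry fun (j : ℕ) (q : Vec d × (ℕ → Z) × (ℕ → Vec d)) =>
      gML O t M l j q.1 q.2.1 q.2.2) :=
    measurable_from_prod_countable_right fun n => measurable_gML hO t M l n
  exact this.comp (f := fun ω => (j ω, x ω, z ω, e ω)) (hj.prodMk (hx.prodMk (hz.prodMk he)))

theorem measurable_nextState (h : Hyper) {O : Vec d → Z → ℝ} (hO : Measurable (Function.uncurry O))
    {s : Ω → State d} {j : Ω → ℕ} {z : Ω → ℕ → Z} {e : Ω → ℕ → Vec d}
    (hs : Measurable (fun ω => (s ω).x) ∧ Measurable (fun ω => (s ω).xf) ∧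
      Measurable (fun ω => (s ω).calls))
    (hj : Measurable j) (hz : Measurable z) (he : Measurable e) :
    Measurable (fun ω => (nextState h O (z ω) (j ω) (e ω) (s ω)).x) ∧
      Measurable (fun ω => (nextState h O (z ω) (j ω) (e ω) (s ω)).xf) ∧
      Measurable (fun ω => (nextState h O (z ω) (j ω) (e ω) (s ω)).calls) := by
  obtain ⟨h1, h2, h3⟩ := hs
  have hxg : Measurable fun ω => h.θ • (s ω).xf + (1 - h.θ) • (s ω).x := by fun_prop
  have hg := measurable_gML_comp hO h.t h.M h.l hj hxg (measurable_shift h3 hz) he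
  have hxf : Measurable fun ω => (nextState h O (z ω) (j ω) (e ω) (s ω)).xf :=
    hxg.sub (hg.const_smul (h.p * h.γ))
  refine ⟨?_, hxf, ?_⟩
  · exact (((hxf.const_smul h.η).add (h2.const_smul (h.p - h.η))).add
      (h1.const_smul ((1 - h.p) * (1 - h.β)))).add (hxg.const_smul ((1 - h.p) * h.β))
  · exact h3.add (((measurable_of_countable (batchSize h.M h.l)).comp hj).const_mul 2)

theorem measurable_iter (h : Hyper) {F : Vec d → Z → ℝ} {δ : Vec d → ℝ}
    (hF : Measurable (Function.uncurry F)) (hδ : Measurable δ) (x0 : Vec d) (k : ℕ) :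
    Measurable (fun ω : Sample Z d => (iter h F δ x0 k ω).x) ∧
      Measurable (fun ω : Sample Z d => (iter h F δ x0 k ω).xf) ∧
      Measurable (fun ω : Sample Z d => (iter h F δ x0 k ω).calls) := by
  have hO : Measurable (Function.uncurry fun x z => F x z + δ x) := hF.add (hδ.comp measurable_fst)
  induction k with
  | zero => exact ⟨measurable_const, measurable_const, measurable_const⟩
  | succ k ih =>
    exact measurable_nextState h hO ih (j := fun ω : Sample Z d => ω.2.1 k)
      (z := fun ω => ω.1) (e := fun ω i => (ω.2.2 (k, i) : Vec d))
      (by fun_prop) (by fun_prop) (by fun_prop)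

end

section
variable {L μ t : ℝ} {f : Vec d → ℝ}

theorem IsLSmooth.measurable_smoothed (hf : IsLSmooth L f) (t : ℝ) : Measurable (smoothed f t) := by
  have hc := hf.continuous
  have : Continuous (Function.uncurry fun (x u : Vec d) => f (x + t • u)) := by fun_prop
  exact this.stronglyMeasurable.integral_prod_right.measurable

theorem IsLSmooth.measurable_smoothGrad (hf : IsLSmooth L f) (t : ℝ) :
    Measurable (smoothGrad f t) := by
  have hc := hf.continuous_gradient
  have : Continuous (Function.uncurry fun (x u : Vec d) => gradient f (x + t • u)) := by fun_prop
  exact this.stronglyMeasurable.integral_prod_right.measurable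

end

/-! ### Estimator error at the random query point -/

/-- The point at which the gradient is queried. -/
noncomputable def Hyper.extrapolate (h : Hyper) (s : State d) : Vec d :=
  h.θ • s.xf + (1 - h.θ) • s.x

section
variable {Z : Type*} [MeasurableSpace Z] {L μ σ Δ : ℝ} {τ : ℕ} {Q : Kernel Z Z} {π : Measure Z}
  {F : Vec d → Z → ℝ} {δ f : Vec d → ℝ} {xs : Vec d}

theorem IsProblem.measurable_oracle (h : IsProblem L μ σ Δ τ Q π F δ f xs) :
    Measurable (Function.uncurry fun x z => F x z + δ x) :=
  h.oracle.measurable.add (h.perturbation_measurable.comp measurable_fst)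

theorem IsProblem.measurable_meanGrad (hd : 0 < d) (h : IsProblem L μ σ Δ τ Q π F δ f xs) (t : ℝ) :
    Measurable (meanGrad f δ t) := by
  have := isProbabilityMeasure_sphereLaw hd
  have hδ := h.perturbation_measurable
  have hf := h.measurable_f
  have hm : Measurable fun q : Vec d × sphere (0 : Vec d) 1 => q.1 + t • (q.2 : Vec d) := by fun_prop
  have : Measurable (Function.uncurry fun (x : Vec d) (e : sphere (0 : Vec d) 1) =>
      (f (x + t • (e : Vec d)) + δ (x + t • (e : Vec d))) • (e : Vec d)) :=
    ((hf.comp hm).add (hδ.comp hm)).smul (by fun_prop)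
  exact (this.stronglyMeasurable.integral_prod_right (ν := sphereLaw d)).measurable.const_smul
    ((d : ℝ) / t)

section
variable (ξ : Measure Z) (Q) [IsMarkovKernel Q]

/-- The first k iterates do not see level k, so averaging over a fresh value affects only the next
step. -/
theorem lintegral_sampleLaw_update_level (hd : 0 < d) (k : ℕ) {Ψ : Sample Z d → ENNReal}
    (hΨ : Measurable Ψ) :
    ∫⁻ ω, Ψ ω ∂sampleLaw d ξ Q =
      ∫⁻ ω, ∫⁻ j, Ψ (ω.1, Function.update ω.2.1 k j, ω.2.2) ∂levelLaw ∂sampleLaw d ξ Q := by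
  have := isProbabilityMeasure_sphereLaw hd
  have hu : Measurable fun q : Sample Z d × ℕ =>
      Ψ (q.1.1, Function.update q.1.2.1 k q.2, q.1.2.2) := by
    have h1 : Measurable fun q : Sample Z d × ℕ => Function.update q.1.2.1 k q.2 :=
      measurable_update'.comp (f := fun q : Sample Z d × ℕ => (q.1.2.1, q.2)) (by fun_prop)
    exact hΨ.comp (Measurable.prodMk (by fun_prop) (h1.prodMk (by fun_prop)))
  have hu' := hu.lintegral_prod_right'  (ν := levelLaw)
  rw [sampleLaw, lintegral_prod _ hΨ.aemeasurable, lintegral_prod _ hu'.aemeasurable]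
  refine lintegral_congr fun z => ?_
  have hz : Measurable fun q : (ℕ → ℕ) × (ℕ × ℕ → sphere (0 : Vec d) 1) => Ψ (z, q) :=
    hΨ.comp measurable_prodMk_left
  have hz' : Measurable fun q : (ℕ → ℕ) × (ℕ × ℕ → sphere (0 : Vec d) 1) =>
      ∫⁻ j, Ψ (z, Function.update q.1 k j, q.2) ∂levelLaw :=
    hu'.comp measurable_prodMk_left
  rw [lintegral_prod _ hz.aemeasurable, lintegral_prod _ hz'.aemeasurable,
    lintegral_infinitePi_update levelLaw k hz.lintegral_prod_right']
  refine lintegral_congr fun J => ?_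
  refine lintegral_lintegral_swap (f := fun j e => Ψ (z, Function.update J k j, e)) ?_
  refine Measurable.aemeasurable ?_
  exact hΨ.comp (f := fun q : ℕ × (ℕ × ℕ → sphere (0 : Vec d) 1) =>
    (z, Function.update J k q.1, q.2)) (Measurable.prodMk (by fun_prop)
      (((measurable_update J).comp measurable_fst).prodMk (by fun_prop)))

theorem lintegral_sampleLaw (hd : 0 < d) {Ψ : Sample Z d → ENNReal} (hΨ : Measurable Ψ)
    [SFinite (chainLaw ξ Q)] :
    ∫⁻ ω, Ψ ω ∂sampleLaw d ξ Q =
      ∫⁻ J, ∫⁻ e, ∫⁻ z, Ψ (z, J, e) ∂chainLaw ξ Q ∂(Measure.infinitePi fun _ : ℕ × ℕ => sphereLaw d)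
        ∂(Measure.infinitePi fun _ : ℕ => levelLaw) := by
  have := isProbabilityMeasure_sphereLaw hd
  rw [sampleLaw, lintegral_prod_symm _ hΨ.aemeasurable,
    lintegral_prod _ hΨ.lintegral_prod_left'.aemeasurable]

/-- The order of integration is the point: with levels and old directions fixed outside, the offset
into the path is a constant and the query point a function of the path, while the fresh row of
directions is integrated innermost. -/
theorem lintegral_sampleLaw_row (hd : 0 < d) (k : ℕ) {Ψ : Sample Z d → ENNReal} (hΨ : Measurable Ψ)
    [SFinite (chainLaw ξ Q)] :
    ∫⁻ ω, Ψ ω ∂sampleLaw d ξ Q =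
      ∫⁻ J, ∫⁻ e, ∫⁻ z, ∫⁻ v, Ψ (z, J, fun i => if i.1 = k then v i.2 else e i)
        ∂(Measure.infinitePi fun _ : ℕ => sphereLaw d) ∂chainLaw ξ Q
        ∂(Measure.infinitePi fun _ : ℕ × ℕ => sphereLaw d)
        ∂(Measure.infinitePi fun _ : ℕ => levelLaw) := by
  have := isProbabilityMeasure_sphereLaw hd
  rw [lintegral_sampleLaw Q ξ hd hΨ]
  refine lintegral_congr fun J => ?_
  have h1 : Measurable fun e => ∫⁻ z, Ψ (z, J, e) ∂chainLaw ξ Q :=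
    hΨ.lintegral_prod_left'.comp measurable_prodMk_left
  rw [lintegral_infinitePi_row (sphereLaw d) k h1]
  refine lintegral_congr fun e => ?_
  have mrow : Measurable fun q : (ℕ → sphere (0 : Vec d) 1) × (ℕ → Z) =>
      ((q.2, J, fun i => if i.1 = k then q.1 i.2 else e i) : Sample Z d) := by
    refine Measurable.prodMk (by fun_prop) (measurable_const.prodMk ?_)
    refine measurable_pi_lambda _ fun i => ?_
    split_ifs <;> fun_prop
  exact lintegral_lintegral_swap (hΨ.comp mrow).aemeasurable

end

theorem IsProblem.measurable_sample_gRD (h : IsProblem L μ σ Δ τ Q π F δ f xs) (t : ℝ) (n k : ℕ)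
    {X : Sample Z d → Vec d} (hX : Measurable X) {c : Sample Z d → ℕ} (hc : Measurable c) :
    Measurable fun ω : Sample Z d => gRD (fun x z => F x z + δ x) t n (X ω)
      (fun i => ω.1 (c ω + i)) (fun i => (ω.2.2 (k, i) : Vec d)) := by
  have m1 : Measurable fun (ω : Sample Z d) i => ω.1 (c ω + i) := measurable_shift hc measurable_fst
  have m2 : Measurable fun (ω : Sample Z d) i => (ω.2.2 (k, i) : Vec d) := by fun_prop
  exact (measurable_gRD h.measurable_oracle t n).comp
    (f := fun ω : Sample Z d => (X ω, (fun i => ω.1 (c ω + i)),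
      fun i => (ω.2.2 (k, i) : Vec d))) (hX.prodMk (m1.prodMk m2))

/-- For each fixed choice of levels and earlier directions this is the batch estimate with
deterministic offset c J. The hypotheses `hrow` and `hpath` say that X ignores the current
directions and the future of the chain. -/
theorem IsProblem.lintegral_sampleLaw_gRD_sub_sq_le [IsMarkovKernel Q] [IsProbabilityMeasure π]
    (ξ : Measure Z) [IsProbabilityMeasure ξ] (hd : 0 < d) (hτ : 0 < τ)
    (h : IsProblem L μ σ Δ τ Q π F δ f xs) (hσ : 0 ≤ σ) {t : ℝ} (ht : 0 < t) (hL : 0 ≤ L)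
    (hμ : 0 ≤ μ) {n : ℕ} (hn : 0 < n) (k : ℕ) {X : Sample Z d → Vec d} (hX : Measurable X)
    {c : (ℕ → ℕ) → ℕ} (hc : Measurable c)
    (hrow : ∀ z J e e', (∀ i n, i ≠ k → e (i, n) = e' (i, n)) → X (z, J, e) = X (z, J, e'))
    (hpath : ∀ z z' J e, (∀ i < c J, z i = z' i) → X (z, J, e) = X (z', J, e)) :
    ∫⁻ ω, ENNReal.ofReal (‖gRD (fun x z => F x z + δ x) t n (X ω)
        (fun i => ω.1 (c ω.2.1 + i)) (fun i => (ω.2.2 (k, i) : Vec d)) -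
          meanGrad f δ t (X ω)‖ ^ 2) ∂sampleLaw d ξ Q ≤
      ∫⁻ ω, ENNReal.ofReal (24 / n * (d * ‖smoothGrad f t (X ω)‖ ^ 2 +
        baseVariance d τ L σ Δ t)) ∂sampleLaw d ξ Q := by
  have := isProbabilityMeasure_sphereLaw hd
  have mg := h.measurable_sample_gRD t n k hX
    (c := fun ω => c ω.2.1) (hc.comp (by fun_prop))
  have mΨ : Measurable fun ω : Sample Z d =>
      ENNReal.ofReal (‖gRD (fun x z => F x z + δ x) t n (X ω)
        (fun i => ω.1 (c ω.2.1 + i)) (fun i => (ω.2.2 (k, i) : Vec d)) -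
          meanGrad f δ t (X ω)‖ ^ 2) :=
    ((mg.sub ((h.measurable_meanGrad hd t).comp hX)).norm.pow_const 2).ennreal_ofReal
  have mΦ : Measurable fun ω : Sample Z d =>
      ENNReal.ofReal (24 / n * (d * ‖smoothGrad f t (X ω)‖ ^ 2 + baseVariance d τ L σ Δ t)) := by
    have hs : Measurable fun ω => smoothGrad f t (X ω) := (h.smooth.measurable_smoothGrad t).comp hX
    fun_prop
  rw [lintegral_sampleLaw_row Q ξ hd k mΨ, lintegral_sampleLaw Q ξ hd mΦ]
  refine lintegral_mono fun J => lintegral_mono fun e => ?_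
  have hXrow (z : ℕ → Z) (v : ℕ → sphere (0 : Vec d) 1) :
      X (z, J, fun i => if i.1 = k then v i.2 else e i) = X (z, J, e) :=
    hrow _ _ _ _ fun i n hi => by simp [hi]
  have key := h.lintegral_gRD_sub_sq_le (ξ := ξ) hd hτ hσ ht hL hμ hn
    (x := fun z => X (z, J, e)) (hX.comp (measurable_prodMk_right (y := (J, e)))) (c J)
    fun z z' hz => hpath z z' J e hz
  simpa only [hXrow, if_true] using key

end

/-! ### Parameter identities and the shape of one iteration -/

namespace Hyper
variable {H : Hyper}

theorem β_pos (hp : 0 < H.p) (hμ : 0 < H.μ) (hγ : 0 < H.γ) : 0 < H.β :=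
  Real.sqrt_pos.2 (by positivity)

theorem β_sq (hμ : 0 < H.μ) (hγ : 0 < H.γ) : H.β ^ 2 = 4 * H.p ^ 2 * H.μ * H.γ / 3 :=
  Real.sq_sqrt (by positivity)

theorem β_le_p (hp : 0 < H.p) (hμγ : H.μ * H.γ ≤ 3 / 4) : H.β ≤ H.p := by
  refine Real.sqrt_le_iff.2 ⟨hp.le, ?_⟩
  have := mul_le_mul_of_nonneg_left hμγ (sq_nonneg H.p)
  linarith

theorem η_mul_β (hp : 0 < H.p) (hμ : 0 < H.μ) (hγ : 0 < H.γ) : H.η * H.β = 2 * H.p := by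
  rw [η, β, ← Real.sqrt_mul (by positivity)]
  rw [show 3 / (H.μ * H.γ) * (4 * H.p ^ 2 * H.μ * H.γ / 3) = (2 * H.p) ^ 2 by field_simp; ring]
  exact Real.sqrt_sq (by positivity)

/-- Since pη⁻¹ = β/2, the formula for θ reads θ = (1 − β/2)/(1 − β²/2), which is the value balancing
the two differences. -/
theorem extrapolate_rel (hp : 0 < H.p) (hμ : 0 < H.μ) (hγ : 0 < H.γ) (hβ1 : H.β ≤ 1)
    (s : State d) : (1 - H.β) • (s.x - H.extrapolate s) =
      (2 / H.β - 1) • (H.extrapolate s - s.xf) := by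
  have hβ := β_pos hp hμ hγ
  have hη := η_mul_β hp hμ hγ
  have hη0 : H.η ≠ 0 := by
    rintro h
    rw [h] at hη
    linarith
  have h1 : H.p * H.η⁻¹ = H.β / 2 := by
    field_simp
    linarith
  have h2 : H.β * H.p * H.η⁻¹ - 1 ≠ 0 := by
    rw [mul_assoc, h1]
    nlinarith
  have h3 : (1 - H.β) * H.θ = (2 / H.β - 1) * (1 - H.θ) := by
    have h4 : H.θ * (H.β * (H.β / 2) - 1) = H.β / 2 - 1 := by
      rw [θ, ← h1, ← mul_assoc, div_mul_cancel₀ _ h2]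
    have h5 : H.β * ((1 - H.β) * H.θ) = H.β * ((2 / H.β - 1) * (1 - H.θ)) := by
      have : H.β * ((2 / H.β - 1) * (1 - H.θ)) = (2 - H.β) * (1 - H.θ) := by
        field_simp
      rw [this]
      linarith
    exact mul_left_cancel₀ hβ.ne' h5
  have e1 : s.x - H.extrapolate s = H.θ • (s.x - s.xf) := by
    rw [extrapolate]
    module
  have e2 : H.extrapolate s - s.xf = (1 - H.θ) • (s.x - s.xf) := by
    rw [extrapolate]
    module
  rw [e1, e2, smul_smul, smul_smul, h3]

/-- By the extrapolation relation the terms in x_f and those weighted by p cancel, which leaves the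
momentum form required by `accelerated_step`. -/
theorem nextState_x {Z : Type*} (hp : 0 < H.p) (hμ : 0 < H.μ) (hγ : 0 < H.γ) (hβ1 : H.β ≤ 1)
    (O : Vec d → Z → ℝ) (z : ℕ → Z) (j : ℕ) (e : ℕ → Vec d) (s : State d) :
    (nextState H O z j e s).x = (1 - H.β) • s.x + H.β • H.extrapolate s - (3 * H.β / (2 * H.μ)) •
      gML O H.t H.M H.l j (H.extrapolate s) (fun i => z (s.calls + i)) e := by
  have hβ := β_pos hp hμ hγ
  have hη : H.η = 2 * H.p / H.β := by
    rw [eq_div_iff hβ.ne', η_mul_β hp hμ hγ]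
  have hrel := extrapolate_rel hp hμ hγ hβ1 s
  have ha : H.η * (H.p * H.γ) = 3 * H.β / (2 * H.μ) := by
    have := β_sq (H := H) hμ hγ
    rw [hη]
    field_simp
    linarith
  rw [← ha]
  set g := gML O H.t H.M H.l j (H.extrapolate s) (fun i => z (s.calls + i)) e with hg
  set w := H.extrapolate s with hw
  have hx : (nextState H O z j e s).x = H.η • (w - (H.p * H.γ) • g) + (H.p - H.η) • s.xf +
      ((1 - H.p) * (1 - H.β)) • s.x + ((1 - H.p) * H.β) • w := rfl
  rw [hx]
  have h1 : H.η • (w - s.xf) = (2 * H.p / H.β) • (w - s.xf) := by rw [hη]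
  have h2 : (2 * H.p / H.β) • (w - s.xf) = H.p • ((1 - H.β) • (s.x - w) + (w - s.xf)) := by
    rw [hrel]
    module
  have h3 : H.η • (w - (H.p * H.γ) • g) + (H.p - H.η) • s.xf =
      H.η • (w - s.xf) + H.p • s.xf - (H.η * (H.p * H.γ)) • g := by module
  rw [h3, h1, h2]
  module

theorem nextState_xf {Z : Type*} (O : Vec d → Z → ℝ) (z : ℕ → Z) (j : ℕ) (e : ℕ → Vec d)
    (s : State d) :
    (nextState H O z j e s).xf = H.extrapolate s - (H.p * H.γ) •
      gML O H.t H.M H.l j (H.extrapolate s) (fun i => z (s.calls + i)) e := rfl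

theorem one_le_M (hp : 0 < H.p) (hp1 : H.p ≤ 1) : 1 ≤ H.M := by
  have h1 : 1 ≤ 1 / H.p := by rwa [le_div_iff₀ hp, one_mul]
  have h2 : 0 ≤ 2 / H.β := div_nonneg two_pos.le (Real.sqrt_nonneg _)
  exact h1.trans (le_add_of_nonneg_right h2)

/-- The largest level at which the multilevel correction is active. -/
noncomputable def maxLevel (H : Hyper) : ℕ := ⌊Real.logb 2 H.M⌋₊

theorem l_eq (H : Hyper) : H.l = (H.maxLevel + 1) * H.B := rfl

theorem M_lt_two_pow (hp : 0 < H.p) (hp1 : H.p ≤ 1) : H.M < 2 * 2 ^ H.maxLevel := by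
  by_contra! h
  rw [← pow_succ', two_pow_le_iff_le_floor (one_le_M hp hp1)] at h
  exact Nat.not_succ_le_self _ h

end Hyper

/-! ### The potential -/

section
variable {L μ t : ℝ} {f : Vec d → ℝ} {xs : Vec d}

/-- Potential function of the accelerated method. -/
noncomputable def potential (L μ t : ℝ) (f : Vec d → ℝ) (xs : Vec d) (s : State d) : ℝ :=
  ‖s.x - xs‖ ^ 2 + 6 / μ * (smoothed f t s.xf - smoothed f t xs + L * t ^ 2 / 2)

/-- The point xs minimises f, not its average; the shift Lt²/2 in the potential makes up for this
and keeps it nonnegative. -/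
theorem IsLSmooth.sub_le_smoothed_sub (hf : IsLSmooth L f) (hc : IsStronglyConvex μ f) (hL : 0 ≤ L)
    (hμ : 0 ≤ μ) (t : ℝ) (xs y : Vec d) :
    f y - f xs ≤ smoothed f t y - smoothed f t xs + L * t ^ 2 / 2 := by
  have h1 := hf.le_smoothed hc hμ t y
  have h2 := hf.smoothed_le hL t xs
  linarith

theorem errR_le_potential (hf : IsLSmooth L f) (hc : IsStronglyConvex μ f) (hL : 0 ≤ L)
    (hμ : 0 < μ) (hmin : ∀ x, f xs ≤ f x) (t : ℝ) (s : State d) :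
    errR μ f xs s ≤ potential L μ t f xs s := by
  have h1 := hf.sub_le_smoothed_sub hc hL hμ.le t xs s.xf
  have h2 := hmin s.xf
  rw [errR, potential, add_comm]
  gcongr
  norm_num

theorem errR_nonneg (hμ : 0 < μ) (hmin : ∀ x, f xs ≤ f x) (s : State d) : 0 ≤ errR μ f xs s := by
  have := sub_nonneg.2 (hmin s.xf)
  unfold errR
  positivity

theorem potential_nonneg (hf : IsLSmooth L f) (hc : IsStronglyConvex μ f) (hL : 0 ≤ L)
    (hμ : 0 < μ) (hmin : ∀ x, f xs ≤ f x) (t : ℝ) (s : State d) : 0 ≤ potential L μ t f xs s :=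
  (errR_nonneg hμ hmin s).trans (errR_le_potential hf hc hL hμ hmin t s)

theorem potential_le (hf : IsLSmooth L f) (hc : IsStronglyConvex μ f) (hL : 0 ≤ L)
    (hμ : 0 < μ) (t : ℝ) (s : State d) :
    potential L μ t f xs s ≤ 6 * errR μ f xs s + 6 / μ * (L * t ^ 2) := by
  have h1 := hf.smoothed_le hL t s.xf
  have h2 := hf.le_smoothed hc hμ.le t xs
  have h3 : 6 / μ * (smoothed f t s.xf - smoothed f t xs + L * t ^ 2 / 2) ≤
      6 / μ * (f s.xf - f xs + L * t ^ 2) :=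
    mul_le_mul_of_nonneg_left (by linarith) (by positivity)
  have h4 : 6 * (1 / μ * (f s.xf - f xs)) + 6 / μ * (L * t ^ 2) =
    6 / μ * (f s.xf - f xs + L * t ^ 2) := by ring
  have h5 := sq_nonneg ‖s.x - xs‖
  rw [potential, errR, mul_add]
  linarith

/-- Needed only for integrability of the squared gradient; its constant does not enter any rate. -/
theorem norm_smoothGrad_extrapolate_sq_le (hf : IsLSmooth L f) (hc : IsStronglyConvex μ f)
    (hL : 0 ≤ L) (hμ : 0 < μ) (hmin : ∀ x, f xs ≤ f x) (ht : 0 ≤ t) (H : Hyper) (s : State d) :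
    ‖smoothGrad f t (H.extrapolate s)‖ ^ 2 ≤
      2 * L ^ 2 * (2 * H.θ ^ 2 + 2 * (1 - H.θ) ^ 2) * potential L μ t f xs s + 2 * (L * t) ^ 2 := by
  set z := H.extrapolate s with hz
  set T := potential L μ t f xs s with hT
  have h1 := hf.norm_gradient_sub_smoothGrad_le hL ht z
  have h2 : ‖gradient f z‖ ≤ L * ‖z - xs‖ := by
    have := hf.2 z xs
    rwa [gradient_eq_zero_of_forall_le hmin, sub_zero] at this
  have h3 : ‖smoothGrad f t z‖ ^ 2 ≤ 2 * ‖gradient f z‖ ^ 2 +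
      2 * ‖gradient f z - smoothGrad f t z‖ ^ 2 := by
    have := norm_sub_sq_le (gradient f z) (gradient f z - smoothGrad f t z)
    rw [sub_sub_cancel] at this
    linarith
  have h4 : ‖z - xs‖ ^ 2 ≤ 2 * (H.θ ^ 2 * ‖s.xf - xs‖ ^ 2) + 2 * ((1 - H.θ) ^ 2 * ‖s.x - xs‖ ^ 2) := by
    have := norm_add_sq_le (H.θ • (s.xf - xs)) ((1 - H.θ) • (s.x - xs))
    rw [show H.θ • (s.xf - xs) + (1 - H.θ) • (s.x - xs) = z - xs by
      rw [hz, Hyper.extrapolate]; module, norm_smul, norm_smul, mul_pow, mul_pow,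
      Real.norm_eq_abs, Real.norm_eq_abs, sq_abs, sq_abs] at this
    linarith
  have h5 : ‖s.xf - xs‖ ^ 2 ≤ T := by
    have e1 := hc.2 s.xf xs
    rw [gradient_eq_zero_of_forall_le hmin, inner_zero_left, sub_zero] at e1
    have e2 := hf.sub_le_smoothed_sub hc hL hμ.le t xs s.xf
    have e3 : ‖s.xf - xs‖ ^ 2 ≤ 2 / μ * (f s.xf - f xs) := by
      rw [div_mul_eq_mul_div, le_div_iff₀ hμ]
      linarith
    have e4 : 0 ≤ f s.xf - f xs := sub_nonneg.2 (hmin _)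
    have e5 : 2 / μ * (f s.xf - f xs) ≤
        6 / μ * (smoothed f t s.xf - smoothed f t xs + L * t ^ 2 / 2) := by
      gcongr
      norm_num
    have e6 := sq_nonneg ‖s.x - xs‖
    rw [hT, potential]
    linarith
  have h6 : ‖s.x - xs‖ ^ 2 ≤ T := by
    have e2 := hf.sub_le_smoothed_sub hc hL hμ.le t xs s.xf
    have e4 : 0 ≤ f s.xf - f xs := sub_nonneg.2 (hmin _)
    rw [hT, potential]
    refine le_add_of_nonneg_right (mul_nonneg (by positivity) (e4.trans e2))
  have h7 : ‖z - xs‖ ^ 2 ≤ (2 * H.θ ^ 2 + 2 * (1 - H.θ) ^ 2) * T := by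
    have := mul_le_mul_of_nonneg_left h5 (sq_nonneg H.θ)
    have := mul_le_mul_of_nonneg_left h6 (sq_nonneg (1 - H.θ))
    linarith
  calc ‖smoothGrad f t z‖ ^ 2 ≤ 2 * (L * ‖z - xs‖) ^ 2 + 2 * (L * t) ^ 2 := by
        refine h3.trans ?_
        gcongr
    _ = 2 * L ^ 2 * ‖z - xs‖ ^ 2 + 2 * (L * t) ^ 2 := by ring
    _ ≤ 2 * L ^ 2 * ((2 * H.θ ^ 2 + 2 * (1 - H.θ) ^ 2) * T) + 2 * (L * t) ^ 2 := by gcongr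
    _ = _ := by ring

end

section
variable {Z : Type*} [MeasurableSpace Z] {L σ Δ : ℝ} {τ : ℕ} {Q : Kernel Z Z} {π : Measure Z}
  {F : Vec d → Z → ℝ} {δ f : Vec d → ℝ} {xs : Vec d} {H : Hyper}

/-- Average over the level of the potential after one iteration. -/
theorem IsProblem.sum_levelWeight_mul_potential_le (hd : 0 < d)
    (h : IsProblem L H.μ σ Δ τ Q π F δ f xs) (hp : 0 < H.p) (hp1 : H.p ≤ 1) (hμ : 0 < H.μ)
    (hγ : 0 < H.γ) (hLγ : L * H.γ ≤ 3 / 4) (ht : 0 < H.t) (z : ℕ → Z) (e : ℕ → Vec d) (s : State d)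
    (D : ℕ → ℝ) (hD : ∀ i, D i = ‖gRD (fun x z => F x z + δ x) H.t (2 ^ i * H.l) (H.extrapolate s)
      (fun i => z (s.calls + i)) e - meanGrad f δ H.t (H.extrapolate s)‖ ^ 2) :
    ∑ n ∈ Finset.range (H.maxLevel + 1), levelWeight H.maxLevel n *
        potential L H.μ H.t f xs (nextState H (fun x z => F x z + δ x) z (n + 1) e s) ≤
      (1 - H.β / 2) * potential L H.μ H.t f xs s + 3 * H.β * (L * H.t ^ 2 / 2) / H.μ +
        H.β / H.μ ^ 2 * (16 * H.β * (2 * D 0 + ∑ n ∈ Finset.range H.maxLevel,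
            4 * 2 ^ (n + 1) * (D (n + 1) + D n)) + 45 / 2 * D H.maxLevel +
          77 / 2 * (d * Δ / H.t) ^ 2 - (9 * H.β / (4 * H.p) - 8 * H.β) *
            ‖smoothGrad f H.t (H.extrapolate s)‖ ^ 2) := by
  have hβ := Hyper.β_pos hp hμ hγ
  have hμL := h.smooth.strongConvexity_le hd h.stronglyConvex
  have hβp : H.β ≤ H.p := Hyper.β_le_p hp ((mul_le_mul_of_nonneg_right hμL hγ.le).trans hLγ)
  have hβ1 := hβp.trans hp1
  have hM := Hyper.one_le_M hp hp1
  set w := H.extrapolate s with hw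
  set O : Vec d → Z → ℝ := fun x z => F x z + δ x with hO
  set R : ℕ → Vec d := fun i => gRD O H.t (2 ^ i * H.l) w (fun i => z (s.calls + i)) e with hR
  set m := meanGrad f δ H.t w with hm
  set G := smoothGrad f H.t w with hG
  set s0 := L * H.t ^ 2 / 2 with hs0
  have hg (n : ℕ) : gML O H.t H.M H.l (n + 1) w (fun i => z (s.calls + i)) e =
      mlCombine H.maxLevel R n := gML_succ_eq_mlCombine _ _ hM _ _ _ _ _
  have hlow := h.smooth.smoothed_lower h.stronglyConvex H.t w
  have key := accelerated_step (Finset.range (H.maxLevel + 1)) (w := levelWeight H.maxLevel)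
    (fun i _ => levelWeight_nonneg _ i) (sum_levelWeight _) (mlCombine H.maxLevel R) hμ hγ hp hβ hβ1
    hLγ (by rw [Hyper.β_sq hμ hγ]; field_simp) (Hyper.extrapolate_rel hp hμ hγ hβ1 s)
    ((le_add_of_nonneg_right (by positivity)).trans (hlow s.xf)) (hlow xs)
    (h.smooth.smoothed_upper H.t w)
  have e1 (n : ℕ) : potential L H.μ H.t f xs (nextState H O z (n + 1) e s) =
      (‖(1 - H.β) • s.x + H.β • w - (3 * H.β / (2 * H.μ)) • mlCombine H.maxLevel R n - xs‖ ^ 2 +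
        6 / H.μ * (smoothed f H.t (w - (H.p * H.γ) • mlCombine H.maxLevel R n) -
          smoothed f H.t xs)) + 6 / H.μ * s0 := by
    rw [potential, Hyper.nextState_x hp hμ hγ hβ1, Hyper.nextState_xf, hg]
    ring
  simp only [e1, mul_add (levelWeight _ _) _ (6 / H.μ * s0), Finset.sum_add_distrib]
  rw [← Finset.sum_mul, sum_levelWeight, one_mul]
  rw [sum_levelWeight_smul_mlCombine] at key
  have hDm := h.norm_meanGrad_sub_le hd ht w
  have b1 : ‖R H.maxLevel - G‖ ^ 2 ≤ 2 * D H.maxLevel + 2 * (d * Δ / H.t) ^ 2 := by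
    have := norm_add_sq_le (R H.maxLevel - m) (m - G)
    rw [sub_add_sub_cancel, ← hD] at this
    linarith
  have b2 : ∑ n ∈ Finset.range (H.maxLevel + 1), levelWeight H.maxLevel n *
      ‖mlCombine H.maxLevel R n - G‖ ^ 2 ≤ 2 * (2 * D 0 + ∑ n ∈ Finset.range H.maxLevel,
            4 * 2 ^ (n + 1) * (D (n + 1) + D n)) + 2 * (d * Δ / H.t) ^ 2 := by
    have := sum_levelWeight_mlCombine_sub_sq_le H.maxLevel R m
    simp only [hR, ← hD] at this
    calc _ ≤ ∑ n ∈ Finset.range (H.maxLevel + 1), levelWeight H.maxLevel n *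
          (2 * ‖mlCombine H.maxLevel R n - m‖ ^ 2 + 2 * (d * Δ / H.t) ^ 2) := by
          refine Finset.sum_le_sum fun n _ => mul_le_mul_of_nonneg_left ?_ (levelWeight_nonneg _ _)
          have := norm_add_sq_le (mlCombine H.maxLevel R n - m) (m - G)
          rw [sub_add_sub_cancel] at this
          linarith
      _ = 2 * ∑ n ∈ Finset.range (H.maxLevel + 1), levelWeight H.maxLevel n *
          ‖mlCombine H.maxLevel R n - m‖ ^ 2 + 2 * (d * Δ / H.t) ^ 2 := by
          simp only [mul_add, Finset.sum_add_distrib]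
          rw [← Finset.sum_mul, sum_levelWeight, one_mul, Finset.mul_sum]
          congr 1
          exact Finset.sum_congr rfl fun n _ => by ring
      _ ≤ _ := by gcongr
  set V := ∑ n ∈ Finset.range (H.maxLevel + 1), levelWeight H.maxLevel n *
      ‖mlCombine H.maxLevel R n - G‖ ^ 2 with hV
  set W := 2 * D 0 + ∑ n ∈ Finset.range H.maxLevel, 4 * 2 ^ (n + 1) * (D (n + 1) + D n) with hW
  -- From β ≤ p. The bias coefficient is then at most 45/4, and 77/2 = 16 + 45/2 collects the
  -- perturbation from both the variance and the bias.
  have b3 : 9 * H.β / (4 * H.p) ≤ 9 / 4 := by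
    rw [div_le_div_iff₀ (by positivity) (by norm_num)]
    linarith
  have b4 : (9 + 9 * H.β / (4 * H.p)) * ‖R H.maxLevel - G‖ ^ 2 ≤
      45 / 4 * (2 * D H.maxLevel + 2 * (d * Δ / H.t) ^ 2) :=
    mul_le_mul (by linarith) b1 (by positivity) (by norm_num)
  have b5 : 8 * H.β * V ≤ 16 * H.β * W + 16 * (d * Δ / H.t) ^ 2 := by
    have e1 := mul_le_mul_of_nonneg_left b2 (by positivity : 0 ≤ 8 * H.β)
    have e2 := mul_le_mul_of_nonneg_right hβ1 (sq_nonneg (d * Δ / H.t))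
    linarith
  have b6 : 8 * H.β * (‖G‖ ^ 2 + V) + (9 + 9 * H.β / (4 * H.p)) * ‖R H.maxLevel - G‖ ^ 2 -
      9 * H.β / (4 * H.p) * ‖G‖ ^ 2 ≤ 16 * H.β * W + 45 / 2 * D H.maxLevel +
          77 / 2 * (d * Δ / H.t) ^ 2 - (9 * H.β / (4 * H.p) - 8 * H.β) * ‖G‖ ^ 2 := by
    linarith
  have b7 := mul_le_mul_of_nonneg_left b6 (by positivity : 0 ≤ H.β / H.μ ^ 2)
  refine (add_le_add_left key _).trans ?_
  have e3 : (1 - H.β / 2) * potential L H.μ H.t f xs s + 3 * H.β * s0 / H.μ =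
      (1 - H.β / 2) * (‖s.x - xs‖ ^ 2 + 6 / H.μ * (smoothed f H.t s.xf - smoothed f H.t xs)) +
        6 / H.μ * s0 := by
    rw [potential]
    ring
  rw [e3]
  linarith

end

/-- Beyond the maximal level the correction vanishes, so the position no longer depends on the
level; this is what `lintegral_levelLaw` asks for. -/
theorem potential_nextState_congr {Z : Type*} {L : ℝ} {f : Vec d → ℝ} {xs : Vec d} {H : Hyper}
    (hp : 0 < H.p) (hp1 : H.p ≤ 1) (O : Vec d → Z → ℝ) (z : ℕ → Z)
    (e : ℕ → Vec d) (s : State d) (n : ℕ) (hn : H.maxLevel ≤ n) :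
    potential L H.μ H.t f xs (nextState H O z (n + 1) e s) =
      potential L H.μ H.t f xs (nextState H O z (H.maxLevel + 1) e s) := by
  have hM := Hyper.one_le_M hp hp1
  have hg : gML O H.t H.M H.l (n + 1) (H.extrapolate s) (fun i => z (s.calls + i)) e =
      gML O H.t H.M H.l (H.maxLevel + 1) (H.extrapolate s) (fun i => z (s.calls + i)) e := by
    rw [gML_succ_eq_mlCombine _ _ hM, gML_succ_eq_mlCombine _ _ hM, mlCombine, mlCombine,
      if_neg (show ¬ n < ⌊Real.logb 2 H.M⌋₊ from hn.not_gt),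
      if_neg (show ¬ H.maxLevel < ⌊Real.logb 2 H.M⌋₊ from lt_irrefl _)]
  rw [Hyper.extrapolate] at hg
  simp only [potential, nextState, hg]

/-! ### The recursion for the expected potential -/

/-- `X` is integrable with mean at most `a`. -/
def HasMeanLE {Ω : Type*} [MeasurableSpace Ω] (P : Measure Ω) (X : Ω → ℝ) (a : ℝ) : Prop :=
  Integrable X P ∧ ∫ ω, X ω ∂P ≤ a

namespace HasMeanLE
variable {Ω : Type*} [MeasurableSpace Ω] {P : Measure Ω} {X Y : Ω → ℝ} {a b : ℝ}

theorem add (hX : HasMeanLE P X a) (hY : HasMeanLE P Y b) :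
    HasMeanLE P (fun ω => X ω + Y ω) (a + b) :=
  ⟨hX.1.add hY.1, by rw [integral_add hX.1 hY.1]; exact add_le_add hX.2 hY.2⟩

theorem const_mul (hX : HasMeanLE P X a) {c : ℝ} (hc : 0 ≤ c) :
    HasMeanLE P (fun ω => c * X ω) (c * a) :=
  ⟨hX.1.const_mul c, by rw [integral_const_mul]; exact mul_le_mul_of_nonneg_left hX.2 hc⟩

theorem const [IsProbabilityMeasure P] (c : ℝ) : HasMeanLE P (fun _ => c) c :=
  ⟨integrable_const c, by simp⟩

theorem sum {ι : Type*} (s : Finset ι) {X : ι → Ω → ℝ} {a : ι → ℝ}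
    (h : ∀ i ∈ s, HasMeanLE P (X i) (a i)) :
    HasMeanLE P (fun ω => ∑ i ∈ s, X i ω) (∑ i ∈ s, a i) :=
  ⟨integrable_finsetSum s fun i hi => (h i hi).1, by
    rw [integral_finsetSum s fun i hi => (h i hi).1]
    exact Finset.sum_le_sum fun i hi => (h i hi).2⟩

/-- Passes from bounds on `∫⁻`, in which the induction is phrased, to Bochner integrals, where
negative terms can be kept. -/
theorem of_lintegral_le (hX : Measurable X) (h0 : 0 ≤ X) (ha : 0 ≤ a)
    (h : ∫⁻ ω, ENNReal.ofReal (X ω) ∂P ≤ ENNReal.ofReal a) : HasMeanLE P X a := by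
  have hi : Integrable X P := (lintegral_ofReal_ne_top_iff_integrable hX.aestronglyMeasurable
    (Eventually.of_forall h0)).1 (ne_top_of_le_ne_top ENNReal.ofReal_ne_top h)
  refine ⟨hi, ?_⟩
  rwa [← ofReal_integral_eq_lintegral_ofReal hi (Eventually.of_forall h0),
    ENNReal.ofReal_le_ofReal_iff ha] at h

theorem lintegral_le (hX : HasMeanLE P X a) (h0 : 0 ≤ X) :
    ∫⁻ ω, ENNReal.ofReal (X ω) ∂P ≤ ENNReal.ofReal a := by
  rw [← ofReal_integral_eq_lintegral_ofReal hX.1 (Eventually.of_forall h0)]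
  exact ENNReal.ofReal_le_ofReal hX.2

end HasMeanLE

theorem isProbabilityMeasure_sampleLaw {Z : Type*} [MeasurableSpace Z] (ξ : Measure Z)
    [IsProbabilityMeasure ξ] (Q : Kernel Z Z) [IsMarkovKernel Q] (hd : 0 < d) :
    IsProbabilityMeasure (sampleLaw d ξ Q) := by
  have := isProbabilityMeasure_sphereLaw hd
  unfold sampleLaw
  infer_instance

/-- Weighted sum of the variances of the estimators in the multilevel correction. -/
theorem Hyper.sum_level_variance_le {H : Hyper} (hp : 0 < H.p) (hp1 : H.p ≤ 1) (hμ : 0 < H.μ)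
    (hγ : 0 < H.γ) (hB : 0 < H.B) {N : ℝ} (hN : 0 ≤ N) :
    16 * H.β * (2 * (24 / (2 ^ 0 * H.l : ℕ) * N) + ∑ n ∈ Finset.range H.maxLevel,
        4 * 2 ^ (n + 1) * (24 / (2 ^ (n + 1) * H.l : ℕ) * N + 24 / (2 ^ n * H.l : ℕ) * N)) +
      45 / 2 * (24 / (2 ^ H.maxLevel * H.l : ℕ) * N) ≤ 5148 * (H.β / H.B) * N := by
  have hβ := Hyper.β_pos hp hμ hγ
  have hB' : (0 : ℝ) < H.B := by exact_mod_cast hB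
  set m := H.maxLevel with hm
  have hl : (H.l : ℝ) = (m + 1) * H.B := by rw [Hyper.l_eq]; push_cast; ring
  have hl0 : (0 : ℝ) < H.l := by rw [hl]; positivity
  -- The growth 2^(n+1) cancels the batch sizes, so all levels contribute equally: 4 · 24 · (1 + 2)
  -- = 288.
  have e1 (n : ℕ) : 4 * (2 : ℝ) ^ (n + 1) * (24 / (2 ^ (n + 1) * H.l : ℕ) * N +
      24 / (2 ^ n * H.l : ℕ) * N) = 288 * N / H.l := by
    push_cast
    rw [pow_succ]
    field_simp
    ring
  simp only [e1, Finset.sum_const, Finset.card_range, nsmul_eq_mul]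
  -- There are m levels and the base term counts as at most one more; this is why l contains the
  -- factor m + 1.
  have e2 : 2 * (24 / ((2 ^ 0 * H.l : ℕ) : ℝ) * N) + m * (288 * N / H.l) ≤ 288 * N / H.B := by
    have : 288 * N / H.B = (m + 1) * (288 * N / H.l) := by
      rw [hl]
      field_simp
    rw [this, pow_zero, one_mul]
    have : 2 * (24 / (H.l : ℝ) * N) ≤ 288 * N / H.l := by
      rw [div_mul_eq_mul_div, ← mul_div_assoc]
      exact div_le_div_of_nonneg_right (by linarith) hl0.le
    linarith
  -- The summand 2/β of M serves here: 2^(m+1) > M ≥ 2/β makes the error of the largest batch of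
  -- order β/B.
  have e3 : 24 / ((2 ^ m * H.l : ℕ) : ℝ) * N ≤ 24 * H.β * N / H.B := by
    have h1 := Hyper.M_lt_two_pow hp hp1
    have h2 : 2 / H.β ≤ H.M := by
      rw [Hyper.M]
      exact le_add_of_nonneg_left (by positivity)
    have h3 : 1 ≤ H.β * 2 ^ m := by
      have := h2.trans h1.le
      rw [div_le_iff₀ hβ] at this
      linarith
    have h4 : (H.B : ℝ) ≤ H.l := by
      rw [hl]
      exact le_mul_of_one_le_left hB'.le (by linarith [(Nat.cast_nonneg m : (0 : ℝ) ≤ m)])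
    push_cast
    rw [div_mul_eq_mul_div, div_le_div_iff₀ (by positivity) hB']
    calc 24 * N * H.B ≤ 24 * N * (H.β * 2 ^ m * H.l) := by
          gcongr
          exact h4.trans (le_mul_of_one_le_left hl0.le h3)
      _ = _ := by ring
  have e4 := mul_le_mul_of_nonneg_left e2 (by positivity : 0 ≤ 16 * H.β)
  have e5 : 16 * H.β * (288 * N / H.B) + 45 / 2 * (24 * H.β * N / H.B) =
    5148 * (H.β / H.B) * N := by ring
  linarith

section
variable {Z : Type*} [MeasurableSpace Z] {L σ Δ : ℝ} {τ : ℕ} {Q : Kernel Z Z} {π : Measure Z}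
  {F : Vec d → Z → ℝ} {δ f : Vec d → ℝ} {xs : Vec d} {H : Hyper}

/-- Error added in one iteration. -/
noncomputable def stepError (d τ : ℕ) (L σ Δ : ℝ) (H : Hyper) : ℝ :=
  3 * H.β * (L * H.t ^ 2 / 2) / H.μ + H.β / H.μ ^ 2 *
    (5148 * (H.β / H.B) * baseVariance d τ L σ Δ H.t + 77 / 2 * (d * Δ / H.t) ^ 2)

/-- The pathwise level average is integrated and each squared error replaced by its mean bound. The
errors contain a multiple of the mean squared gradient, which the negative gradient term of the step
compensates. -/
theorem IsProblem.lintegral_potential_succ_le [IsMarkovKernel Q] [IsProbabilityMeasure π]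
    (ξ : Measure Z) [IsProbabilityMeasure ξ] (hd : 0 < d) (hτ : 0 < τ)
    (h : IsProblem L H.μ σ Δ τ Q π F δ f xs) (hσ : 0 ≤ σ) (hL : 0 ≤ L) (hp : 0 < H.p)
    (hp1 : H.p ≤ 1) (hμ : 0 < H.μ) (hγ : 0 < H.γ) (hLγ : L * H.γ ≤ 3 / 4) (ht : 0 < H.t)
    (hB : 0 < H.B) (hpB : 8 + 5148 * (d / H.B) ≤ 9 / (4 * H.p)) (x0 : Vec d) (k : ℕ) {b : ℝ}
    (hb : 0 ≤ b)
    (hk : ∫⁻ ω, ENNReal.ofReal (potential L H.μ H.t f xs (iter H F δ x0 k ω)) ∂sampleLaw d ξ Q ≤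
      ENNReal.ofReal b) :
    ∫⁻ ω, ENNReal.ofReal (potential L H.μ H.t f xs (iter H F δ x0 (k + 1) ω)) ∂sampleLaw d ξ Q ≤
      ENNReal.ofReal ((1 - H.β / 2) * b + stepError d τ L σ Δ H) := by
  have hP := isProbabilityMeasure_sampleLaw ξ Q hd
  set P := sampleLaw d ξ Q with hPdef
  have hβ := Hyper.β_pos hp hμ hγ
  have hμL := h.smooth.strongConvexity_le hd h.stronglyConvex
  have hβp : H.β ≤ H.p := Hyper.β_le_p hp ((mul_le_mul_of_nonneg_right hμL hγ.le).trans hLγ)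
  have hβ1 := hβp.trans hp1
  have hB' : (0 : ℝ) < H.B := by exact_mod_cast hB
  have hκ : 0 ≤ baseVariance d τ L σ Δ H.t := baseVariance_nonneg ..
  have hl : 0 < H.l := by
    rw [Hyper.l_eq]
    positivity
  have m0 (k : ℕ) := measurable_iter (d := d) H h.oracle.measurable h.perturbation_measurable x0 k
  have hpot (k : ℕ) : Measurable fun ω : Sample Z d =>
      potential L H.μ H.t f xs (iter H F δ x0 k ω) := by
    obtain ⟨m1, m2, m3⟩ := m0 k
    have := (h.smooth.measurable_smoothed H.t).comp m2
    exact ((m1.sub_const xs).norm.pow_const 2).add (((this.sub_const _).add_const _).const_mul _)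
  have hpot0 (s : State d) : 0 ≤ potential L H.μ H.t f xs s :=
    potential_nonneg h.smooth h.stronglyConvex hL hμ h.minimizer H.t s
  obtain ⟨m1, m2, m3⟩ := m0 k
  have mx : Measurable fun ω : Sample Z d => H.extrapolate (iter H F δ x0 k ω) :=
    (m2.const_smul H.θ).add (m1.const_smul (1 - H.θ))
  have hΦ : HasMeanLE P (fun ω => potential L H.μ H.t f xs (iter H F δ x0 k ω)) b :=
    HasMeanLE.of_lintegral_le (hpot k) (fun ω => hpot0 _) hb hk
  -- second moment of the gradient
  set Gsq : Sample Z d → ℝ := fun ω =>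
    ‖smoothGrad f H.t (H.extrapolate (iter H F δ x0 k ω))‖ ^ 2 with hGsq
  have mG : Measurable Gsq := ((h.smooth.measurable_smoothGrad H.t).comp mx).norm.pow_const 2
  have iG : Integrable Gsq P := by
    refine Integrable.mono' ((hΦ.1.const_mul (2 * L ^ 2 * (2 * H.θ ^ 2 + 2 * (1 - H.θ) ^ 2))).add
      (integrable_const (2 * (L * H.t) ^ 2))) mG.aestronglyMeasurable (Eventually.of_forall fun ω => ?_)
    rw [Real.norm_of_nonneg (sq_nonneg _)]
    exact norm_smoothGrad_extrapolate_sq_le h.smooth h.stronglyConvex hL hμ h.minimizer ht.le H _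
  set g := ∫ ω, Gsq ω ∂P with hg
  have hg0 : 0 ≤ g := integral_nonneg fun ω => sq_nonneg _
  -- second moments of the estimators
  set D : ℕ → Sample Z d → ℝ := fun i ω => ‖gRD (fun x z => F x z + δ x) H.t (2 ^ i * H.l)
      (H.extrapolate (iter H F δ x0 k ω)) (fun i => ω.1 ((iter H F δ x0 k ω).calls + i))
        (fun i => (ω.2.2 (k, i) : Vec d)) -
      meanGrad f δ H.t (H.extrapolate (iter H F δ x0 k ω))‖ ^ 2 with hD
  have hDE (i : ℕ) : HasMeanLE P (D i)
      (24 / (2 ^ i * H.l : ℕ) * (d * g + baseVariance d τ L σ Δ H.t)) := by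
    have mD : Measurable (D i) := by
      have := h.measurable_sample_gRD H.t (2 ^ i * H.l) k mx m3
      exact ((this.sub ((h.measurable_meanGrad hd H.t).comp mx)).norm).pow_const 2
    have hb : HasMeanLE P (fun ω => 24 / (2 ^ i * H.l : ℕ) * (d * Gsq ω + baseVariance d τ L σ Δ H.t))
        (24 / (2 ^ i * H.l : ℕ) * (d * g + baseVariance d τ L σ Δ H.t)) :=
      ((HasMeanLE.const_mul (X := Gsq) (a := g) ⟨iG, le_rfl⟩ (Nat.cast_nonneg d)).add
        (HasMeanLE.const _)).const_mul (by positivity)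
    refine HasMeanLE.of_lintegral_le mD (fun ω => sq_nonneg _) (by positivity) (le_trans ?_
      (hb.lintegral_le fun ω => by positivity))
    have hcalls (ω : Sample Z d) : (iter H F δ x0 k ω).calls =
      ∑ i ∈ Finset.range k, 2 * batchSize H.M H.l (ω.2.1 i) := run_calls _ _ _ _ _ _ _
    have := h.lintegral_sampleLaw_gRD_sub_sq_le ξ hd hτ hσ ht hL hμ.le
      (n := 2 ^ i * H.l) (by positivity) k mx
      (c := fun J => ∑ i ∈ Finset.range k, 2 * batchSize H.M H.l (J i))
      (Finset.measurable_sum _ fun i _ => ((measurable_of_countable (batchSize H.M H.l)).comp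
        (measurable_pi_apply i)).const_mul 2)
      (fun z J e e' he => congrArg H.extrapolate (run_congr_levels _ _ _ _ (fun _ _ => rfl)
        fun i hi => funext fun n => congrArg Subtype.val (he i n hi.ne)))
      (fun z z' J e hz => congrArg H.extrapolate (run_congr_path _ _ _ _ _ _ fun i hi =>
        hz i (by rwa [run_calls] at hi)))
    simpa only [hD, hcalls] using this
  -- averaging over the level
  have hcoef : 0 ≤ 1 - H.β / 2 := by linarith
  set U : Sample Z d → ℝ := fun ω => (1 - H.β / 2) * potential L H.μ H.t f xs (iter H F δ x0 k ω) +
    3 * H.β * (L * H.t ^ 2 / 2) / H.μ +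
        H.β / H.μ ^ 2 * (16 * H.β * (2 * D 0 ω + ∑ n ∈ Finset.range H.maxLevel,
            4 * 2 ^ (n + 1) * (D (n + 1) ω + D n ω)) + 45 / 2 * D H.maxLevel ω +
          77 / 2 * (d * Δ / H.t) ^ 2 - (9 * H.β / (4 * H.p) - 8 * H.β) * Gsq ω) with hU
  have hstep (ω : Sample Z d) : ∑ n ∈ Finset.range (H.maxLevel + 1), levelWeight H.maxLevel n *
        potential L H.μ H.t f xs (nextState H (fun x z => F x z + δ x) ω.1 (n + 1)
          (fun i => (ω.2.2 (k, i) : Vec d)) (iter H F δ x0 k ω)) ≤ U ω :=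
    h.sum_levelWeight_mul_potential_le hd hp hp1 hμ hγ hLγ ht ω.1 _ _ (fun i => D i ω) fun i => rfl
  -- U contains a negative term; it is nonnegative because it dominates an average of potentials.
  have hU0 : 0 ≤ U := fun ω => (Finset.sum_nonneg fun n _ =>
    mul_nonneg (levelWeight_nonneg _ _) (hpot0 _)).trans (hstep ω)
  have hlevel : ∫⁻ ω, ENNReal.ofReal (potential L H.μ H.t f xs (iter H F δ x0 (k + 1) ω)) ∂P ≤
      ∫⁻ ω, ENNReal.ofReal (U ω) ∂P := by
    rw [hPdef, lintegral_sampleLaw_update_level Q ξ hd k (hpot (k + 1)).ennreal_ofReal]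
    refine lintegral_mono fun ω => ?_
    have e1 (j : ℕ) : iter H F δ x0 (k + 1) (ω.1, Function.update ω.2.1 k j, ω.2.2) =
        nextState H (fun x z => F x z + δ x) ω.1 j (fun i => (ω.2.2 (k, i) : Vec d))
          (iter H F δ x0 k ω) := by
      rw [iter, run_succ]
      dsimp only
      rw [Function.update_self, run_congr_levels (J' := ω.2.1) H _ x0 ω.1
        (fun i hi => Function.update_of_ne hi.ne _ _) (fun _ _ => rfl)]
      rfl
    simp only [e1]
    rw [lintegral_levelLaw _ fun n hn => by
      rw [potential_nextState_congr hp hp1 _ _ _ _ n hn]]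
    simp only [← ENNReal.ofReal_mul (levelWeight_nonneg _ _)]
    rw [← ENNReal.ofReal_sum_of_nonneg fun n _ => mul_nonneg (levelWeight_nonneg _ _) (hpot0 _)]
    exact ENNReal.ofReal_le_ofReal (hstep ω)
  refine hlevel.trans (HasMeanLE.lintegral_le ?_ hU0)
  set N := d * g + baseVariance d τ L σ Δ H.t with hN
  have hW := ((((hDE 0).const_mul two_pos.le).add (HasMeanLE.sum (Finset.range H.maxLevel)
    fun n _ => ((hDE (n + 1)).add (hDE n)).const_mul (c := 4 * 2 ^ (n + 1))
      (by positivity))).const_mul (c := 16 * H.β) (by positivity)).add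
      ((hDE H.maxLevel).const_mul (c := 45 / 2) (by norm_num))
  have hGm : HasMeanLE P (fun ω => -((9 * H.β / (4 * H.p) - 8 * H.β) * Gsq ω))
      (-((9 * H.β / (4 * H.p) - 8 * H.β) * g)) :=
    ⟨(iG.const_mul _).neg, by rw [integral_neg, integral_const_mul]⟩
  have hUm := ((hΦ.const_mul hcoef).add (HasMeanLE.const (P := P)
    (3 * H.β * (L * H.t ^ 2 / 2) / H.μ))).add (((hW.add (HasMeanLE.const (P := P)
      (77 / 2 * (d * Δ / H.t) ^ 2))).add hGm).const_mul (c := H.β / H.μ ^ 2) (by positivity))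
  refine ⟨hUm.1.congr (Eventually.of_forall fun ω => by simp only [hU]; ring), ?_⟩
  have : ∫ ω, U ω ∂P ≤ _ := le_trans (le_of_eq (integral_congr_ae
    (Eventually.of_forall fun ω => by simp only [hU]; ring))) hUm.2
  refine this.trans ?_
  have hvar := H.sum_level_variance_le hp hp1 hμ hγ hB (N := N) (by positivity)
  rw [stepError, ← add_assoc]
  refine add_le_add_right ?_ _
  refine mul_le_mul_of_nonneg_left ?_ (by positivity)
  -- The condition `hpB` on p is used here: the factor 1/p outweighs both 8 and the d/B coming from
  -- the variance.
  have hcancel : 5148 * (H.β / H.B) * (d * g) ≤ (9 * H.β / (4 * H.p) - 8 * H.β) * g := by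
    have e1 := mul_le_mul_of_nonneg_left hpB (mul_nonneg hβ.le hg0)
    have e2 : H.β * g * (9 / (4 * H.p)) = 9 * H.β / (4 * H.p) * g := by ring
    have e3 : H.β * g * (8 + 5148 * (d / H.B)) =
      8 * H.β * g + 5148 * (H.β / H.B) * (d * g) := by ring
    linarith
  have e4 : 5148 * (H.β / H.B) * N = 5148 * (H.β / H.B) * (d * g) +
    5148 * (H.β / H.B) * baseVariance d τ L σ Δ H.t := by rw [hN]; ring
  linarith

/-- Geometric recursion whose fixed point is (2/β) · `stepError`. -/
theorem IsProblem.lintegral_potential_le [IsMarkovKernel Q] [IsProbabilityMeasure π]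
    (ξ : Measure Z) [IsProbabilityMeasure ξ] (hd : 0 < d) (hτ : 0 < τ)
    (h : IsProblem L H.μ σ Δ τ Q π F δ f xs) (hσ : 0 ≤ σ) (hL : 0 ≤ L) (hp : 0 < H.p)
    (hp1 : H.p ≤ 1) (hμ : 0 < H.μ) (hγ : 0 < H.γ) (hLγ : L * H.γ ≤ 3 / 4) (ht : 0 < H.t)
    (hB : 0 < H.B) (hpB : 8 + 5148 * (d / H.B) ≤ 9 / (4 * H.p)) (x0 : Vec d) (N : ℕ) :
    ∫⁻ ω, ENNReal.ofReal (potential L H.μ H.t f xs (iter H F δ x0 N ω)) ∂sampleLaw d ξ Q ≤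
      ENNReal.ofReal ((1 - H.β / 2) ^ N * potential L H.μ H.t f xs ⟨x0, x0, 0⟩ +
        2 / H.β * stepError d τ L σ Δ H) := by
  have hP := isProbabilityMeasure_sampleLaw ξ Q hd
  have hβ := Hyper.β_pos hp hμ hγ
  have hμL := h.smooth.strongConvexity_le hd h.stronglyConvex
  have hβp : H.β ≤ H.p := Hyper.β_le_p hp ((mul_le_mul_of_nonneg_right hμL hγ.le).trans hLγ)
  have hβ1 := hβp.trans hp1
  have hpot0 (s : State d) : 0 ≤ potential L H.μ H.t f xs s :=
    potential_nonneg h.smooth h.stronglyConvex hL hμ h.minimizer H.t s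
  have hκ : 0 ≤ baseVariance d τ L σ Δ H.t := baseVariance_nonneg ..
  have hK : 0 ≤ stepError d τ L σ Δ H := by
    unfold stepError
    positivity
  have hcoef : 0 ≤ 1 - H.β / 2 := by linarith
  induction N with
  | zero =>
    rw [pow_zero, one_mul]
    have (ω : Sample Z d) : iter H F δ x0 0 ω = ⟨x0, x0, 0⟩ := rfl
    simp only [this, lintegral_const, measure_univ, mul_one]
    exact ENNReal.ofReal_le_ofReal (le_add_of_nonneg_right (by positivity))
  | succ N ih =>
    refine (h.lintegral_potential_succ_le ξ hd hτ hσ hL hp hp1 hμ hγ hLγ ht hB hpB x0 N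
      (by have := hpot0 ⟨x0, x0, 0⟩; positivity) ih).trans (le_of_eq ?_)
    congr 1
    field_simp
    ring

end

/-! ### The error bound in closed form -/

theorem Real.rpow_three_halves_eq {x : ℝ} (hx : 0 ≤ x) : x ^ (3 / 2 : ℝ) = √x ^ 3 := by
  rw [Real.sqrt_eq_rpow, ← Real.rpow_natCast, ← Real.rpow_mul hx]
  norm_num

theorem Hyper.sqrt_rate_eq (H : Hyper) (N : ℕ) :
    √(H.p ^ 2 * H.μ * H.γ * N ^ 2 / 3) = N * (H.β / 2) := by
  rw [Hyper.β, show H.p ^ 2 * H.μ * H.γ * (N : ℝ) ^ 2 / 3 =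
    (N / 2 : ℝ) ^ 2 * (4 * H.p ^ 2 * H.μ * H.γ / 3) by ring, Real.sqrt_mul (sq_nonneg _),
    Real.sqrt_sq (by positivity)]
  ring

theorem Hyper.one_sub_β_pow_le {H : Hyper} (hβ1 : H.β ≤ 1) (N : ℕ) :
    (1 - H.β / 2) ^ N ≤ Real.exp (-√(H.p ^ 2 * H.μ * H.γ * N ^ 2 / 3)) := by
  rw [H.sqrt_rate_eq, neg_mul_eq_mul_neg, Real.exp_nat_mul]
  refine pow_le_pow_left₀ (by linarith) ?_ _
  have := Real.add_one_le_exp (-(H.β / 2))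
  linarith

/-- β is 2/√3 times p√(μγ), and 2/√3 ≤ 6/5. -/
theorem Hyper.β_div_sq_le {H : Hyper} (hp : 0 < H.p) (hμ : 0 < H.μ) (hγ : 0 < H.γ) :
    H.β / H.μ ^ 2 ≤ 6 / 5 * (H.p * √H.γ / H.μ ^ (3 / 2 : ℝ)) := by
  have hs := Real.sqrt_pos.2 hμ
  have hq := Real.sqrt_pos.2 hγ
  have h1 : H.β ≤ 6 / 5 * (H.p * √H.γ * √H.μ) := by
    refine abs_le_of_sq_le_sq' ?_ (by positivity) |>.2
    rw [Hyper.β_sq hμ hγ, mul_pow, mul_pow, mul_pow, Real.sq_sqrt hμ.le, Real.sq_sqrt hγ.le]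
    have : 0 ≤ H.p ^ 2 * H.γ * H.μ := by positivity
    linarith
  rw [Real.rpow_three_halves_eq hμ.le]
  have h2 : H.μ ^ 2 = √H.μ ^ 4 := by rw [← Real.sq_sqrt hμ.le]; simp only [Real.sqrt_sq hs.le]; ring
  rw [h2, div_le_iff₀ (by positivity)]
  refine h1.trans (le_of_eq ?_)
  field_simp

section
variable {Z : Type*} [MeasurableSpace Z] {L σ Δ : ℝ} {τ : ℕ} {Q : Kernel Z Z} {π : Measure Z}
  {F : Vec d → Z → ℝ} {δ f : Vec d → ℝ} {xs : Vec d} {H : Hyper}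

theorem two_div_mul_stepError_le (d τ : ℕ) (σ Δ : ℝ) (hp : 0 < H.p)
    (hμ : 0 < H.μ) (hγ : 0 < H.γ) (ht : 0 < H.t) (hB : 0 < H.B) (hβ1 : H.β ≤ 1) :
    2 / H.β * stepError d τ L σ Δ H ≤ 3 * (L * H.t ^ 2 / H.μ) +
      20000 * (H.p * √H.γ / H.μ ^ (3 / 2 : ℝ) * (σ ^ 2 * (d * (d + τ)) / (H.t ^ 2 * H.B) +
        H.t ^ 2 * (L ^ 2 * d ^ 2 / H.B))) + 20000 * (Δ ^ 2 * d ^ 2 / (H.μ ^ 2 * H.t ^ 2)) := by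
  have hβ := Hyper.β_pos hp hμ hγ
  have hB' : (1 : ℝ) ≤ H.B := by exact_mod_cast hB
  have hB0 : (0 : ℝ) < H.B := by linarith
  have h1 := Hyper.β_div_sq_le hp hμ hγ
  set A := H.p * √H.γ / H.μ ^ (3 / 2 : ℝ) with hA
  set K := σ ^ 2 * (d * (d + τ)) / (H.t ^ 2 * H.B) + H.t ^ 2 * (L ^ 2 * d ^ 2 / H.B) with hK
  have hK0 : 0 ≤ K := by positivity
  have hA0 : 0 ≤ A := by positivity
  set E := Δ ^ 2 * d ^ 2 / (H.μ ^ 2 * H.t ^ 2) with hE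
  have hE0 : 0 ≤ E := by positivity
  have e1 : 2 / H.β * stepError d τ L σ Δ H = 3 * (L * H.t ^ 2 / H.μ) +
      10296 * (H.β / H.μ ^ 2 * K) + (10296 * (H.β / H.B) + 77) * E := by
    rw [stepError, baseVariance, hK, hE]
    field_simp
    ring
  have e2 : H.β / H.μ ^ 2 * K ≤ 6 / 5 * A * K := mul_le_mul_of_nonneg_right h1 hK0
  have e3 : H.β / H.B ≤ 1 := (div_le_one hB0).2 (hβ1.trans hB')
  have e4 := mul_le_mul_of_nonneg_right e3 hE0
  have e5 := mul_nonneg hA0 hK0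
  rw [e1]
  linarith

theorem IsProblem.lintegral_potential_le_errBound [IsMarkovKernel Q] [IsProbabilityMeasure π]
    (ξ : Measure Z) [IsProbabilityMeasure ξ] (hd : 0 < d) (hτ : 0 < τ)
    (h : IsProblem L H.μ σ Δ τ Q π F δ f xs) (hσ : 0 ≤ σ) (hL : 0 ≤ L) (hp : 0 < H.p)
    (hp1 : H.p ≤ 1) (hμ : 0 < H.μ) (hγ : 0 < H.γ) (hLγ : L * H.γ ≤ 3 / 4) (ht : 0 < H.t)
    (hB : 0 < H.B) (hpB : 8 + 5148 * (d / H.B) ≤ 9 / (4 * H.p)) (x0 : Vec d) (N : ℕ) :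
    ∫⁻ ω, ENNReal.ofReal (potential L H.μ H.t f xs (iter H F δ x0 N ω)) ∂sampleLaw d ξ Q ≤
      ENNReal.ofReal (20000 * errBound d τ N L σ Δ (errR H.μ f xs ⟨x0, x0, 0⟩) H) := by
  have hμL := h.smooth.strongConvexity_le hd h.stronglyConvex
  have hβp : H.β ≤ H.p := Hyper.β_le_p hp ((mul_le_mul_of_nonneg_right hμL hγ.le).trans hLγ)
  have hβ := Hyper.β_pos hp hμ hγ
  have hβ1 := hβp.trans hp1
  refine (h.lintegral_potential_le ξ hd hτ hσ hL hp hp1 hμ hγ hLγ ht hB hpB x0 N).trans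
    (ENNReal.ofReal_le_ofReal ?_)
  set s : State d := ⟨x0, x0, 0⟩
  have h1 := two_div_mul_stepError_le (L := L) d τ σ Δ hp hμ hγ ht hB hβ1
  have h2 := Hyper.one_sub_β_pow_le hβ1 N
  have h3 := potential_le (xs := xs) h.smooth h.stronglyConvex hL hμ H.t s
  have h4 : (1 - H.β / 2) ^ N ≤ 1 := pow_le_one₀ (by linarith) (by linarith)
  have h5 : 0 ≤ (1 - H.β / 2) ^ N := pow_nonneg (by linarith) _
  have hr := errR_nonneg hμ h.minimizer s
  have h6 := mul_le_mul_of_nonneg_left h3 h5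
  have h7 := mul_le_mul_of_nonneg_right h2 hr
  have h8 : 0 ≤ L * H.t ^ 2 / H.μ := by positivity
  have h9 := mul_le_mul_of_nonneg_right h4 h8
  have h10 := mul_nonneg (Real.exp_pos (-√(H.p ^ 2 * H.μ * H.γ * N ^ 2 / 3))).le hr
  have e1 : (1 - H.β / 2) ^ N * (6 * errR H.μ f xs s + 6 / H.μ * (L * H.t ^ 2)) =
    6 * ((1 - H.β / 2) ^ N * errR H.μ f xs s) +
      6 * ((1 - H.β / 2) ^ N * (L * H.t ^ 2 / H.μ)) := by ring
  rw [errBound]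
  linarith

end

/-! ### Oracle calls -/

/-- An active level has probability inverse to its batch, so every one of the m + 1 classes of
levels costs at most l = (m+1)B on average. -/
theorem lintegral_batchSize_le {H : Hyper} (hp : 0 < H.p) (hp1 : H.p ≤ 1) :
    ∫⁻ j, (batchSize H.M H.l j : ENNReal) ∂levelLaw ≤
      ENNReal.ofReal (H.B * (H.maxLevel + 1) ^ 2) := by
  have hM := Hyper.one_le_M hp hp1
  have hb (j : ℕ) : batchSize H.M H.l j = if j ≤ H.maxLevel then 2 ^ j * H.l else H.l := by
    rw [batchSize]
    exact if_congr (two_pow_le_iff_le_floor hM j) rfl rfl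
  rw [lintegral_levelLaw (m := H.maxLevel) _ fun n hn => by
    rw [hb, hb, if_neg (by omega), if_neg (by omega)]]
  have e1 : ∀ n ∈ Finset.range (H.maxLevel + 1), ENNReal.ofReal (levelWeight H.maxLevel n) *
      (batchSize H.M H.l (n + 1) : ENNReal) ≤ ENNReal.ofReal H.l := by
    intro n hn
    rw [← ENNReal.ofReal_natCast (batchSize _ _ _), ← ENNReal.ofReal_mul (levelWeight_nonneg _ _)]
    refine ENNReal.ofReal_le_ofReal ?_
    rw [hb, levelWeight]
    by_cases hn' : n < H.maxLevel
    · rw [if_pos hn', if_pos (by omega)]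
      push_cast
      rw [← mul_assoc, ← mul_pow]
      norm_num
    · rw [if_neg hn', if_neg (by omega)]
      exact mul_le_of_le_one_left (Nat.cast_nonneg _) (pow_le_one₀ (by norm_num) (by norm_num))
  refine (Finset.sum_le_sum e1).trans (le_of_eq ?_)
  rw [Finset.sum_const, Finset.card_range, nsmul_eq_mul, ← ENNReal.ofReal_natCast,
    ← ENNReal.ofReal_mul (Nat.cast_nonneg _), Hyper.l_eq]
  congr 1
  push_cast
  ring

theorem lintegral_calls_le {Z : Type*} [MeasurableSpace Z] {H : Hyper} (hp : 0 < H.p)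
    (hp1 : H.p ≤ 1) (hd : 0 < d) (ξ : Measure Z) [IsProbabilityMeasure ξ] (Q : Kernel Z Z)
    [IsMarkovKernel Q] (F : Vec d → Z → ℝ) (δ : Vec d → ℝ) (x0 : Vec d) (N : ℕ) :
    ∫⁻ ω, ((iter H F δ x0 N ω).calls : ENNReal) ∂sampleLaw d ξ Q ≤
      ENNReal.ofReal (N * (2 * (H.B * (H.maxLevel + 1) ^ 2))) := by
  have := isProbabilityMeasure_sphereLaw hd
  have hmp (i : ℕ) : MeasurePreserving (fun ω : Sample Z d => ω.2.1 i) (sampleLaw d ξ Q) levelLaw :=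
    (measurePreserving_eval_infinitePi (fun _ : ℕ => levelLaw) i).comp
      (measurePreserving_fst.comp measurePreserving_snd)
  have hb : Measurable fun j => (batchSize H.M H.l j : ENNReal) := measurable_of_countable _
  have hbi (i : ℕ) : Measurable fun ω : Sample Z d => (batchSize H.M H.l (ω.2.1 i) : ENNReal) :=
    hb.comp (hmp i).measurable
  have h1 (ω : Sample Z d) : ((iter H F δ x0 N ω).calls : ENNReal) =
      ∑ i ∈ Finset.range N, 2 * (batchSize H.M H.l (ω.2.1 i) : ENNReal) := by
    rw [iter, run_calls]
    push_cast
    rfl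
  simp only [h1]
  rw [lintegral_finsetSum _ fun i _ => (hbi i).const_mul 2]
  have h2 (i : ℕ) : ∫⁻ ω, 2 * (batchSize H.M H.l (ω.2.1 i) : ENNReal) ∂sampleLaw d ξ Q ≤
      ENNReal.ofReal (2 * (H.B * (H.maxLevel + 1) ^ 2)) := by
    rw [lintegral_const_mul _ (hbi i), (hmp i).lintegral_comp hb,
      ENNReal.ofReal_mul two_pos.le, ENNReal.ofReal_ofNat]
    gcongr
    exact lintegral_batchSize_le hp hp1
  refine (Finset.sum_le_sum fun i _ => h2 i).trans (le_of_eq ?_)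
  rw [Finset.sum_const, Finset.card_range, nsmul_eq_mul, ← ENNReal.ofReal_natCast,
    ← ENNReal.ofReal_mul (Nat.cast_nonneg _)]

/-- Requirements on the accuracy `ε` which hold once `ε` is small. -/
theorem exists_accuracy_threshold {q a b κ r v : ℝ} (hq : 0 < q) (ha : 0 ≤ a) (hb : 0 < b) :
    ∃ ε₀ : ℝ, 0 < ε₀ ∧ ∀ ε : ℝ, 0 < ε → ε < ε₀ →
      1 ≤ Real.log (1 / ε) ∧ v ≤ Real.log (1 / ε) ∧
      1 ≤ Real.log (q * Real.log (1 / ε) + a / (b * ε ^ 2)) ∧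
      κ ≤ q * Real.log (q * Real.log (1 / ε) + a / (b * ε ^ 2)) ∧
      κ ≤ q * Real.log (1 / ε) + a / (b * ε ^ 2) ∧
      r ≤ q * Real.log (1 / ε) + a / (b * ε ^ 2) ∧
      a / (b * ε ^ 2) * Real.log (1 / ε) ≤ (q * Real.log (1 / ε) + a / (b * ε ^ 2)) *
        Real.log (q * Real.log (1 / ε) + a / (b * ε ^ 2)) := by
  have hl : Tendsto (fun ε : ℝ => Real.log (1 / ε)) (𝓝[>] 0) atTop := by
    simp only [one_div, Real.log_inv]
    exact tendsto_neg_atBot_atTop.comp Real.tendsto_log_nhdsGT_zero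
  have hS : Tendsto (fun ε : ℝ => q * Real.log (1 / ε) + a / (b * ε ^ 2)) (𝓝[>] 0) atTop :=
    tendsto_atTop_mono (fun ε => le_add_of_nonneg_right (by positivity)) (hl.const_mul_atTop hq)
  have hX := Real.tendsto_log_atTop.comp hS
  -- With noise, ε ≤ a/b gives 1/ε ≤ a/(bε²) ≤ S, so log(1/ε) ≤ log S; without noise the product to
  -- be bounded is zero.
  have hlast : ∀ᶠ ε : ℝ in 𝓝[>] 0, a = 0 ∨ ε ≤ a / b := by
    rcases ha.eq_or_lt with h | h
    · exact Eventually.of_forall fun _ => Or.inl h.symm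
    · exact ((eventually_le_nhds (div_pos h hb)).filter_mono nhdsWithin_le_nhds).mono
        fun _ => Or.inr
  have hev := (hl.eventually_ge_atTop 1).and ((hl.eventually_ge_atTop v).and
    ((hX.eventually_ge_atTop 1).and ((hX.eventually_ge_atTop (κ / q)).and
      ((hS.eventually_ge_atTop κ).and ((hS.eventually_ge_atTop r).and hlast)))))
  obtain ⟨ε₀, h0, hsub⟩ := mem_nhdsGT_iff_exists_Ioo_subset.1 hev
  refine ⟨ε₀, h0, fun ε he he' => ?_⟩
  obtain ⟨h1, h2, h3, h4, h5, h6, h7⟩ := hsub ⟨he, he'⟩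
  simp only [Function.comp] at h3 h4
  refine ⟨h1, h2, h3, ?_, h5, h6, ?_⟩
  · rwa [div_le_iff₀' hq] at h4
  set T := q * Real.log (1 / ε) + a / (b * ε ^ 2) with hT
  have hT1 : a / (b * ε ^ 2) ≤ T := le_add_of_nonneg_left (by positivity)
  have ha0 : 0 ≤ a / (b * ε ^ 2) := by positivity
  rcases h7 with h7 | h7
  · rw [h7, zero_div, zero_mul]
    exact mul_nonneg (ha0.trans hT1) (by linarith)
  · have h8 : 1 / ε ≤ T := by
      refine le_trans ?_ hT1
      rw [div_le_div_iff₀ he (by positivity)]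
      rw [le_div_iff₀ hb] at h7
      have := mul_le_mul_of_nonneg_left h7 he.le
      linarith
    exact mul_le_mul hT1 (Real.log_le_log (by positivity) h8) (by linarith) (ha0.trans hT1)

/-- Expected number of calls in terms of the rate. -/
theorem iterations_mul_calls_le {A q s κ ℓ ℓ' S r nb : ℝ} (hA : 1 ≤ A) (hs : 0 ≤ s)
    (hκ0 : 0 ≤ κ) (hr0 : 1 ≤ r) (hnb0 : 0 ≤ nb) (hnb : nb ≤ A * (q + s + κ)) (hℓ : 1 ≤ ℓ)
    (hℓ' : ℓ' ≤ 2 * ℓ) (hq : 0 ≤ q) (hS : S = q * ℓ + s) (hX : 1 ≤ Real.log S)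
    (hκX : κ ≤ q * Real.log S) (hκS : κ ≤ S) (hr : r ≤ S) (hsX : s * ℓ ≤ S * Real.log S)
    (hℓ0 : 0 ≤ ℓ') :
    ⌈nb * ℓ'⌉₊ * (2 * ((⌊Real.logb 2 (r + nb)⌋₊ : ℝ) + 1) ^ 2) ≤
      14 * A * (2 * Real.log (4 * A) + 3) ^ 2 * Real.log S ^ 3 * S := by
  set X := Real.log S with hXdef
  have hS1 : 1 ≤ S := hr0.trans hr
  have hS0 : 0 < S := by linarith
  have hqS : q * ℓ ≤ S := by linarith
  have hsS : s ≤ S := by nlinarith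
  have hqS' : q ≤ S := by nlinarith
  have hSX : S ≤ S * X := le_mul_of_one_le_right hS0.le hX
  have hAS : 1 ≤ A * (S * X) := by nlinarith
  have hlA : 0 ≤ Real.log (4 * A) := Real.log_nonneg (by linarith)
  have hN : (⌈nb * ℓ'⌉₊ : ℝ) ≤ 7 * A * S * X := by
    have h1 : (⌈nb * ℓ'⌉₊ : ℝ) ≤ nb * ℓ' + 1 := (Nat.ceil_lt_add_one (by positivity)).le
    have h2 : nb * ℓ' ≤ A * (q + s + κ) * (2 * ℓ) :=
      mul_le_mul hnb hℓ' hℓ0 (by positivity)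
    -- κ is not part of the rate; for small ε it is dominated by q log S, which costs one logarithm.
    have h3 : κ * ℓ ≤ S * X := by
      calc κ * ℓ ≤ q * X * ℓ := by gcongr
        _ = q * ℓ * X := by ring
        _ ≤ S * X := by gcongr
    have h4 : (q + s + κ) * ℓ ≤ 3 * (S * X) := by linarith
    have h5 : A * (q + s + κ) * (2 * ℓ) ≤ 6 * (A * (S * X)) := by
      have := mul_le_mul_of_nonneg_left h4 (by linarith : 0 ≤ 2 * A)
      linarith
    linarith
  -- r + nb is the limit M, polynomial in S here, so the number of levels is at most a constant
  -- times log S.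
  have hj : (⌊Real.logb 2 (r + nb)⌋₊ : ℝ) + 1 ≤ (2 * Real.log (4 * A) + 3) * X := by
    have hM1 : 1 ≤ r + nb := by linarith
    have h1 : (⌊Real.logb 2 (r + nb)⌋₊ : ℝ) ≤ Real.logb 2 (r + nb) :=
      Nat.floor_le (Real.logb_nonneg (by norm_num) hM1)
    have h2 : r + nb ≤ 4 * A * S := by
      have : A * (q + s + κ) ≤ A * (3 * S) := by gcongr; linarith
      have : S ≤ A * S := le_mul_of_one_le_left hS0.le hA
      linarith
    have h3 : Real.log (r + nb) ≤ Real.log (4 * A) + X := by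
      rw [hXdef, ← Real.log_mul (by positivity) hS0.ne']
      exact Real.log_le_log (by linarith) h2
    have h4 : Real.logb 2 (r + nb) ≤ 2 * Real.log (r + nb) := by
      have := Real.log_two_gt_d9
      have h0 := Real.log_nonneg hM1
      rw [Real.logb, div_le_iff₀ (by linarith)]
      nlinarith
    have h5 := mul_le_mul_of_nonneg_left hX hlA
    linarith
  calc ⌈nb * ℓ'⌉₊ * (2 * ((⌊Real.logb 2 (r + nb)⌋₊ : ℝ) + 1) ^ 2) ≤
        7 * A * S * X * (2 * ((2 * Real.log (4 * A) + 3) * X) ^ 2) := by gcongr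
    _ = _ := by ring

/-! ### Choice of parameters for a target accuracy -/

/-- Step size for target accuracy `ε`. -/
noncomputable def targetStep (L μ ε C p K : ℝ) : ℝ :=
  min √(3 / (4 * L)) (ε * μ ^ (3 / 2 : ℝ) / (4 * C * p * K)) ^ 2

section
variable {L μ ε C p K : ℝ}

theorem targetStep_pos (hL : 0 < L) (hμ : 0 < μ) (hε : 0 < ε) (hC : 0 < C) (hp : 0 < p)
    (hK : 0 < K) : 0 < targetStep L μ ε C p K := by
  have h1 : 0 < √(3 / (4 * L)) := Real.sqrt_pos.2 (by positivity)
  have h2 := Real.rpow_pos_of_pos hμ (3 / 2)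
  have : 0 < min √(3 / (4 * L)) (ε * μ ^ (3 / 2 : ℝ) / (4 * C * p * K)) := lt_min h1 (by positivity)
  unfold targetStep
  positivity

theorem sqrt_targetStep (hμ : 0 ≤ μ) (hε : 0 ≤ ε) (hC : 0 ≤ C) (hp : 0 ≤ p)
    (hK : 0 ≤ K) : √(targetStep L μ ε C p K) =
      min √(3 / (4 * L)) (ε * μ ^ (3 / 2 : ℝ) / (4 * C * p * K)) := by
  have h2 := Real.rpow_nonneg hμ (3 / 2)
  exact Real.sqrt_sq (le_min (Real.sqrt_nonneg _) (by positivity))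

theorem targetStep_le (hL : 0 ≤ L) (hμ : 0 ≤ μ) (hε : 0 ≤ ε) (hC : 0 ≤ C) (hp : 0 ≤ p)
    (hK : 0 ≤ K) : targetStep L μ ε C p K ≤ 3 / (4 * L) := by
  have h2 := Real.rpow_nonneg hμ (3 / 2)
  calc targetStep L μ ε C p K ≤ √(3 / (4 * L)) ^ 2 :=
        pow_le_pow_left₀ (le_min (Real.sqrt_nonneg _) (by positivity)) (min_le_left _ _) 2
    _ = _ := Real.sq_sqrt (by positivity)

/-- The second entry of the minimum is the value of √γ for which equality holds. -/
theorem mul_sqrt_targetStep_le (hμ : 0 < μ) (hε : 0 ≤ ε) (hC : 0 < C) (hp : 0 < p)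
    (hK : 0 < K) :
    p * √(targetStep L μ ε C p K) / μ ^ (3 / 2 : ℝ) * K ≤ ε / (4 * C) := by
  have h2 := Real.rpow_pos_of_pos hμ (3 / 2)
  rw [sqrt_targetStep hμ.le hε hC.le hp.le hK.le]
  have h3 := min_le_right √(3 / (4 * L)) (ε * μ ^ (3 / 2 : ℝ) / (4 * C * p * K))
  calc p * min √(3 / (4 * L)) (ε * μ ^ (3 / 2 : ℝ) / (4 * C * p * K)) / μ ^ (3 / 2 : ℝ) * K ≤
        p * (ε * μ ^ (3 / 2 : ℝ) / (4 * C * p * K)) / μ ^ (3 / 2 : ℝ) * K := by gcongr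
    _ = ε / (4 * C) := by field_simp

/-- The reciprocal of a minimum is at most the sum of the reciprocals: the first gives the
deterministic rate, the second the statistical one. The constant 7 bounds 4√3. -/
theorem two_div_β_targetStep_le {H : Hyper} (hL : 0 < L) (hμ : 0 < H.μ) (hε : 0 < ε) (hC : 0 < C)
    (hp : 0 < H.p) (hK : 0 < K) (hγ : H.γ = targetStep L H.μ ε C H.p K) :
    2 / H.β ≤ 2 / H.p * √(L / H.μ) + 7 * C * (K / (ε * H.μ ^ 2)) := by
  have hs := Real.sqrt_pos.2 hμ
  have hsL := Real.sqrt_pos.2 hL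
  have h3 : √3 ≤ 7 / 4 := Real.sqrt_le_iff.2 ⟨by norm_num, by norm_num⟩
  have h30 : 0 < √3 := Real.sqrt_pos.2 (by norm_num)
  have hq := sqrt_targetStep (L := L) hμ.le hε.le hC.le hp.le hK.le
  rw [← hγ, Real.rpow_three_halves_eq hμ.le] at hq
  have hγ0 : 0 < H.γ := hγ ▸ targetStep_pos hL hμ hε hC hp hK
  have hg := Real.sqrt_pos.2 hγ0
  have e1 : 2 / H.β = √3 / (H.p * √H.μ) * (1 / √H.γ) := by
    rw [Hyper.β, show 4 * H.p ^ 2 * H.μ * H.γ / 3 = (2 * H.p) ^ 2 * (H.μ * H.γ) / 3 by ring,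
      Real.sqrt_div (by positivity), Real.sqrt_mul (by positivity), Real.sqrt_sq (by positivity),
      Real.sqrt_mul hμ.le]
    field_simp
  have e2 : √(3 / (4 * L)) = √3 / (2 * √L) := by
    rw [Real.sqrt_div (by norm_num), Real.sqrt_mul (by norm_num),
      show (4 : ℝ) = 2 ^ 2 by norm_num, Real.sqrt_sq (by norm_num)]
  have h4 : 1 / √H.γ ≤ 2 * √L / √3 + 4 * C * H.p * K / (ε * √H.μ ^ 3) := by
    rw [hq, e2]
    rcases min_cases (√3 / (2 * √L)) (ε * √H.μ ^ 3 / (4 * C * H.p * K)) with h | h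
    · rw [h.1, one_div_div]
      exact le_add_of_nonneg_right (by positivity)
    · rw [h.1, one_div_div]
      exact le_add_of_nonneg_left (by positivity)
  have e3 : √3 / (H.p * √H.μ) * (2 * √L / √3 + 4 * C * H.p * K / (ε * √H.μ ^ 3)) =
      2 / H.p * (√L / √H.μ) + √3 * (4 * C * (K / (ε * (√H.μ ^ 2) ^ 2))) := by
    field_simp
  rw [Real.sq_sqrt hμ.le, ← Real.sqrt_div hL.le] at e3
  rw [e1]
  refine (mul_le_mul_of_nonneg_left h4 (by positivity)).trans ?_
  rw [e3]
  have h5 : 0 ≤ 4 * C * (K / (ε * H.μ ^ 2)) := by positivity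
  have := mul_le_mul_of_nonneg_right h3 h5
  linarith

end

theorem Hyper.inv_p_ofScale (μ γ t : ℝ) (d : ℕ) {B : ℕ} (hB : 0 < B) :
    1 / (Hyper.ofScale (1 / 2500) μ γ t d B).p = 2500 * (1 + d / B) := by
  have hB' : (0 : ℝ) < B := by exact_mod_cast hB
  rw [Hyper.ofScale]
  field_simp

theorem Hyper.p_ofScale_pos (μ γ t : ℝ) (d : ℕ) {B : ℕ} (hB : 0 < B) :
    0 < (Hyper.ofScale (1 / 2500) μ γ t d B).p := by
  have hB' : (0 : ℝ) < B := by exact_mod_cast hB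
  rw [Hyper.ofScale]
  positivity

theorem Hyper.p_ofScale_le_one (μ γ t : ℝ) (d : ℕ) {B : ℕ} (hB : 0 < B) :
    (Hyper.ofScale (1 / 2500) μ γ t d B).p ≤ 1 := by
  have h1 := inv_p_ofScale μ γ t d hB
  have h2 := p_ofScale_pos μ γ t d hB
  have h3 : (0 : ℝ) ≤ d / B := by positivity
  rw [← one_div_one_div (Hyper.ofScale _ _ _ _ _ _).p, h1, div_le_one (by positivity)]
  linarith

/-- The reason for c₁ = 1/2500: (9/4) · 2500 = 5625 exceeds 5148. -/
theorem Hyper.p_ofScale_small (μ γ t : ℝ) (d : ℕ) {B : ℕ} (hB : 0 < B) :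
    8 + 5148 * ((d : ℝ) / B) ≤ 9 / (4 * (Hyper.ofScale (1 / 2500) μ γ t d B).p) := by
  have h1 := inv_p_ofScale μ γ t d hB
  have h3 : (0 : ℝ) ≤ d / B := by positivity
  have : 9 / (4 * (Hyper.ofScale (1 / 2500) μ γ t d B).p) =
      9 / 4 * (1 / (Hyper.ofScale (1 / 2500) μ γ t d B).p) := by
    rw [div_mul_div_comm, mul_one]
  rw [this, h1]
  linarith

/-- Each of the four terms is at most ε/(4C): by the choice of N, of γ, by the tolerance on Δ, and
by the choice of t respectively. -/
theorem errBound_le {H : Hyper} {τ N : ℕ} {L σ Δ r0 R ε C : ℝ} (hd : 0 < d) (hL : 0 < L) (hμ : 0 < H.μ)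
    (hp : 0 < H.p) (hγ : 0 < H.γ) (hε : 0 < ε) (hC : 0 < C) (hR : 0 < R) (hr : r0 ≤ R)
    (hN : 2 / H.β * Real.log (4 * C * R / ε) ≤ N)
    (ht : H.t ^ 2 = ε * H.μ / (4 * C * L))
    (hvar : H.p * √H.γ / H.μ ^ (3 / 2 : ℝ) * (σ ^ 2 * (d * (d + τ)) / (H.t ^ 2 * H.B) +
      H.t ^ 2 * (L ^ 2 * d ^ 2 / H.B)) ≤ ε / (4 * C))
    (hΔ0 : 0 ≤ Δ) (hΔ : Δ ≤ 1 / (4 * C) * (ε * H.μ ^ (3 / 2 : ℝ) / (d * √L))) :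
    errBound d τ N L σ Δ r0 H ≤ ε / C := by
  have hβ := Hyper.β_pos hp hμ hγ
  have hd' : (0 : ℝ) < d := by exact_mod_cast hd
  have hs := Real.sqrt_pos.2 hL
  have hexp : Real.exp (-√(H.p ^ 2 * H.μ * H.γ * N ^ 2 / 3)) * r0 ≤ ε / (4 * C) := by
    have h1 : Real.log (4 * C * R / ε) ≤ N * (H.β / 2) := by
      have := mul_le_mul_of_nonneg_right hN (by positivity : 0 ≤ H.β / 2)
      rwa [mul_right_comm, div_mul_div_cancel₀ hβ.ne', div_self two_ne_zero, one_mul] at this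
    have h2 : Real.exp (-√(H.p ^ 2 * H.μ * H.γ * N ^ 2 / 3)) ≤ (4 * C * R / ε)⁻¹ := by
      rw [H.sqrt_rate_eq, ← Real.exp_log (by positivity : 0 < (4 * C * R / ε)⁻¹), Real.log_inv]
      exact Real.exp_le_exp.2 (neg_le_neg h1)
    calc _ ≤ Real.exp (-√(H.p ^ 2 * H.μ * H.γ * N ^ 2 / 3)) * R := by gcongr
      _ ≤ (4 * C * R / ε)⁻¹ * R := by gcongr
      _ = ε / (4 * C) := by field_simp
  have hlast : L * H.t ^ 2 / H.μ = ε / (4 * C) := by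
    rw [ht]
    field_simp
  have hpert : Δ ^ 2 * d ^ 2 / (H.μ ^ 2 * H.t ^ 2) ≤ ε / (4 * C) := by
    have h3 : (H.μ ^ (3 / 2 : ℝ)) ^ 2 = H.μ ^ 3 := by
      rw [Real.rpow_three_halves_eq hμ.le, ← pow_mul, mul_comm, pow_mul, Real.sq_sqrt hμ.le]
    rw [ht]
    calc Δ ^ 2 * d ^ 2 / (H.μ ^ 2 * (ε * H.μ / (4 * C * L))) ≤
        (1 / (4 * C) * (ε * H.μ ^ (3 / 2 : ℝ) / (d * √L))) ^ 2 * d ^ 2 /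
          (H.μ ^ 2 * (ε * H.μ / (4 * C * L))) := by gcongr
      _ = (1 / (4 * C)) ^ 2 * (ε ^ 2 * (H.μ ^ (3 / 2 : ℝ)) ^ 2 / (d ^ 2 * √L ^ 2)) * d ^ 2 /
          (H.μ ^ 2 * (ε * H.μ / (4 * C * L))) := by
        rw [mul_pow (1 / (4 * C)), div_pow (ε * _), mul_pow ε, mul_pow (d : ℝ)]
      _ = ε / (4 * C) := by
        rw [h3, Real.sq_sqrt hL.le]
        field_simp
  have e : ε / C = ε / (4 * C) + ε / (4 * C) + ε / (4 * C) + ε / (4 * C) := by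
    field_simp
    norm_num
  rw [errBound, e]
  linarith

/-- Supplies a bound independent of f, so that N can be fixed before the problem; the added 1 keeps
it positive when R = 0. -/
theorem errR_initial_le {L μ R : ℝ} {f : Vec d → ℝ} {xs x0 : Vec d} (hf : IsLSmooth L f)
    (hL : 0 ≤ L) (hμ : 0 < μ) (hmin : ∀ x, f xs ≤ f x) (hx : ‖x0 - xs‖ ≤ R) :
    errR μ f xs ⟨x0, x0, 0⟩ ≤ (L / (2 * μ) + 1) * R ^ 2 + 1 := by
  have h1 := hf.upper xs x0
  rw [gradient_eq_zero_of_forall_le hmin, inner_zero_left, add_zero] at h1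
  have h2 : ‖x0 - xs‖ ^ 2 ≤ R ^ 2 := pow_le_pow_left₀ (norm_nonneg _) hx 2
  have h3 : 1 / μ * (f x0 - f xs) ≤ 1 / μ * (L / 2 * R ^ 2) := by
    gcongr
    have := mul_le_mul_of_nonneg_left h2 (by positivity : 0 ≤ L / 2)
    linarith
  have e : (L / (2 * μ) + 1) * R ^ 2 + 1 = 1 / μ * (L / 2 * R ^ 2) + R ^ 2 + 1 := by
    field_simp
  rw [errR, e]
  dsimp only
  linarith

theorem sq_norm_le_errR {μ : ℝ} {f : Vec d → ℝ} {xs : Vec d} (hμ : 0 < μ)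
    (hmin : ∀ x, f xs ≤ f x) (s : State d) : ‖s.x - xs‖ ^ 2 ≤ errR μ f xs s := by
  have := sub_nonneg.2 (hmin s.xf)
  unfold errR
  exact le_add_of_nonneg_left (by positivity)

/-- With t² proportional to ε the noise part of the variance is of order 1/ε, giving 1/ε² after
division by ε, while the smoothing part is of order ε and leaves the ε-free term Ld²/(μB). -/
theorem two_div_β_ofScale_le {τ B : ℕ} {L μ σ ε t γ C : ℝ} (hd : 0 < d) (hB : 0 < B) (hL : 0 < L)
    (hμ : 0 < μ) (hε : 0 < ε) (hC : 20000 ≤ C) (ht : t ^ 2 = ε * μ / (4 * C * L))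
    (hγ : γ = targetStep L μ ε C (Hyper.ofScale (1 / 2500) μ γ t d B).p
      (σ ^ 2 * (d * (d + τ)) / (t ^ 2 * B) + t ^ 2 * (L ^ 2 * d ^ 2 / B))) :
    2 / (Hyper.ofScale (1 / 2500) μ γ t d B).β ≤ 28 * C ^ 2 * (max 1 ((d : ℝ) / B) * √(L / μ) +
      L * d * (d + τ) * σ ^ 2 / (B * μ ^ 3 * ε ^ 2) + L * d ^ 2 / (μ * B)) := by
  have hd' : (0 : ℝ) < d := by exact_mod_cast hd
  have hB' : (0 : ℝ) < B := by exact_mod_cast hB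
  have hC0 : 0 < C := by linarith
  have hp := Hyper.p_ofScale_pos μ γ t d hB
  have ht0 : 0 < t ^ 2 := ht ▸ by positivity
  have h1 := two_div_β_targetStep_le (H := Hyper.ofScale (1 / 2500) μ γ t d B) hL hμ hε hC0 hp
    (by positivity) hγ
  refine h1.trans ?_
  change _ * √(L / μ) + 7 * C * (_ / (ε * μ ^ 2)) ≤ _
  have e1 : (σ ^ 2 * (d * (d + τ)) / (t ^ 2 * B) + t ^ 2 * (L ^ 2 * d ^ 2 / B)) / (ε * μ ^ 2) =
      4 * C * (L * d * (d + τ) * σ ^ 2 / (B * μ ^ 3 * ε ^ 2)) +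
        L * d ^ 2 / (μ * B) / (4 * C) := by
    rw [ht]
    field_simp
  have e2 : 2 / (Hyper.ofScale (1 / 2500) μ γ t d B).p = 2 * (2500 * (1 + d / B)) := by
    rw [← Hyper.inv_p_ofScale μ γ t d hB, mul_one_div]
  rw [e1, e2]
  set s := L * d * (d + τ) * σ ^ 2 / (B * μ ^ 3 * ε ^ 2)
  set κ := L * d ^ 2 / (μ * B)
  have hκ : 0 ≤ κ := by positivity
  have e3 : 7 * C * (4 * C * s + κ / (4 * C)) = 28 * C ^ 2 * s + 7 / 4 * κ := by
    field_simp
    ring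
  have h2 : 2 * (2500 * (1 + (d : ℝ) / B)) * √(L / μ) ≤
      28 * C ^ 2 * (max 1 ((d : ℝ) / B) * √(L / μ)) := by
    rw [← mul_assoc (28 * C ^ 2)]
    refine mul_le_mul_of_nonneg_right ?_ (Real.sqrt_nonneg _)
    have h3 := le_max_left 1 ((d : ℝ) / B)
    have h4 := le_max_right 1 ((d : ℝ) / B)
    have h5 : 10000 * max 1 ((d : ℝ) / B) ≤ 28 * C ^ 2 * max 1 ((d : ℝ) / B) := by
      gcongr
      nlinarith
    linarith
  have h3 : 7 / 4 * κ ≤ 28 * C ^ 2 * κ := by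
    gcongr
    nlinarith
  rw [e3]
  linarith

/-- One-point smooth upper bound. The constants `c₁`, `c₂`, `C` and the polynomial `P` hidden in
`Õ` are universal. First part: error bound for every stepsize, approximation step, batch size
multiplier and number of iterations. Second part: oracle complexity; here `γ, t, N` depend only on
`d, τ, L, μ, σ, R, B, ε`, and the bound holds once `ε` is small. -/
theorem theorem1 :
    ∃ (c₁ c₂ C : ℝ) (P : Polynomial ℝ), 0 < c₁ ∧ c₁ ≤ 1 ∧ 0 < c₂ ∧ 0 < C ∧
      (∀ (d τ B N : ℕ) (L μ σ Δ γ t : ℝ), 0 < d → 0 < τ → 0 < B → 0 < L → 0 < μ → 0 ≤ σ →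
        0 ≤ Δ → 0 < γ → γ ≤ 3 / (4 * L) → 0 < t →
        ∀ (Z : Type*) [MeasurableSpace Z] (Q : Kernel Z Z) [IsMarkovKernel Q]
          (π ξ : Measure Z) [IsProbabilityMeasure π] [IsProbabilityMeasure ξ]
          (F : Vec d → Z → ℝ) (δ f : Vec d → ℝ) (xs x0 : Vec d),
          IsProblem L μ σ Δ τ Q π F δ f xs →
          ∫⁻ ω, ENNReal.ofReal (errR μ f xs (iter (Hyper.ofScale c₁ μ γ t d B) F δ x0 N ω))
              ∂(sampleLaw d ξ Q) ≤
            ENNReal.ofReal (C * errBound d τ N L σ Δ (errR μ f xs ⟨x0, x0, 0⟩)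
              (Hyper.ofScale c₁ μ γ t d B))) ∧
      (∀ (d τ B : ℕ) (L μ σ R : ℝ), 0 < d → 0 < τ → 0 < B → 0 < L → 0 < μ → 0 ≤ σ → 0 ≤ R →
        ∃ ε₀ : ℝ, 0 < ε₀ ∧ ∀ ε : ℝ, 0 < ε → ε < ε₀ →
          ∃ (γ t : ℝ) (N : ℕ), 0 < γ ∧ γ ≤ 3 / (4 * L) ∧ 0 < t ∧
            ∀ (Z : Type*) [MeasurableSpace Z] (Q : Kernel Z Z) [IsMarkovKernel Q]
              (π ξ : Measure Z) [IsProbabilityMeasure π] [IsProbabilityMeasure ξ]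
              (F : Vec d → Z → ℝ) (δ f : Vec d → ℝ) (xs x0 : Vec d) (Δ : ℝ),
              IsProblem L μ σ Δ τ Q π F δ f xs → ‖x0 - xs‖ ≤ R →
              Δ ≤ c₂ * (ε * μ ^ (3 / 2 : ℝ) / (d * Real.sqrt L)) →
              ∫⁻ ω, ENNReal.ofReal (‖(iter (Hyper.ofScale c₁ μ γ t d B) F δ x0 N ω).x - xs‖ ^ 2)
                  ∂(sampleLaw d ξ Q) ≤ ENNReal.ofReal ε ∧
              ∫⁻ ω, ENNReal.ofReal (errR μ f xs (iter (Hyper.ofScale c₁ μ γ t d B) F δ x0 N ω))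
                  ∂(sampleLaw d ξ Q) ≤ ENNReal.ofReal ε ∧
              ∫⁻ ω, ((iter (Hyper.ofScale c₁ μ γ t d B) F δ x0 N ω).calls : ENNReal)
                  ∂(sampleLaw d ξ Q) ≤ ENNReal.ofReal
                      (B * (P.eval (Real.log (rateS d B τ L μ σ ε)) * rateS d B τ L μ σ ε))) := by
  have hA : (1 : ℝ) ≤ 28 * 20000 ^ 2 := by norm_num
  have hlA : 0 ≤ Real.log (4 * (28 * 20000 ^ 2)) := Real.log_nonneg (by linarith)
  -- C = 20000 is the constant of the error bound, c₂ = 1/(4C), and 28C² that of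
  -- `two_div_β_ofScale_le`. The cube has one logarithm from the number of iterations and two from
  -- the squared number of levels.
  refine ⟨1 / 2500, 1 / (4 * 20000), 20000, Polynomial.C (14 * (28 * 20000 ^ 2) *
    (2 * Real.log (4 * (28 * 20000 ^ 2)) + 3) ^ 2) * Polynomial.X ^ 3, by norm_num, by norm_num,
    by norm_num, by norm_num, ?_, ?_⟩
  · intro d τ B N L μ σ Δ γ t hd hτ hB hL hμ hσ _ hγ hγL ht Z _ Q _ π ξ _ _ F δ f xs x0 h
    have hLγ : L * γ ≤ 3 / 4 := by
      rw [le_div_iff₀ (by positivity)] at hγL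
      linarith
    refine le_trans (lintegral_mono fun ω => ENNReal.ofReal_le_ofReal
      (errR_le_potential h.smooth h.stronglyConvex hL.le hμ h.minimizer t _)) ?_
    exact IsProblem.lintegral_potential_le_errBound (H := Hyper.ofScale (1 / 2500) μ γ t d B) ξ hd hτ
      h hσ hL.le (Hyper.p_ofScale_pos μ γ t d hB) (Hyper.p_ofScale_le_one μ γ t d hB) hμ hγ hLγ ht hB
      (Hyper.p_ofScale_small μ γ t d hB) x0 N
  · intro d τ B L μ σ R hd hτ hB hL hμ hσ hR
    have hd' : (0 : ℝ) < d := by exact_mod_cast hd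
    have hB' : (0 : ℝ) < B := by exact_mod_cast hB
    set q := max 1 ((d : ℝ) / B) * √(L / μ) with hq
    have hq0 : 0 < q := mul_pos (by positivity) (Real.sqrt_pos.2 (by positivity))
    set R' := (L / (2 * μ) + 1) * R ^ 2 + 1 with hR'
    have hR1 : 1 ≤ R' := le_add_of_nonneg_left (by positivity)
    -- Here r is 1/p, and v makes the constant in log(4CR'/ε) at most log(1/ε).
    obtain ⟨ε₀, hε₀, hε₀'⟩ := exists_accuracy_threshold (q := q) (a := L * d * (d + τ) * σ ^ 2)
      (b := B * μ ^ 3) (κ := L * d ^ 2 / (μ * B)) (r := 2500 * (1 + d / B))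
      (v := Real.log (4 * 20000 * R')) hq0 (by positivity) (by positivity)
    refine ⟨ε₀, hε₀, fun ε hε hεε => ?_⟩
    obtain ⟨hℓ, hv, hX, hκX, hκS, hr, hsX⟩ := hε₀' ε hε hεε
    set t := √(ε * μ / (4 * 20000 * L)) with ht
    have ht0 : 0 < t := Real.sqrt_pos.2 (by positivity)
    have ht2 : t ^ 2 = ε * μ / (4 * 20000 * L) := Real.sq_sqrt (by positivity)
    set K := σ ^ 2 * (d * (d + τ)) / (t ^ 2 * B) + t ^ 2 * (L ^ 2 * d ^ 2 / B) with hK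
    have hK0 : 0 < K := by positivity
    -- Written without γ, which is chosen from p; it agrees definitionally with `H.p` below.
    set p := 1 / 2500 * ((B : ℝ) / (B + d)) with hp
    have hp0 : 0 < p := by positivity
    set γ := targetStep L μ ε 20000 p K with hγ
    have hγ0 : 0 < γ := targetStep_pos hL hμ hε (by norm_num) hp0 hK0
    have hγL : γ ≤ 3 / (4 * L) := targetStep_le hL.le hμ.le hε.le (by norm_num) hp0.le hK0.le
    have hLγ : L * γ ≤ 3 / 4 := by
      rw [le_div_iff₀ (by positivity)] at hγL
      linarith
    set H := Hyper.ofScale (1 / 2500) μ γ t d B with hH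
    have hHp : 0 < H.p := Hyper.p_ofScale_pos μ γ t d hB
    have hHp1 : H.p ≤ 1 := Hyper.p_ofScale_le_one μ γ t d hB
    have hβ : 0 < H.β := Hyper.β_pos hHp hμ hγ0
    refine ⟨γ, t, ⌈2 / H.β * Real.log (4 * 20000 * R' / ε)⌉₊, hγ0, hγL, ht0, ?_⟩
    intro Z _ Q _ π ξ _ _ F δ f xs x0 Δ h hx hΔ
    have herr : ∫⁻ ω, ENNReal.ofReal (errR μ f xs
        (iter H F δ x0 ⌈2 / H.β * Real.log (4 * 20000 * R' / ε)⌉₊ ω)) ∂sampleLaw d ξ Q ≤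
          ENNReal.ofReal ε := by
      refine le_trans (lintegral_mono fun ω => ENNReal.ofReal_le_ofReal
        (errR_le_potential h.smooth h.stronglyConvex hL.le hμ h.minimizer t _)) ?_
      refine (IsProblem.lintegral_potential_le_errBound (H := H) ξ hd hτ h hσ hL.le hHp hHp1 hμ hγ0
        hLγ ht0 hB (Hyper.p_ofScale_small μ γ t d hB) x0 _).trans (ENNReal.ofReal_le_ofReal ?_)
      have := errBound_le (H := H) (τ := τ) (σ := σ) (C := 20000) hd hL hμ hHp hγ0 hε (by norm_num)
        (by linarith : 0 < R') (errR_initial_le h.smooth hL.le hμ h.minimizer hx) (Nat.le_ceil _) ht2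
        (mul_sqrt_targetStep_le hμ hε.le (by norm_num) hp0 hK0)
        ((abs_nonneg _).trans (h.perturbation_bounded 0)) hΔ
      rw [le_div_iff₀ (by norm_num)] at this
      refine le_trans (le_of_eq ?_) this
      rw [mul_comm]
      rfl
    refine ⟨le_trans (lintegral_mono fun ω => ENNReal.ofReal_le_ofReal
      (sq_norm_le_errR hμ h.minimizer _)) herr, herr, ?_⟩
    refine (lintegral_calls_le hHp hHp1 hd ξ Q F δ x0 _).trans (ENNReal.ofReal_le_ofReal ?_)
    have hlog : Real.log (4 * 20000 * R' / ε) =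
        Real.log (4 * 20000 * R') + Real.log (1 / ε) := by
      rw [← Real.log_mul (by positivity) (by positivity), mul_one_div]
    have hlog0 : 0 ≤ Real.log (4 * 20000 * R') := Real.log_nonneg (by linarith)
    have hinv : 1 / H.p = 2500 * (1 + d / B) := Hyper.inv_p_ofScale μ γ t d hB
    have hdB : (0 : ℝ) ≤ d / B := by positivity
    have hℓ' : 0 ≤ Real.log (4 * 20000 * R' / ε) := hlog ▸ by positivity
    have key := iterations_mul_calls_le (A := 28 * 20000 ^ 2) (q := q)
      (s := L * d * (d + τ) * σ ^ 2 / (B * μ ^ 3 * ε ^ 2)) (κ := L * d ^ 2 / (μ * B))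
      (ℓ := Real.log (1 / ε)) (ℓ' := Real.log (4 * 20000 * R' / ε)) (S := rateS d B τ L μ σ ε)
      (r := 2500 * (1 + d / B)) (nb := 2 / H.β) hA (by positivity) (by positivity) (by linarith)
      (by positivity) (two_div_β_ofScale_le hd hB hL hμ hε le_rfl ht2 rfl) hℓ
      (by linarith) hq0.le rfl hX hκX hκS hr hsX hℓ'
    rw [← hinv] at key
    have e : (Polynomial.eval (Real.log (rateS d B τ L μ σ ε)) (Polynomial.C (14 * (28 * 20000 ^ 2) *
        (2 * Real.log (4 * (28 * 20000 ^ 2)) + 3) ^ 2) * Polynomial.X ^ 3)) =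
        14 * (28 * 20000 ^ 2) * (2 * Real.log (4 * (28 * 20000 ^ 2)) + 3) ^ 2 *
          Real.log (rateS d B τ L μ σ ε) ^ 3 := by
      rw [Polynomial.eval_mul, Polynomial.eval_C, Polynomial.eval_pow, Polynomial.eval_X]
    rw [e]
    have := mul_le_mul_of_nonneg_left key hB'.le
    refine le_trans (le_of_eq ?_) this
    change _ * (2 * ((B : ℝ) * _)) = (B : ℝ) * (_ * (2 * _))
    rw [mul_left_comm 2, mul_left_comm]
    rfl
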